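/- **Conventions.** Let $(\Sigma,\mu)$ be a $\sigma$-finite measure space and $L_0$ the space of complex measurable functions modulo equality a.e. A Köthe space is a linear subspace $X\subseteq L_0$ with a complete norm such that $f\in L_0$, $g\in X$, $|f|\le|g|$ a.e. imply $f\in X$ and $\|f\|_X\le\|g\|_X$. Its Köthe dual $X^*$ is the space of $g\in L_0$ with $\|g\|_{X^*}=\sup\{\int|fg|\,d\mu:\|f\|_X\le1\}<\infty$. For $p\geq 1$, the $p$-convexification of $X$ is $\{f\in L_0:|f|^p\in X\}$ with norm $\||f|^p\|_X^{1/p}$. For a pair $(X_0,X_1)$ and $0<\theta<1$, let $\mathcal F(X_0,X_1)$ be Calderón's space of bounded continuous functions $F:\{0\le\operatorname{Re}z\le1\}\to X_0+X_1$ that are analytic in the open strip and for which $t\mapsto F(j+it)$ is continuous into $X_j$ and tends to $0$ in $X_j$ as $|t|\to\infty$ ($j=0,1$), normed by $\|F\|=\max_j\sup_t\|F(j+it)\|_{X_j}$. Then $[X_0,X_1]_\theta=\{F(\theta):F\in\mathcal F(X_0,X_1)\}$ with the quotient norm. A differential (associated centralizer) of $(X_0,X_1)$ at $\theta$ is a map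 $\Omega f=(B f)'(\theta)$ on $[X_0,X_1]_\theta$, where $B:[X_0,X_1]_\theta\to\mathcal F(X_0,X_1)$ is a homogeneous bounded map with $(Bf)(\theta)=f$. Two maps $\Omega,\Psi$ on a space $Z$ are boundedly equivalent if $\|\Omega f-\Psi f\|_Z\le C\|f\|_Z$ for all $f\in Z$ and some constant $C$. The Kalton–Peck map is $\mathsf{KP}_2f=2f\log(|f|/\|f\|_2)$ on $L_2=L_2(\mu)$. Equality of interpolation spaces with $L_2$ is equality as sets with equivalent norms. **Proposition.** Let $X$ be a Köthe space such that $[X,X^*]_{1/2}=L_2$, let $\Omega_X$ be any differential of $(X,X^*)$ at $1/2$, and let $0<\theta<1$. Let $X_\theta$ be $[X,L_\infty]_\theta$, or let $X_\theta$ be the $(1-\theta)^{-1}$-convexification of $X$. Then, in either case, $[X_\theta,X_\theta^*]_{1/2}=L_2$, the map $$(1-\theta)\,\Omega_X+\theta\,\mathsf{KP}_2$$ is a differential of the pair $(X_\theta,X_\theta^*)$ at $1/2$, and every differential $\Omega_{X_\theta}$ of $(X_\theta,X_\theta^*)$ at $1/2$ is boundedly equivalent to it on $L_2$. -/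

import Mathlib

open MeasureTheory Filter Topology
open scoped ENNReal NNReal

noncomputable section

namespace Kothe

variable {α : Type*} [MeasurableSpace α] {μ : Measure α}

/-- An extended norm on `L₀(μ)`: the space it describes is the set of all (classes of) functions
at which it is finite. All spaces below are given in this form. -/
abbrev ExtNorm (μ : Measure α) : Type _ := (α →ₘ[μ] ℂ) → ℝ≥0∞

/-- The extended norm of `L_p(μ)`. -/
def normLp (μ : Measure α) (p : ℝ≥0∞) : ExtNorm μ := fun f => eLpNorm f p μ

/-- `N` is the norm of a (complex, complete) Köthe space: an `L_∞`-submodule of `L₀`, i.e. a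
solid subspace, with a complete norm such that `|f| ≤ |g|` implies `‖f‖ ≤ ‖g‖`. -/
structure IsKothe (N : ExtNorm μ) : Prop where
  map_zero : N 0 = 0
  eq_zero : ∀ f, N f = 0 → f = 0
  add_le : ∀ f g, N (f + g) ≤ N f + N g
  smul : ∀ (c : ℂ) f, N (c • f) = ‖c‖ₑ * N f
  mono : ∀ f g : α →ₘ[μ] ℂ, (∀ᵐ x ∂μ, ‖f x‖ ≤ ‖g x‖) → N f ≤ N g
  complete : ∀ u : ℕ → (α →ₘ[μ] ℂ), (∀ n, N (u n) < ∞) →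
    (∀ ε : ℝ≥0∞, 0 < ε → ∃ n₀, ∀ m ≥ n₀, ∀ n ≥ n₀, N (u m - u n) < ε) →
    ∃ f, N f < ∞ ∧ Tendsto (fun n => N (u n - f)) atTop (𝓝 0)

/-- The Köthe dual `X^*`, with norm `g ↦ sup {∫ |f g| dμ : ‖f‖_X ≤ 1}`. -/
def dual (N : ExtNorm μ) : ExtNorm μ :=
  fun g => ⨆ f : {f : α →ₘ[μ] ℂ // N f ≤ 1}, ∫⁻ x, ‖f.1 x‖ₑ * ‖g x‖ₑ ∂μ

/-- The two spaces coincide as subsets of `L₀` and their norms are equivalent. -/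
def SameSpace (N M : ExtNorm μ) : Prop :=
  ∃ C : ℝ≥0, 0 < C ∧ ∀ f, N f ≤ C * M f ∧ M f ≤ C * N f

/-- The function `|f|^p`. -/
def absPow (p : ℝ) (f : α →ₘ[μ] ℂ) : α →ₘ[μ] ℂ :=
  AEEqFun.compMeasurable (fun z : ℂ => ((‖z‖ ^ p : ℝ) : ℂ)) (by fun_prop) f

/-- The `p`-convexification `{f : |f|^p ∈ X}` of `X`, with norm `‖ |f|^p ‖_X^{1/p}`. -/
def convexification (p : ℝ) (N : ExtNorm μ) : ExtNorm μ :=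
  fun f => N (absPow p f) ^ (1 / p)

/-- The norm of the sum `X₀ + X₁`. -/
def sumNorm (N₀ N₁ : ExtNorm μ) : ExtNorm μ :=
  fun f => ⨅ p : {p : (α →ₘ[μ] ℂ) × (α →ₘ[μ] ℂ) // p.1 + p.2 = f}, N₀ p.1.1 + N₁ p.1.2

/-- The open unit strip. -/
def strip : Set ℂ := {z | 0 < z.re ∧ z.re < 1}

/-- The closed unit strip. -/
def closedStrip : Set ℂ := {z | 0 ≤ z.re ∧ z.re ≤ 1}

/-- `F` has complex derivative `D` at `z` in the space with norm `N`. -/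
def HasDerivIn (N : ExtNorm μ) (F : ℂ → (α →ₘ[μ] ℂ)) (z : ℂ) (D : α →ₘ[μ] ℂ) : Prop :=
  N D < ∞ ∧ Tendsto (fun w => N ((w - z)⁻¹ • (F w - F z) - D)) (𝓝[≠] z) (𝓝 0)

/-- Membership in Calderón's space `𝓕(X₀, X₁)`: `F` is bounded and continuous on the closed strip
with values in `X₀ + X₁`, analytic in the open strip, and `t ↦ F (j + i t)` is continuous into
`X_j` and tends to `0` in `X_j` as `|t| → ∞`, for `j = 0, 1`. Values off the closed strip are
irrelevant. -/
structure MemCalderon (N₀ N₁ : ExtNorm μ) (F : ℂ → (α →ₘ[μ] ℂ)) : Prop where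
  bounded : ∃ C : ℝ≥0, ∀ z ∈ closedStrip, sumNorm N₀ N₁ (F z) ≤ C
  continuous : ∀ z ∈ closedStrip,
    Tendsto (fun w => sumNorm N₀ N₁ (F w - F z)) (𝓝[closedStrip] z) (𝓝 0)
  analytic : ∀ z ∈ strip, ∃ D, HasDerivIn (sumNorm N₀ N₁) F z D
  mem_left : ∀ t : ℝ, N₀ (F (t * Complex.I)) < ∞
  continuous_left : ∀ t : ℝ,
    Tendsto (fun s : ℝ => N₀ (F (s * Complex.I) - F (t * Complex.I))) (𝓝 t) (𝓝 0)
  decay_left : Tendsto (fun t : ℝ => N₀ (F (t * Complex.I))) (cocompact ℝ) (𝓝 0)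
  mem_right : ∀ t : ℝ, N₁ (F (1 + t * Complex.I)) < ∞
  continuous_right : ∀ t : ℝ,
    Tendsto (fun s : ℝ => N₁ (F (1 + s * Complex.I) - F (1 + t * Complex.I))) (𝓝 t) (𝓝 0)
  decay_right : Tendsto (fun t : ℝ => N₁ (F (1 + t * Complex.I))) (cocompact ℝ) (𝓝 0)

/-- The norm of Calderón's space. -/
def calderonNorm (N₀ N₁ : ExtNorm μ) (F : ℂ → (α →ₘ[μ] ℂ)) : ℝ≥0∞ :=
  max (⨆ t : ℝ, N₀ (F (t * Complex.I))) (⨆ t : ℝ, N₁ (F (1 + t * Complex.I)))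

/-- The complex interpolation space `[X₀, X₁]_θ`, with its quotient norm
(which is `∞` at functions that are not of the form `F θ` with `F ∈ 𝓕(X₀, X₁)`). -/
def interp (N₀ N₁ : ExtNorm μ) (θ : ℝ) : ExtNorm μ :=
  fun f => ⨅ F : {F : ℂ → (α →ₘ[μ] ℂ) // MemCalderon N₀ N₁ F ∧ F (θ : ℂ) = f},
    calderonNorm N₀ N₁ F.1

/-- `Ω` is a differential of the pair `(X₀, X₁)` at `θ`: there is a homogeneous bounded selection
`B : [X₀, X₁]_θ → 𝓕(X₀, X₁)` of the evaluation map at `θ`, and `Ω f = (B f)'(θ)` for all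
`f ∈ [X₀, X₁]_θ`. Values of `Ω` off `[X₀, X₁]_θ` are irrelevant. -/
def IsDifferential (N₀ N₁ : ExtNorm μ) (θ : ℝ) (Ω : (α →ₘ[μ] ℂ) → (α →ₘ[μ] ℂ)) : Prop :=
  ∃ (B : (α →ₘ[μ] ℂ) → ℂ → (α →ₘ[μ] ℂ)) (K : ℝ≥0),
    (∀ (c : ℂ) (f : α →ₘ[μ] ℂ), interp N₀ N₁ θ f < ∞ → B (c • f) = c • B f) ∧
    ∀ f, interp N₀ N₁ θ f < ∞ →
      MemCalderon N₀ N₁ (B f) ∧ B f (θ : ℂ) = f ∧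
      calderonNorm N₀ N₁ (B f) ≤ K * interp N₀ N₁ θ f ∧
      HasDerivIn (sumNorm N₀ N₁) (B f) (θ : ℂ) (Ω f)

/-- `Ω` and `Ψ` are boundedly equivalent on `X`: their difference is a bounded map `X → X`. -/
def BoundedlyEquivalent (N : ExtNorm μ) (Ω Ψ : (α →ₘ[μ] ℂ) → (α →ₘ[μ] ℂ)) : Prop :=
  ∃ C : ℝ≥0, ∀ f, N f < ∞ → N (Ω f - Ψ f) ≤ C * N f

/-- The Kalton–Peck map `KP_p f = p f log (|f| / ‖f‖_p)`, so that `KP_p f = p f log |f|` if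
`‖f‖_p = 1`. -/
def kaltonPeck (p : ℝ) (f : α →ₘ[μ] ℂ) : α →ₘ[μ] ℂ :=
  AEEqFun.compMeasurable
    (fun z : ℂ => (p : ℂ) * z *
      (Real.log (‖z‖ / (normLp μ (ENNReal.ofReal p) f).toReal) : ℂ)) (by fun_prop) f

end Kothe

end

/-! The mechanism is an explicit formula. Suppose `|f|² = ab` with `a ≥ 0` in `X` and `b ≥ 0` in
`X^*`, both of norm at most `r`, where `r` is comparable to `‖f‖₂`. Up to a Gaussian factor, `F(z) =
sgn(f) a^{1-z} b^z` lies in Calderón's space of `(X, X^*)`, with `F(1/2) = f` and `F'(1/2) = f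
log(b/a)`. Now put `a' = a^{1-θ} r^θ` and `b' = b^{1-θ} (|f|²/r)^θ`. Again `a'b' = |f|²`, and `a'`
has norm `O(r)` in `X_θ`. By Hölder's inequality (`IsScaling.dual_le`) `b'` has norm `O(r)` in
`X_θ^*`, and `f log(b'/a') = (1-θ) f log(b/a) + 2θ f log(|f|/r)`. The last term is `θ KP₂ f` up to
the choice of `r`. This computation is `IsScaling.exists_pieces`; the only facts about `X_θ` that it
needs are collected in `IsScaling`, which both choices of the space satisfy.

The factorization comes from a pointwise estimate, `exists_calderon_bound`: for every `F` in
Calderón's space, `|F(s)| ≤ a^{1-s} b^s` a.e., where `a` and `b` are multiples of kernel averages of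
`|F|` over the two edges; if `F(s) = 0`, then `|F'(s)|` obeys the same bound. It is proved by
testing `F` against functionals, using a Cauchy formula on the strip with weights `exp((z-s)c)`, and
optimising over `c`. For the pair `(X, X^*)` at `1/2` it has three consequences. The midpoint space
embeds in `L₂`; since that space is assumed to be `L₂`, every `f` in `L₂` factors
(`exists_factorization`); and two functions of Calderón's space with the same value at `1/2` have
derivatives whose difference is bounded in `L₂`. The last fact makes all differentials boundedly
equivalent.

The formula is applied only where `f` and `b` are bounded above and below and `a` is bounded below,
because there analyticity is uniform in the point and no continuity of the norms is required. So the
measure space is cut into sets `A n`, up to a set on which `f = 0`: the part of `f` not covered by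
`A 0, …, A (n-1)` has `L₂`-norm at most `‖f‖₂ / 2^n`, is factored afresh, and `A n` is taken where
its factors are tame. The local functions have geometrically decreasing norms and are summed
(`exists_piece_union`). On `A n` the logarithm is taken relative to a scale of order `‖f‖₂ / 2^n`
instead of `‖f‖₂`. This changes it by `O(n + 1)`, which is square summable against the masses
`4^{-n}`, so `IsScaling.exists_link` relates the two derivatives up to an `L₂`-bounded error.

This error lies in the midpoint space, hence equals `H(1/2)` for some `H`. Adding `ψ H`, where `ψ`
has a simple zero at `1/2`, makes the derivative exactly `(1-θ) Ω f + θ KP₂ f`, and homogeneity of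
the selection follows by choosing one representative on each complex line. -/

noncomputable section

namespace Kothe

variable {α : Type*} [MeasurableSpace α] {μ : Measure α}

/-! ### Solid norms and the normed spaces that they define. -/

/-- `N` is a norm with the ideal property, not necessarily complete. -/
structure IsSolid (N : ExtNorm μ) : Prop where
  map_zero : N 0 = 0
  eq_zero : ∀ f, N f = 0 → f = 0
  add_le : ∀ f g, N (f + g) ≤ N f + N g
  smul : ∀ (c : ℂ) f, N (c • f) = ‖c‖ₑ * N f
  mono : ∀ f g : α →ₘ[μ] ℂ, (∀ᵐ x ∂μ, ‖f x‖ ≤ ‖g x‖) → N f ≤ N g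

theorem IsKothe.isSolid {N : ExtNorm μ} (h : IsKothe N) : IsSolid N :=
  ⟨h.map_zero, h.eq_zero, h.add_le, h.smul, h.mono⟩

/-- The pointwise absolute value of a class of functions. -/
def absL (f : α →ₘ[μ] ℂ) : α →ₘ[μ] ℂ :=
  AEEqFun.compMeasurable (fun z : ℂ => ((‖z‖ : ℝ) : ℂ)) (by fun_prop) f

theorem coeFn_absL (f : α →ₘ[μ] ℂ) : ∀ᵐ x ∂μ, absL f x = (‖f x‖ : ℂ) :=
  AEEqFun.coeFn_compMeasurable _ _ f

/-- The indicator function of a measurable set, as a class of functions. -/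
def chi (μ : Measure α) {A : Set α} (hA : MeasurableSet A) : α →ₘ[μ] ℂ :=
  AEEqFun.mk (A.indicator 1)
    ((measurable_one.indicator hA : Measurable (A.indicator (1 : α → ℂ))).aestronglyMeasurable)

theorem coeFn_chi {A : Set α} (hA : MeasurableSet A) :
    ∀ᵐ x ∂μ, chi μ hA x = A.indicator 1 x :=
  AEEqFun.coeFn_mk _ _

theorem chi_mul_apply {A : Set α} (hA : MeasurableSet A) (f : α →ₘ[μ] ℂ) :
    ∀ᵐ x ∂μ, (chi μ hA * f) x = A.indicator f x := by
  filter_upwards [AEEqFun.coeFn_mul (chi μ hA) f, coeFn_chi (μ := μ) hA] with x h1 h2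
  rw [h1, Pi.mul_apply, h2]
  by_cases hx : x ∈ A <;> simp [hx]

theorem mul_add_L0 (m f g : α →ₘ[μ] ℂ) : m * (f + g) = m * f + m * g := by
  apply AEEqFun.ext
  filter_upwards [AEEqFun.coeFn_mul m (f + g), AEEqFun.coeFn_mul m f, AEEqFun.coeFn_mul m g,
    AEEqFun.coeFn_add f g, AEEqFun.coeFn_add (m * f) (m * g)] with x h1 h2 h3 h4 h5
  simp only [h1, h2, h3, h4, h5, Pi.mul_apply, Pi.add_apply, mul_add]

theorem mul_smul_L0 (c : ℂ) (m f : α →ₘ[μ] ℂ) : m * (c • f) = c • (m * f) := by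
  apply AEEqFun.ext
  filter_upwards [AEEqFun.coeFn_mul m (c • f), AEEqFun.coeFn_mul m f,
    AEEqFun.coeFn_smul c f, AEEqFun.coeFn_smul c (m * f)] with x h1 h2 h3 h4
  simp only [h1, h2, h3, h4, Pi.mul_apply, Pi.smul_apply, smul_eq_mul]
  ring

theorem mul_sub_L0 (m f g : α →ₘ[μ] ℂ) : m * (f - g) = m * f - m * g :=
  map_sub (AddMonoidHom.mk' (fun f => m * f) (mul_add_L0 m)) f g

theorem eq_zero_iff_ae {f : α →ₘ[μ] ℂ} : f = 0 ↔ ∀ᵐ x ∂μ, f x = 0 := by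
  constructor
  · rintro rfl
    exact AEEqFun.coeFn_zero
  · intro h
    apply AEEqFun.ext
    filter_upwards [h, AEEqFun.coeFn_zero (μ := μ) (β := ℂ)] with x h1 h2
    rw [h1, h2]; rfl

namespace IsSolid

variable {N : ExtNorm μ} (h : IsSolid N)
include h

theorem congr_norm {f g : α →ₘ[μ] ℂ} (hfg : ∀ᵐ x ∂μ, ‖f x‖ = ‖g x‖) : N f = N g :=
  le_antisymm (h.mono _ _ (hfg.mono fun _ hx => hx.le)) (h.mono _ _ (hfg.mono fun _ hx => hx.ge))

theorem abs_eq (f : α →ₘ[μ] ℂ) : N (absL f) = N f :=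
  h.congr_norm ((coeFn_absL f).mono fun x hx => by rw [hx]; simp)

theorem neg_eq (f : α →ₘ[μ] ℂ) : N (-f) = N f :=
  h.congr_norm ((AEEqFun.coeFn_neg f).mono fun x hx => by rw [hx]; simp)

theorem sub_comm' (f g : α →ₘ[μ] ℂ) : N (f - g) = N (g - f) := by
  rw [← h.neg_eq, neg_sub]

theorem sub_le (f g : α →ₘ[μ] ℂ) : N (f - g) ≤ N f + N g := by
  rw [sub_eq_add_neg, ← h.neg_eq g]
  exact h.add_le _ _

theorem mono_smul {f g : α →ₘ[μ] ℂ} (C : ℝ≥0) (hfg : ∀ᵐ x ∂μ, ‖f x‖ ≤ C * ‖g x‖) :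
    N f ≤ C * N g := by
  have : N f ≤ N ((C : ℂ) • g) := by
    apply h.mono
    filter_upwards [hfg, AEEqFun.coeFn_smul (C : ℂ) g] with x h1 h2
    rw [h2]
    simpa using h1
  rw [h.smul] at this
  convert this using 2
  simp [enorm_eq_nnnorm]

/-- The linear space on which `N` is finite. -/
def toSubmodule : Submodule ℂ (α →ₘ[μ] ℂ) where
  carrier := {f | N f < ∞}
  add_mem' hf hg := (h.add_le _ _).trans_lt (ENNReal.add_lt_top.2 ⟨hf, hg⟩)
  zero_mem' := by simp [h.map_zero]
  smul_mem' c f hf := by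
    simp only [Set.mem_ofPred_eq] at hf ⊢
    rw [h.smul]
    exact ENNReal.mul_lt_top enorm_lt_top hf

end IsSolid

/-- The normed space of all functions with finite norm. -/
def Sp {N : ExtNorm μ} (h : IsSolid N) : Type _ := h.toSubmodule

namespace Sp

variable {N : ExtNorm μ} {h : IsSolid N}

instance : AddCommGroup (Sp h) := inferInstanceAs (AddCommGroup h.toSubmodule)

instance : Module ℂ (Sp h) := inferInstanceAs (Module ℂ h.toSubmodule)

/-- The class of functions underlying an element of the space. -/
def val (f : Sp h) : α →ₘ[μ] ℂ := h.toSubmodule.subtype f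

theorem val_lt_top (f : Sp h) : N f.val < ∞ := Subtype.property (p := fun f => f ∈ h.toSubmodule) f

theorem val_ne_top (f : Sp h) : N f.val ≠ ∞ := f.val_lt_top.ne

@[ext] theorem ext {f g : Sp h} (hfg : f.val = g.val) : f = g := Subtype.ext hfg

@[simp] theorem val_zero : (0 : Sp h).val = 0 := rfl
@[simp] theorem val_add (f g : Sp h) : (f + g).val = f.val + g.val := rfl
@[simp] theorem val_sub (f g : Sp h) : (f - g).val = f.val - g.val := rfl
@[simp] theorem val_neg (f : Sp h) : (-f).val = -f.val := rfl
@[simp] theorem val_smul (c : ℂ) (f : Sp h) : (c • f).val = c • f.val := rfl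
@[simp] theorem val_sum {ι : Type*} (s : Finset ι) (u : ι → Sp h) :
    (∑ i ∈ s, u i).val = ∑ i ∈ s, (u i).val := map_sum h.toSubmodule.subtype u s

instance : NormedAddCommGroup (Sp h) :=
  AddGroupNorm.toNormedAddCommGroup
    { toFun := fun f => (N f.val).toReal
      map_zero' := by simp [h.map_zero]
      add_le' := fun f g => by
        rw [← ENNReal.toReal_add f.val_ne_top g.val_ne_top]
        exact ENNReal.toReal_mono (by simp [f.val_ne_top, g.val_ne_top]) (h.add_le _ _)
      neg' := fun f => by simp only [val_neg, h.neg_eq]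
      eq_zero_of_map_eq_zero' := fun f hf =>
        ext (h.eq_zero _ (by simpa [ENNReal.toReal_eq_zero_iff, f.val_ne_top] using hf)) }

theorem norm_def (f : Sp h) : ‖f‖ = (N f.val).toReal := rfl

instance : NormedSpace ℂ (Sp h) where
  norm_smul_le c f := by simp [norm_def, h.smul]

theorem enorm_eq (f : Sp h) : ‖f‖ₑ = N f.val := by
  rw [← ofReal_norm, norm_def, ENNReal.ofReal_toReal f.val_ne_top]

theorem edist_eq (f g : Sp h) : edist f g = N (f.val - g.val) := by
  rw [edist_eq_enorm_sub, enorm_eq, val_sub]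

/-- A function of finite norm, as an element of the space. -/
def ofFinite (h : IsSolid N) (f : α →ₘ[μ] ℂ) (hf : N f < ∞) : Sp h :=
  Subtype.mk (p := fun f => f ∈ h.toSubmodule) f hf

/-- An element of the space, given by a function of finite norm; `0` if the norm is not finite. -/
def of (h : IsSolid N) (f : α →ₘ[μ] ℂ) : Sp h :=
  open Classical in if hf : N f < ∞ then ofFinite h f hf else 0

theorem val_of {f : α →ₘ[μ] ℂ} (hf : N f < ∞) : (of h f).val = f := by
  rw [of, dif_pos hf]; rfl

theorem of_val (f : Sp h) : of h f.val = f := ext (val_of f.val_lt_top)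

theorem enorm_of {f : α →ₘ[μ] ℂ} (hf : N f < ∞) : ‖of h f‖ₑ = N f := by rw [enorm_eq, val_of hf]

theorem norm_of {f : α →ₘ[μ] ℂ} (hf : N f < ∞) : ‖of h f‖ = (N f).toReal := by
  rw [norm_def, val_of hf]

theorem tendsto_iff {ι : Type*} {l : Filter ι} {u : ι → Sp h} {f : Sp h} :
    Tendsto u l (𝓝 f) ↔ Tendsto (fun i => N ((u i).val - f.val)) l (𝓝 0) := by
  rw [tendsto_iff_edist_tendsto_0]
  simp only [edist_eq]

theorem norm_le_iff {f : Sp h} {C : ℝ≥0} : ‖f‖ ≤ C ↔ N f.val ≤ C := by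
  rw [← enorm_eq f, ← ofReal_norm, ← ENNReal.ofReal_coe_nnreal,
    ENNReal.ofReal_le_ofReal_iff C.coe_nonneg]

/-- Pointwise multiplication by a bounded function. -/
def mulBdd (h : IsSolid N) (m : α →ₘ[μ] ℂ) (C : ℝ≥0) (hm : ∀ᵐ x ∂μ, ‖m x‖ ≤ C) :
    Sp h →L[ℂ] Sp h :=
  have key (f : Sp h) : N (m * f.val) ≤ C * N f.val := h.mono_smul C (by
    filter_upwards [hm, AEEqFun.coeFn_mul m f.val] with x h1 h2
    rw [h2, Pi.mul_apply, norm_mul]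
    gcongr)
  have key' (f : Sp h) : N (m * f.val) < ∞ :=
    (key f).trans_lt (ENNReal.mul_lt_top ENNReal.coe_lt_top f.val_lt_top)
  LinearMap.mkContinuous
    { toFun := fun f => of h (m * f.val)
      map_add' := fun f g => ext (by
        rw [val_of (key' (f + g)), val_add, val_add, val_of (key' f), val_of (key' g),
          mul_add_L0])
      map_smul' := fun c f => ext (by
        rw [val_of (key' (c • f)), RingHom.id_apply, val_smul, val_smul, val_of (key' f),
          mul_smul_L0]) } C (fun f => by
      simp only [LinearMap.coe_mk, AddHom.coe_mk]
      rw [norm_of (key' f), norm_def, ← ENNReal.coe_toReal, ← ENNReal.toReal_mul]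
      exact ENNReal.toReal_mono (ENNReal.mul_ne_top ENNReal.coe_ne_top f.val_ne_top) (key f))

theorem val_mulBdd (m : α →ₘ[μ] ℂ) (C : ℝ≥0) (hm : ∀ᵐ x ∂μ, ‖m x‖ ≤ C) (f : Sp h) :
    (mulBdd h m C hm f).val = m * f.val :=
  val_of ((h.mono_smul C (by
    filter_upwards [hm, AEEqFun.coeFn_mul m f.val] with x h1 h2
    rw [h2, Pi.mul_apply, norm_mul]
    gcongr)).trans_lt (ENNReal.mul_lt_top ENNReal.coe_lt_top f.val_lt_top))

theorem completeSpace (hN : IsKothe N) (h : IsSolid N) : CompleteSpace (Sp h) := by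
  apply UniformSpace.complete_of_cauchySeq_tendsto
  intro u hu
  obtain ⟨f, hf, hlim⟩ := hN.complete (fun n => (u n).val) (fun n => (u n).val_lt_top) (by
    intro ε hε
    obtain ⟨n₀, hn₀⟩ := EMetric.cauchySeq_iff.1 hu ε hε
    exact ⟨n₀, fun m hm n hn => by simpa [edist_eq] using hn₀ m hm n hn⟩)
  exact ⟨of h f, tendsto_iff.2 (by simpa only [val_of hf] using hlim)⟩

end Sp

theorem IsSolid.isKothe {N : ExtNorm μ} (h : IsSolid N) [CompleteSpace (Sp h)] : IsKothe N where
  __ := h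
  complete u hu hc := by
    have : CauchySeq (fun n => Sp.of h (u n)) := by
      rw [EMetric.cauchySeq_iff]
      intro ε hε
      obtain ⟨n₀, hn₀⟩ := hc ε hε
      exact ⟨n₀, fun m hm n hn => by
        rw [Sp.edist_eq, Sp.val_of (hu m), Sp.val_of (hu n)]; exact hn₀ m hm n hn⟩
    obtain ⟨f, hf⟩ := cauchySeq_tendsto_of_complete this
    refine ⟨f.val, f.val_lt_top, ?_⟩
    simpa only [Sp.val_of (hu _)] using Sp.tendsto_iff.1 hf

/-- Convergence in norm is not yet known to give convergence a.e. Monotonicity replaces it: the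
positive part of the `n`-th partial sum minus `|s|` is dominated by every later error, so its norm
is zero. -/
theorem IsSolid.ae_tsum_le_of_tendsto {N : ExtNorm μ} (h : IsSolid N) {u : ℕ → α →ₘ[μ] ℂ}
    {s : α →ₘ[μ] ℂ}
    (hs : Tendsto (fun n => N (∑ k ∈ Finset.range n, absL (u k) - s)) atTop (𝓝 0)) :
    ∀ᵐ x ∂μ, ∑' k, ‖u k x‖ₑ ≤ ‖s x‖ₑ := by
  have hS : ∀ᵐ x ∂μ, ∀ n, (∑ k ∈ Finset.range n, absL (u k) - s) x
      = ((∑ k ∈ Finset.range n, ‖u k x‖ : ℝ) : ℂ) - s x := by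
    refine ae_all_iff.2 fun n => ?_
    filter_upwards [AEEqFun.coeFn_sub (∑ k ∈ Finset.range n, absL (u k)) s,
      AEEqFun.coeFn_fun_finsetSum (μ := μ) (Finset.range n) (fun k => absL (u k)),
      ae_all_iff.2 fun k => coeFn_absL (u k)] with x h1 h2 h3
    rw [h1, Pi.sub_apply, h2]
    simp [h3]
  have key : ∀ n, ∀ᵐ x ∂μ, ∑ k ∈ Finset.range n, ‖u k x‖ ≤ ‖s x‖ := by
    intro n
    have hm : Measurable
        (fun x => ((max (∑ k ∈ Finset.range n, ‖u k x‖ - ‖s x‖) 0 : ℝ) : ℂ)) := by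
      have h1 : ∀ k, Measurable (u k) := fun k => (u k).measurable
      have h2 : Measurable s := s.measurable
      fun_prop
    set d : α →ₘ[μ] ℂ := AEEqFun.mk _ hm.aestronglyMeasurable
    have hd0 : N d = 0 := by
      refine le_antisymm (ge_of_tendsto hs ?_) zero_le
      filter_upwards [eventually_ge_atTop n] with m hmn
      apply h.mono
      filter_upwards [hS, AEEqFun.coeFn_mk _ hm.aestronglyMeasurable] with x h1 h2
      rw [h2, h1, Complex.norm_real, Real.norm_of_nonneg (le_max_right _ _)]
      refine max_le ?_ (norm_nonneg _)
      have h3 : ∑ k ∈ Finset.range n, ‖u k x‖ ≤ ∑ k ∈ Finset.range m, ‖u k x‖ :=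
        Finset.sum_le_sum_of_subset_of_nonneg (Finset.range_mono hmn)
          fun _ _ _ => norm_nonneg _
      have h4 := norm_sub_norm_le ((∑ k ∈ Finset.range m, ‖u k x‖ : ℝ) : ℂ) (s x)
      rw [Complex.norm_real, Real.norm_of_nonneg (Finset.sum_nonneg fun _ _ => norm_nonneg _)] at h4
      linarith
    filter_upwards [eq_zero_iff_ae.1 (h.eq_zero _ hd0),
      AEEqFun.coeFn_mk _ hm.aestronglyMeasurable] with x h1 h2
    rw [h2, Complex.ofReal_eq_zero] at h1
    have := le_max_left (∑ k ∈ Finset.range n, ‖u k x‖ - ‖s x‖) 0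
    linarith
  filter_upwards [ae_all_iff.2 key] with x hx
  refine ENNReal.tsum_le_of_sum_range_le fun n => ?_
  have := ENNReal.ofReal_le_ofReal (hx n)
  rw [ENNReal.ofReal_sum_of_nonneg fun _ _ => norm_nonneg _] at this
  simpa only [ofReal_norm] using this

/-- The Riesz–Fischer property: the absolute values are summed in the complete space. -/
theorem IsKothe.exists_dominating {N : ExtNorm μ} (hN : IsKothe N) {u : ℕ → α →ₘ[μ] ℂ}
    (hu : ∑' n, N (u n) ≠ ∞) :
    ∃ s, N s ≤ ∑' n, N (u n) ∧ ∀ᵐ x ∂μ, ∑' n, ‖u n x‖ₑ ≤ ‖s x‖ₑ := by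
  have h := hN.isSolid
  have := Sp.completeSpace hN h
  have hfin : ∀ n, N (absL (u n)) < ∞ := fun n => by
    rw [h.abs_eq]; exact (ENNReal.ne_top_of_tsum_ne_top hu n).lt_top
  set v : ℕ → Sp h := fun n => Sp.of h (absL (u n)) with hv
  have hv' : ∀ n, ‖v n‖ₑ = N (u n) := fun n => by rw [Sp.enorm_of (hfin n), h.abs_eq]
  have hsum : Summable (fun n => ‖v n‖) := by
    have : Summable (fun n => (N (u n)).toReal) := ENNReal.summable_toReal hu
    simpa [hv, Sp.norm_of (hfin _), h.abs_eq] using this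
  have hs := hsum.of_norm.hasSum
  refine ⟨(∑' n, v n).val, ?_, h.ae_tsum_le_of_tendsto ?_⟩
  · rw [← Sp.enorm_eq (∑' n, v n)]
    simpa only [hv'] using enorm_tsum_le_tsum_enorm (f := v)
  · have := Sp.tendsto_iff.1 hs.tendsto_sum_nat
    simpa only [Sp.val_sum, hv, Sp.val_of (hfin _)] using this

/-- Converse of the Riesz–Fischer property, and the route to completeness of all the spaces built
below. The series converges absolutely a.e., and a majorant of each tail controls the norm of the
remainder. The factor `2` leaves room for almost optimal choices in infima. -/
theorem IsSolid.isKothe_of_dominating {N : ExtNorm μ} (h : IsSolid N)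
    (H : ∀ u : ℕ → α →ₘ[μ] ℂ, ∑' n, N (u n) ≠ ∞ →
      ∃ s, N s ≤ 2 * ∑' n, N (u n) ∧ ∀ᵐ x ∂μ, ∑' n, ‖u n x‖ₑ ≤ ‖s x‖ₑ) : IsKothe N := by
  suffices CompleteSpace (Sp h) from h.isKothe
  apply NormedAddCommGroup.completeSpace_of_summable_imp_tendsto
  intro u hu
  have hfin : ∑' n, N (u n).val ≠ ∞ := by
    have := hu.tsum_ofReal_ne_top
    simpa only [ofReal_norm, Sp.enorm_eq] using this
  have htail : ∀ k, ∑' n, N (u (n + k)).val ≠ ∞ := fun k =>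
    ne_top_of_le_ne_top hfin
      (ENNReal.tsum_comp_le_tsum_of_injective (add_left_injective k) (fun n => N (u n).val))
  choose s hs1 hs2 using fun k => H (fun n => (u (n + k)).val) (htail k)
  have hsumm : ∀ᵐ x ∂μ, Summable (fun n => ‖(u n).val x‖) := by
    filter_upwards [hs2 0] with x hx
    have : ∑' n, ‖(u n).val x‖ₑ ≠ ∞ := ne_top_of_le_ne_top enorm_ne_top hx
    have := ENNReal.summable_toReal this
    simpa using this
  have hmeas : AEStronglyMeasurable (fun x => ∑' n, (u n).val x) μ := by
    refine aestronglyMeasurable_of_tendsto_ae atTop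
      (f := fun n x => ∑ k ∈ Finset.range n, (u k).val x)
      (fun n => Finset.aestronglyMeasurable_fun_sum _ fun k _ => (u k).val.aestronglyMeasurable) ?_
    filter_upwards [hsumm] with x hx
    exact hx.of_norm.hasSum.tendsto_sum_nat
  set f : α →ₘ[μ] ℂ := AEEqFun.mk _ hmeas
  have hbound : ∀ k, N (f - ∑ n ∈ Finset.range k, (u n).val)
      ≤ 2 * ∑' n, N (u (n + k)).val := by
    intro k
    refine (h.mono _ _ ?_).trans (hs1 k)
    filter_upwards [AEEqFun.coeFn_sub f (∑ n ∈ Finset.range k, (u n).val),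
      AEEqFun.coeFn_fun_finsetSum (μ := μ) (Finset.range k) (fun n => (u n).val),
      AEEqFun.coeFn_mk _ hmeas, hsumm, hs2 k] with x h1 h2 h3 h4 h5
    rw [h1, Pi.sub_apply, h2, h3, ← h4.of_norm.sum_add_tsum_nat_add k, add_sub_cancel_left]
    rw [← enorm_le_iff_norm_le]
    exact enorm_tsum_le_tsum_enorm.trans h5
  have hf : N f < ∞ := by
    have := hbound 0
    simp only [Finset.range_zero, Finset.sum_empty, sub_zero, add_zero] at this
    exact this.trans_lt (ENNReal.mul_lt_top (by simp) hfin.lt_top)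
  refine ⟨Sp.of h f, Sp.tendsto_iff.2 ?_⟩
  have hlim : Tendsto (fun k => 2 * ∑' n, N (u (n + k)).val) atTop (𝓝 0) := by
    have := ENNReal.Tendsto.const_mul (a := 2)
      (ENNReal.tendsto_sum_nat_add (fun n => N (u n).val) hfin) (by simp)
    simpa using this
  refine tendsto_of_tendsto_of_tendsto_of_le_of_le tendsto_const_nhds hlim (fun _ => zero_le) ?_
  intro k
  simp only [Sp.val_of hf, Sp.val_sum]
  rw [h.sub_comm']
  exact hbound k

theorem enorm_smul_eq_of_le {N : ExtNorm μ}
    (H : ∀ (c : ℂ) f, N (c • f) ≤ ‖c‖ₑ * N f) (c : ℂ) (f : α →ₘ[μ] ℂ) :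
    N (c • f) = ‖c‖ₑ * N f := by
  refine le_antisymm (H c f) ?_
  rcases eq_or_ne c 0 with rfl | hc
  · simp
  · have h1 := H c⁻¹ (c • f)
    rw [inv_smul_smul₀ hc] at h1
    calc ‖c‖ₑ * N f ≤ ‖c‖ₑ * (‖c⁻¹‖ₑ * N (c • f)) := by gcongr
      _ = N (c • f) := by
        rw [← mul_assoc, ← enorm_mul, mul_inv_cancel₀ hc]; simp

/-! ### Exhaustion by sets with finite indicator norm, and the Köthe dual. -/

/-- `P` holds for some subset of positive measure of each set of positive measure. -/
def Ample (μ : Measure α) (P : Set α → Prop) : Prop :=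
  ∀ A, MeasurableSet A → μ A ≠ 0 → ∃ E ⊆ A, μ E ≠ 0 ∧ P E

theorem Ample.ae [SFinite μ] {P : Set α → Prop} (hP : Ample μ P) {p : α → Prop}
    (hm : ∀ E, P E → MeasurableSet E) (H : ∀ E, P E → ∀ᵐ x ∂μ, x ∈ E → p x) : ∀ᵐ x ∂μ, p x := by
  by_contra hcon
  have hpos : μ {x | ¬ p x} ≠ 0 := hcon
  -- The exceptional set need not be measurable, so its measurable hull is used; the hull meets
  -- every measurable set in the same measure as the set itself.
  obtain ⟨E, hEA, hE0, hPE⟩ := hP (toMeasurable μ {x | ¬ p x}) (measurableSet_toMeasurable _ _)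
    (by rwa [measure_toMeasurable])
  apply hE0
  rw [← Set.inter_eq_self_of_subset_right hEA, Measure.measure_toMeasurable_inter_of_sFinite (hm E hPE)]
  have := H E hPE
  rw [ae_iff] at this
  refine measure_mono_null ?_ this
  rintro x ⟨h1, h2⟩
  simp only [Set.mem_ofPred_eq, Classical.not_imp]
  exact ⟨h2, h1⟩

/-- The indicator function of `E` has finite norm. -/
def MemInd (N : ExtNorm μ) (E : Set α) : Prop := ∃ hE : MeasurableSet E, N (chi μ hE) < ∞

theorem IsSolid.memInd_mono {N : ExtNorm μ} (h : IsSolid N) {E E' : Set α} (hE : MemInd N E)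
    (hE' : MeasurableSet E') (hsub : E' ⊆ E) : MemInd N E' := by
  obtain ⟨hEm, hE⟩ := hE
  refine ⟨hE', (h.mono _ _ ?_).trans_lt hE⟩
  filter_upwards [coeFn_chi (μ := μ) hEm, coeFn_chi (μ := μ) hE'] with x h1 h2
  rw [h1, h2]
  by_cases hx : x ∈ E'
  · simp [hx, hsub hx]
  · simp [hx]

theorem lintegral_mul_le_dual {N : ExtNorm μ} (h : IsSolid N) {f : α →ₘ[μ] ℂ} (hf : N f ≠ ∞)
    (g : α →ₘ[μ] ℂ) : ∫⁻ x, ‖f x‖ₑ * ‖g x‖ₑ ∂μ ≤ N f * dual N g := by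
  rcases eq_or_ne (N f) 0 with h0 | h0
  · have := eq_zero_iff_ae.1 (h.eq_zero _ h0)
    rw [lintegral_congr_ae (g := 0) (by filter_upwards [this] with x hx; simp [hx])]
    simp
  · set r : ℝ := (N f).toReal with hr
    have hr0 : 0 < r := ENNReal.toReal_pos h0 hf
    have hNf : N f = ENNReal.ofReal r := (ENNReal.ofReal_toReal hf).symm
    have he : ‖((r⁻¹ : ℝ) : ℂ)‖ₑ = (N f)⁻¹ := by
      rw [hNf, ← ENNReal.ofReal_inv_of_pos hr0, ← ofReal_norm, Complex.norm_real,
        Real.norm_of_nonneg (by positivity)]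
    have h1 : N (((r⁻¹ : ℝ) : ℂ) • f) ≤ 1 := by
      rw [h.smul, he, ENNReal.inv_mul_cancel h0 hf]
    have h2 := le_iSup (fun f : {f : α →ₘ[μ] ℂ // N f ≤ 1} => ∫⁻ x, ‖f.1 x‖ₑ * ‖g x‖ₑ ∂μ)
      ⟨_, h1⟩
    have h3 : ∫⁻ x, ‖(((r⁻¹ : ℝ) : ℂ) • f) x‖ₑ * ‖g x‖ₑ ∂μ
        = (N f)⁻¹ * ∫⁻ x, ‖f x‖ₑ * ‖g x‖ₑ ∂μ := by
      rw [← lintegral_const_mul' _ _ (ENNReal.inv_ne_top.2 h0)]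
      refine lintegral_congr_ae ?_
      filter_upwards [AEEqFun.coeFn_smul ((r⁻¹ : ℝ) : ℂ) f] with x hx
      rw [hx, Pi.smul_apply, smul_eq_mul, enorm_mul, he, mul_assoc]
    simp only [h3] at h2
    calc ∫⁻ x, ‖f x‖ₑ * ‖g x‖ₑ ∂μ = N f * ((N f)⁻¹ * ∫⁻ x, ‖f x‖ₑ * ‖g x‖ₑ ∂μ) := by
          rw [← mul_assoc, ENNReal.mul_inv_cancel h0 hf, one_mul]
      _ ≤ N f * dual N g := by gcongr; exact h2

theorem aemeasurable_enorm_L0 (f : α →ₘ[μ] ℂ) : AEMeasurable (fun x => ‖f x‖ₑ) μ :=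
  f.measurable.enorm.aemeasurable

theorem lintegral_chi_mul {E : Set α} (hE : MeasurableSet E) (g : α → ℝ≥0∞) :
    ∫⁻ x, ‖chi μ hE x‖ₑ * g x ∂μ = ∫⁻ x in E, g x ∂μ := by
  rw [← lintegral_indicator hE]
  refine lintegral_congr_ae ?_
  filter_upwards [coeFn_chi (μ := μ) hE] with x hx
  rw [hx]
  by_cases hx : x ∈ E <;> simp [hx]

theorem dual_mono {N : ExtNorm μ} {f g : α →ₘ[μ] ℂ} (hfg : ∀ᵐ x ∂μ, ‖f x‖ ≤ ‖g x‖) :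
    dual N f ≤ dual N g := by
  refine iSup_mono fun u => lintegral_mono_ae ?_
  filter_upwards [hfg] with x hx
  gcongr
  exact enorm_le_iff_norm_le.2 hx

/-- Only definiteness needs `Ample`: a function supported where every element of the space vanishes
has dual norm zero. -/
theorem dual_isSolid [SigmaFinite μ] {N : ExtNorm μ} (h : IsSolid N) (hs : Ample μ (MemInd N)) :
    IsSolid (dual N) where
  map_zero := by
    refine le_antisymm (iSup_le fun f => ?_) zero_le
    rw [lintegral_congr_ae (g := 0)
      (by filter_upwards [AEEqFun.coeFn_zero (μ := μ) (β := ℂ)] with x hx; simp [hx])]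
    simp
  eq_zero g hg := by
    refine eq_zero_iff_ae.2 (hs.ae (fun E hE => hE.1) fun E ⟨hEm, hE⟩ => ?_)
    have h1 := lintegral_mul_le_dual h hE.ne g
    rw [hg, mul_zero, lintegral_chi_mul, nonpos_iff_eq_zero,
      lintegral_eq_zero_iff g.measurable.enorm] at h1
    have := (ae_restrict_iff' hEm).1 h1
    filter_upwards [this] with x hx hxE
    simpa using hx hxE
  add_le f g := by
    refine iSup_le fun u => ?_
    calc ∫⁻ x, ‖u.1 x‖ₑ * ‖(f + g) x‖ₑ ∂μ
        ≤ ∫⁻ x, ‖u.1 x‖ₑ * ‖f x‖ₑ + ‖u.1 x‖ₑ * ‖g x‖ₑ ∂μ := by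
          refine lintegral_mono_ae ?_
          filter_upwards [AEEqFun.coeFn_add f g] with x hx
          rw [hx, Pi.add_apply, ← mul_add]
          gcongr
          exact enorm_add_le _ _
      _ = _ := lintegral_add_left'
          ((aemeasurable_enorm_L0 u.1).mul (aemeasurable_enorm_L0 f)) _
      _ ≤ _ := add_le_add
          (le_iSup (fun u : {f : α →ₘ[μ] ℂ // N f ≤ 1} => ∫⁻ x, ‖u.1 x‖ₑ * ‖f x‖ₑ ∂μ) u)
          (le_iSup (fun u : {f : α →ₘ[μ] ℂ // N f ≤ 1} => ∫⁻ x, ‖u.1 x‖ₑ * ‖g x‖ₑ ∂μ) u)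
  smul := enorm_smul_eq_of_le fun c f => by
    refine iSup_le fun u => ?_
    calc ∫⁻ x, ‖u.1 x‖ₑ * ‖(c • f) x‖ₑ ∂μ = ‖c‖ₑ * ∫⁻ x, ‖u.1 x‖ₑ * ‖f x‖ₑ ∂μ := by
          rw [← lintegral_const_mul' _ _ enorm_ne_top]
          refine lintegral_congr_ae ?_
          filter_upwards [AEEqFun.coeFn_smul c f] with x hx
          rw [hx, Pi.smul_apply, smul_eq_mul, enorm_mul]
          ring
      _ ≤ _ := by
          gcongr
          exact le_iSup (fun u : {f : α →ₘ[μ] ℂ // N f ≤ 1} => ∫⁻ x, ‖u.1 x‖ₑ * ‖f x‖ₑ ∂μ) u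
  mono _ _ hfg := dual_mono hfg

/-- A measurable function with values in `ℝ≥0∞` that is finite almost everywhere, as a class of
complex functions. -/
theorem exists_L0_enorm_eq {w : α → ℝ≥0∞} (hw : AEMeasurable w μ) (hfin : ∀ᵐ x ∂μ, w x ≠ ∞) :
    ∃ s : α →ₘ[μ] ℂ, ∀ᵐ x ∂μ, ‖s x‖ₑ = w x := by
  have hm : AEMeasurable (fun x => (((w x).toReal : ℝ) : ℂ)) μ :=
    Complex.measurable_ofReal.comp_aemeasurable hw.ennreal_toReal
  refine ⟨AEEqFun.mk _ hm.aestronglyMeasurable, ?_⟩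
  filter_upwards [AEEqFun.coeFn_mk _ hm.aestronglyMeasurable, hfin] with x h1 h2
  rw [h1, ← ofReal_norm, Complex.norm_real, Real.norm_of_nonneg ENNReal.toReal_nonneg,
    ENNReal.ofReal_toReal h2]

/-- The pointwise sum `∑ |u n|` is itself the majorant, by monotone convergence. It is finite a.e.
because its integral is finite over each set whose indicator has finite norm. -/
theorem dual_isKothe [SigmaFinite μ] {N : ExtNorm μ} (h : IsSolid N) (hs : Ample μ (MemInd N)) :
    IsKothe (dual N) := by
  refine (dual_isSolid h hs).isKothe_of_dominating fun u hu => ?_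
  have hmeas : AEMeasurable (fun x => ∑' n, ‖u n x‖ₑ) μ :=
    AEMeasurable.tsum fun n => aemeasurable_enorm_L0 (u n)
  have hpair : ∀ f : α →ₘ[μ] ℂ, N f ≠ ∞ →
      ∫⁻ x, ‖f x‖ₑ * ∑' n, ‖u n x‖ₑ ∂μ ≤ N f * ∑' n, dual N (u n) := by
    intro f hf
    simp_rw [← ENNReal.tsum_mul_left]
    rw [lintegral_tsum (f := fun n x => ‖f x‖ₑ * ‖u n x‖ₑ)
      fun n => (aemeasurable_enorm_L0 f).mul (aemeasurable_enorm_L0 (u n))]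
    exact ENNReal.tsum_le_tsum fun n => lintegral_mul_le_dual h hf (u n)
  have hfin : ∀ᵐ x ∂μ, ∑' n, ‖u n x‖ₑ ≠ ∞ := by
    refine hs.ae (fun E hE => hE.1) fun E ⟨hEm, hE⟩ => ?_
    have h1 := hpair _ hE.ne
    rw [lintegral_chi_mul] at h1
    have h2 := ae_lt_top' hmeas.restrict
      (ne_top_of_le_ne_top (ENNReal.mul_ne_top hE.ne hu) h1)
    filter_upwards [(ae_restrict_iff' hEm).1 h2] with x hx hxE
    exact (hx hxE).ne
  obtain ⟨s, hs⟩ := exists_L0_enorm_eq hmeas hfin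
  refine ⟨s, iSup_le fun f => ?_, hs.mono fun x hx => hx.ge⟩
  rw [lintegral_congr_ae (g := fun x => ‖f.1 x‖ₑ * ∑' n, ‖u n x‖ₑ)
    (by filter_upwards [hs] with x hx; rw [hx])]
  calc _ ≤ N f.1 * ∑' n, dual N (u n) := hpair f.1 (ne_top_of_le_ne_top ENNReal.one_ne_top f.2)
    _ ≤ 2 * ∑' n, dual N (u n) := by
        gcongr
        exact f.2.trans one_le_two

theorem dual_dual_le {N : ExtNorm μ} (h : IsSolid N) (f : α →ₘ[μ] ℂ) (hf : N f ≠ ∞) :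
    dual (dual N) f ≤ N f := by
  refine iSup_le fun g => ?_
  calc ∫⁻ x, ‖g.1 x‖ₑ * ‖f x‖ₑ ∂μ = ∫⁻ x, ‖f x‖ₑ * ‖g.1 x‖ₑ ∂μ := by simp_rw [mul_comm]
    _ ≤ N f * dual N g.1 := lintegral_mul_le_dual h hf g.1
    _ ≤ N f * 1 := by gcongr; exact g.2
    _ = N f := mul_one _

/-! ### Sums of Köthe spaces. -/

section sum

variable {N₀ N₁ : ExtNorm μ}

theorem sumNorm_le_of_eq {f x y : α →ₘ[μ] ℂ} (hxy : x + y = f) :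
    sumNorm N₀ N₁ f ≤ N₀ x + N₁ y :=
  iInf_le (fun p : {p : (α →ₘ[μ] ℂ) × (α →ₘ[μ] ℂ) // p.1 + p.2 = f} => N₀ p.1.1 + N₁ p.1.2)
    ⟨(x, y), hxy⟩

theorem exists_of_sumNorm_lt {f : α →ₘ[μ] ℂ} {c : ℝ≥0∞} (hc : sumNorm N₀ N₁ f < c) :
    ∃ x y, x + y = f ∧ N₀ x + N₁ y < c := by
  obtain ⟨⟨⟨x, y⟩, hxy⟩, h⟩ := iInf_lt_iff.1 hc
  exact ⟨x, y, hxy, h⟩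

theorem le_sumNorm {f : α →ₘ[μ] ℂ} {c : ℝ≥0∞} (H : ∀ x y, x + y = f → c ≤ N₀ x + N₁ y) :
    c ≤ sumNorm N₀ N₁ f :=
  le_iInf fun p => H _ _ p.2

theorem sumNorm_le_left (h₁ : N₁ 0 = 0) (f : α →ₘ[μ] ℂ) : sumNorm N₀ N₁ f ≤ N₀ f := by
  simpa [h₁] using sumNorm_le_of_eq (N₀ := N₀) (N₁ := N₁) (add_zero f)

theorem sumNorm_le_right (h₀ : N₀ 0 = 0) (f : α →ₘ[μ] ℂ) : sumNorm N₀ N₁ f ≤ N₁ f := by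
  simpa [h₀] using sumNorm_le_of_eq (N₀ := N₀) (N₁ := N₁) (zero_add f)

/-- Turns domination into multiplication by a fixed function. This is linear, so it acts on
decompositions and on Calderón's space, and solidity passes to sums and interpolation spaces. -/
theorem exists_mul_of_norm_le {f g : α →ₘ[μ] ℂ} (hfg : ∀ᵐ x ∂μ, ‖f x‖ ≤ ‖g x‖) :
    ∃ m : α →ₘ[μ] ℂ, (∀ᵐ x ∂μ, ‖m x‖ ≤ 1) ∧ m * g = f := by
  have hm : Measurable (fun x => f x / g x) := f.measurable.div g.measurable
  refine ⟨AEEqFun.mk _ hm.aestronglyMeasurable, ?_, AEEqFun.ext ?_⟩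
  · filter_upwards [hfg, AEEqFun.coeFn_mk _ hm.aestronglyMeasurable] with x h1 h2
    rw [h2, norm_div]
    exact div_le_one_of_le₀ h1 (norm_nonneg _)
  · filter_upwards [hfg, AEEqFun.coeFn_mk _ hm.aestronglyMeasurable, AEEqFun.coeFn_mul
      (AEEqFun.mk _ hm.aestronglyMeasurable) g] with x h1 h2 h3
    rw [h3, Pi.mul_apply, h2]
    rcases eq_or_ne (g x) 0 with h0 | h0
    · rw [h0, norm_zero, norm_le_zero_iff] at h1
      simp [h0, h1]
    · field_simp

theorem IsSolid.mul_le {N : ExtNorm μ} (h : IsSolid N) {m : α →ₘ[μ] ℂ}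
    (hm : ∀ᵐ x ∂μ, ‖m x‖ ≤ 1) (f : α →ₘ[μ] ℂ) : N (m * f) ≤ N f := by
  apply h.mono
  filter_upwards [hm, AEEqFun.coeFn_mul m f] with x h1 h2
  rw [h2, Pi.mul_apply, norm_mul]
  exact mul_le_of_le_one_left (norm_nonneg _) h1

theorem IsKothe.ae_tendsto_zero {N : ExtNorm μ} (hN : IsKothe N) {u : ℕ → α →ₘ[μ] ℂ}
    (hu : ∑' n, N (u n) ≠ ∞) : ∀ᵐ x ∂μ, Tendsto (fun n => u n x) atTop (𝓝 0) := by
  obtain ⟨s, -, hs⟩ := hN.exists_dominating hu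
  filter_upwards [hs] with x hx
  have := ENNReal.tendsto_atTop_zero_of_tsum_ne_top (ne_top_of_le_ne_top enorm_ne_top hx)
  simpa [tendsto_zero_iff_enorm_tendsto_zero] using this

/-- For definiteness, a function of norm zero splits for each `n` into two terms with norms below
`2^{-n}`. By completeness of the two spaces both terms tend to zero a.e., so the function vanishes.
-/
theorem sumNorm_isSolid (h₀ : IsKothe N₀) (h₁ : IsKothe N₁) : IsSolid (sumNorm N₀ N₁) where
  map_zero := le_antisymm ((sumNorm_le_left h₁.map_zero 0).trans h₀.map_zero.le) zero_le
  eq_zero f hf := by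
    have hpos : ∀ n : ℕ, (0 : ℝ≥0∞) < 2⁻¹ ^ n := fun n =>
      ENNReal.pow_pos (by simp) n
    choose x y hxy hlt using fun n : ℕ => exists_of_sumNorm_lt (hf.trans_lt (hpos n))
    have hgeo : ∑' n : ℕ, (2⁻¹ : ℝ≥0∞) ^ n ≠ ∞ := by
      rw [ENNReal.tsum_geometric]; simp
    have hx := h₀.ae_tendsto_zero (u := x) (ne_top_of_le_ne_top hgeo
      (ENNReal.tsum_le_tsum fun n => le_self_add.trans (hlt n).le))
    have hy := h₁.ae_tendsto_zero (u := y) (ne_top_of_le_ne_top hgeo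
      (ENNReal.tsum_le_tsum fun n => le_add_self.trans (hlt n).le))
    refine eq_zero_iff_ae.2 ?_
    filter_upwards [hx, hy, ae_all_iff.2 fun n => AEEqFun.coeFn_add (x n) (y n)] with t h1 h2 h3
    have h4 : ∀ n, x n t + y n t = f t := fun n => by
      rw [← hxy n, h3 n, Pi.add_apply]
    have h5 := h1.add h2
    simp only [h4, add_zero] at h5
    exact tendsto_nhds_unique tendsto_const_nhds h5
  add_le f g := by
    refine ENNReal.le_of_forall_pos_le_add fun ε hε hfin => ?_
    have hf : sumNorm N₀ N₁ f ≠ ∞ := (ENNReal.add_lt_top.1 hfin).1.ne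
    have hg : sumNorm N₀ N₁ g ≠ ∞ := (ENNReal.add_lt_top.1 hfin).2.ne
    have hε' : ((ε / 2 : ℝ≥0) : ℝ≥0∞) ≠ 0 := by simpa using hε.ne'
    obtain ⟨x, y, hxy, hlt⟩ := exists_of_sumNorm_lt (ENNReal.lt_add_right hf hε')
    obtain ⟨x', y', hxy', hlt'⟩ := exists_of_sumNorm_lt (ENNReal.lt_add_right hg hε')
    calc sumNorm N₀ N₁ (f + g) ≤ N₀ (x + x') + N₁ (y + y') :=
          sumNorm_le_of_eq (by rw [← hxy, ← hxy']; abel)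
      _ ≤ (N₀ x + N₀ x') + (N₁ y + N₁ y') := add_le_add (h₀.add_le _ _) (h₁.add_le _ _)
      _ = (N₀ x + N₁ y) + (N₀ x' + N₁ y') := by ring
      _ ≤ (sumNorm N₀ N₁ f + (ε / 2 : ℝ≥0)) + (sumNorm N₀ N₁ g + (ε / 2 : ℝ≥0)) :=
          add_le_add hlt.le hlt'.le
      _ = sumNorm N₀ N₁ f + sumNorm N₀ N₁ g + ((ε / 2 : ℝ≥0) + (ε / 2 : ℝ≥0)) := by ring
      _ = sumNorm N₀ N₁ f + sumNorm N₀ N₁ g + ε := by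
          rw [← ENNReal.coe_add, add_halves]
  smul := enorm_smul_eq_of_le fun c f => by
    rcases eq_or_ne c 0 with rfl | hc
    · rw [show (0 : ℂ) • f = 0 from zero_smul ℂ f]
      exact ((sumNorm_le_left h₁.map_zero 0).trans h₀.map_zero.le).trans zero_le
    rw [sumNorm, sumNorm, ENNReal.mul_iInf_of_ne (by simpa using hc) enorm_ne_top]
    refine le_iInf fun p => ?_
    rw [mul_add, ← h₀.smul, ← h₁.smul]
    exact sumNorm_le_of_eq ((smul_add c _ _).symm.trans (by rw [p.2]))
  mono f g hfg := by
    obtain ⟨m, hm, rfl⟩ := exists_mul_of_norm_le hfg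
    refine le_sumNorm fun x y hxy => ?_
    exact (sumNorm_le_of_eq (by rw [← hxy, mul_add_L0])).trans
      (add_le_add (h₀.isSolid.mul_le hm x) (h₁.isSolid.mul_le hm y))

theorem sumNorm_isKothe (h₀ : IsKothe N₀) (h₁ : IsKothe N₁) : IsKothe (sumNorm N₀ N₁) := by
  have h := sumNorm_isSolid h₀ h₁
  refine h.isKothe_of_dominating fun u hu => ?_
  have hdec : ∀ n, ∃ x y, x + y = u n ∧ N₀ x + N₁ y ≤ 2 * sumNorm N₀ N₁ (u n) := by
    intro n
    rcases eq_or_ne (sumNorm N₀ N₁ (u n)) 0 with h0 | h0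
    · exact ⟨0, 0, by rw [h.eq_zero _ h0, add_zero], by simp [h₀.map_zero, h₁.map_zero]⟩
    · have hlt : sumNorm N₀ N₁ (u n) < 2 * sumNorm N₀ N₁ (u n) := by
        rw [two_mul]
        exact ENNReal.lt_add_right (ENNReal.ne_top_of_tsum_ne_top hu n) h0
      obtain ⟨x, y, h1, h2⟩ := exists_of_sumNorm_lt hlt
      exact ⟨x, y, h1, h2.le⟩
  choose x y hxy hle using hdec
  have htot : ∑' n, N₀ (x n) + ∑' n, N₁ (y n) ≤ 2 * ∑' n, sumNorm N₀ N₁ (u n) := by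
    rw [← ENNReal.tsum_add, ← ENNReal.tsum_mul_left]
    exact ENNReal.tsum_le_tsum hle
  have htop : 2 * ∑' n, sumNorm N₀ N₁ (u n) ≠ ∞ := ENNReal.mul_ne_top (by simp) hu
  obtain ⟨s, hs, hs'⟩ := h₀.exists_dominating
    (ne_top_of_le_ne_top htop (le_self_add.trans htot))
  obtain ⟨t, ht, ht'⟩ := h₁.exists_dominating
    (ne_top_of_le_ne_top htop (le_add_self.trans htot))
  refine ⟨absL s + absL t, ?_, ?_⟩
  · calc _ ≤ N₀ (absL s) + N₁ (absL t) := sumNorm_le_of_eq rfl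
      _ ≤ ∑' n, N₀ (x n) + ∑' n, N₁ (y n) := by
          rw [h₀.isSolid.abs_eq, h₁.isSolid.abs_eq]; exact add_le_add hs ht
      _ ≤ _ := htot
  · filter_upwards [hs', ht', AEEqFun.coeFn_add (absL s) (absL t), coeFn_absL s, coeFn_absL t,
      ae_all_iff.2 fun n => AEEqFun.coeFn_add (x n) (y n)] with z h1 h2 h3 h4 h5 h6
    have h7 : ‖(absL s + absL t) z‖ₑ = ‖s z‖ₑ + ‖t z‖ₑ := by
      rw [h3, Pi.add_apply, h4, h5, ← Complex.ofReal_add, ← ofReal_norm, Complex.norm_real,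
        Real.norm_of_nonneg (by positivity), ENNReal.ofReal_add (norm_nonneg _) (norm_nonneg _),
        ofReal_norm, ofReal_norm]
    rw [h7]
    calc ∑' n, ‖u n z‖ₑ ≤ ∑' n, (‖x n z‖ₑ + ‖y n z‖ₑ) := by
          refine ENNReal.tsum_le_tsum fun n => ?_
          rw [← hxy n, h6 n, Pi.add_apply]
          exact enorm_add_le _ _
      _ = ∑' n, ‖x n z‖ₑ + ∑' n, ‖y n z‖ₑ := ENNReal.tsum_add
      _ ≤ _ := add_le_add h1 h2

end sum

/-! ### The norms of `L_p`. -/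

theorem normLp_isSolid (p : ℝ≥0∞) (hp : 1 ≤ p) : IsSolid (normLp μ p) where
  map_zero := by rw [normLp, eLpNorm_congr_ae AEEqFun.coeFn_zero, eLpNorm_zero]
  eq_zero f hf := by
    rw [normLp, eLpNorm_eq_zero_iff f.aestronglyMeasurable (by positivity)] at hf
    exact eq_zero_iff_ae.2 hf
  add_le f g := by
    rw [normLp, eLpNorm_congr_ae (AEEqFun.coeFn_add f g)]
    exact eLpNorm_add_le f.aestronglyMeasurable g.aestronglyMeasurable hp
  smul c f := by
    rw [normLp, eLpNorm_congr_ae (AEEqFun.coeFn_smul c f), eLpNorm_const_smul]; rfl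
  mono f g hfg := eLpNorm_mono_ae hfg

theorem normLp_top_isKothe : IsKothe (normLp μ ∞) := by
  refine (normLp_isSolid ∞ le_top).isKothe_of_dominating fun u hu => ?_
  set c : ℝ := (∑' n, normLp μ ∞ (u n)).toReal
  have hc : ‖(c : ℂ)‖ₑ = ∑' n, normLp μ ∞ (u n) := by
    rw [← ofReal_norm, Complex.norm_real, Real.norm_of_nonneg ENNReal.toReal_nonneg,
      ENNReal.ofReal_toReal hu]
  refine ⟨AEEqFun.const α (c : ℂ), ?_, ?_⟩
  · rw [normLp, eLpNorm_congr_ae (AEEqFun.coeFn_const α _), eLpNorm_exponent_top]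
    refine le_trans (essSup_le_of_ae_le (∑' n, normLp μ ∞ (u n)) ?_) (le_mul_of_one_le_left' one_le_two)
    exact Eventually.of_forall fun x => hc.le
  · filter_upwards [AEEqFun.coeFn_const (μ := μ) α (c : ℂ),
      ae_all_iff.2 fun n => ae_le_eLpNormEssSup (f := u n) (μ := μ)] with x h1 h2
    rw [h1, Function.const_apply, hc]
    refine ENNReal.tsum_le_tsum fun n => ?_
    rw [normLp, eLpNorm_exponent_top]
    exact h2 n

/-! ### The strip and Calderón's space. -/

theorem strip_eq : strip = Complex.re ⁻¹' Set.Ioo 0 1 := rfl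

theorem closedStrip_eq : closedStrip = Complex.re ⁻¹' Set.Icc 0 1 := rfl

theorem isOpen_strip : IsOpen strip := isOpen_Ioo.preimage Complex.continuous_re

theorem closure_strip : closure strip = closedStrip := by
  rw [strip_eq, closedStrip_eq, Complex.closure_preimage_re, closure_Ioo zero_ne_one]

theorem strip_subset_closedStrip : strip ⊆ closedStrip := fun _ hz => ⟨hz.1.le, hz.2.le⟩

theorem left_mem_closedStrip (t : ℝ) : (t * Complex.I : ℂ) ∈ closedStrip := by
  simp [closedStrip]

theorem right_mem_closedStrip (t : ℝ) : (1 + t * Complex.I : ℂ) ∈ closedStrip := by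
  simp [closedStrip]

theorem ofReal_mem_strip {s : ℝ} (h0 : 0 < s) (h1 : s < 1) : (s : ℂ) ∈ strip := by
  simp [strip, h0, h1]

namespace Sp

variable {N M : ExtNorm μ}

/-- The inclusion of a space into a larger one. -/
def incl (h : IsSolid N) (h' : IsSolid M) (hle : ∀ f, M f ≤ N f) : Sp h →L[ℂ] Sp h' :=
  have fin (f : Sp h) : M f.val < ∞ := (hle _).trans_lt f.val_lt_top
  LinearMap.mkContinuous
    { toFun := fun f => of h' f.val
      map_add' := fun f g => ext (by
        rw [val_of (fin (f + g)), val_add, val_add, val_of (fin f), val_of (fin g)])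
      map_smul' := fun c f => ext (by
        rw [val_of (fin (c • f)), RingHom.id_apply, val_smul, val_smul, val_of (fin f)]) } 1
    (fun f => by
      simp only [LinearMap.coe_mk, AddHom.coe_mk, one_mul]
      rw [norm_of (fin f), norm_def]
      exact ENNReal.toReal_mono f.val_ne_top (hle _))

theorem val_incl (h : IsSolid N) (h' : IsSolid M) (hle : ∀ f, M f ≤ N f) (f : Sp h) :
    (incl h h' hle f).val = f.val :=
  val_of ((hle _).trans_lt f.val_lt_top)

/-- Gives access to the calculus of `HasDerivAt`. Finiteness near `z` is required because `of` takes
the default value `0` outside the space. -/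
theorem hasDerivIn_iff (h : IsSolid N) {F : ℂ → α →ₘ[μ] ℂ} {z : ℂ} {D : α →ₘ[μ] ℂ}
    (hfin : ∀ᶠ w in 𝓝 z, N (F w) < ∞) :
    HasDerivIn N F z D ↔ N D < ∞ ∧ HasDerivAt (fun w => of h (F w)) (of h D) z := by
  refine and_congr_right fun hD => ?_
  rw [hasDerivAt_iff_tendsto_slope, tendsto_iff]
  refine tendsto_congr' ?_
  filter_upwards [hfin.filter_mono nhdsWithin_le_nhds] with w hw
  rw [slope_def_module, val_smul, val_sub, val_of hw, val_of hfin.self_of_nhds, val_of hD]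

end Sp

section calderon

variable {N₀ N₁ : ExtNorm μ} {F G : ℂ → α →ₘ[μ] ℂ}

theorem le_calderonNorm_left (t : ℝ) :
    N₀ (F (t * Complex.I)) ≤ calderonNorm N₀ N₁ F :=
  (le_iSup (fun t : ℝ => N₀ (F (t * Complex.I))) t).trans (le_max_left _ _)

theorem le_calderonNorm_right (t : ℝ) :
    N₁ (F (1 + t * Complex.I)) ≤ calderonNorm N₀ N₁ F :=
  (le_iSup (fun t : ℝ => N₁ (F (1 + t * Complex.I))) t).trans (le_max_right _ _)

theorem calderonNorm_le {C : ℝ≥0∞} (h0 : ∀ t : ℝ, N₀ (F (t * Complex.I)) ≤ C)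
    (h1 : ∀ t : ℝ, N₁ (F (1 + t * Complex.I)) ≤ C) : calderonNorm N₀ N₁ F ≤ C :=
  max_le (iSup_le h0) (iSup_le h1)

theorem calderonNorm_add_le (h₀ : IsSolid N₀) (h₁ : IsSolid N₁) :
    calderonNorm N₀ N₁ (fun z => F z + G z) ≤ calderonNorm N₀ N₁ F + calderonNorm N₀ N₁ G :=
  calderonNorm_le
    (fun t => (h₀.add_le _ _).trans (add_le_add (le_calderonNorm_left t) (le_calderonNorm_left t)))
    (fun t => (h₁.add_le _ _).trans
      (add_le_add (le_calderonNorm_right t) (le_calderonNorm_right t)))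

theorem calderonNorm_smul_le (h₀ : IsSolid N₀) (h₁ : IsSolid N₁) {ψ : ℂ → ℂ} {C : ℝ≥0∞}
    (hψ : ∀ z ∈ closedStrip, ‖ψ z‖ₑ ≤ C) :
    calderonNorm N₀ N₁ (fun z => ψ z • F z) ≤ C * calderonNorm N₀ N₁ F :=
  calderonNorm_le
    (fun t => (h₀.smul _ _).trans_le
      (mul_le_mul' (hψ _ (left_mem_closedStrip t)) (le_calderonNorm_left t)))
    (fun t => (h₁.smul _ _).trans_le
      (mul_le_mul' (hψ _ (right_mem_closedStrip t)) (le_calderonNorm_right t)))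

theorem calderonNorm_mul_le (h₀ : IsSolid N₀) (h₁ : IsSolid N₁) {m : α →ₘ[μ] ℂ}
    (hm : ∀ᵐ x ∂μ, ‖m x‖ ≤ 1) :
    calderonNorm N₀ N₁ (fun z => m * F z) ≤ calderonNorm N₀ N₁ F :=
  calderonNorm_le
    (fun t => (h₀.mul_le hm _).trans (le_calderonNorm_left t))
    (fun t => (h₁.mul_le hm _).trans (le_calderonNorm_right t))

namespace MemCalderon

theorem lt_top (hF : MemCalderon N₀ N₁ F) {z : ℂ} (hz : z ∈ closedStrip) :
    sumNorm N₀ N₁ (F z) < ∞ := by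
  obtain ⟨C, hC⟩ := hF.bounded
  exact (hC z hz).trans_lt ENNReal.coe_lt_top

theorem eventually_lt_top (hF : MemCalderon N₀ N₁ F) {z : ℂ} (hz : z ∈ strip) :
    ∀ᶠ w in 𝓝 z, sumNorm N₀ N₁ (F w) < ∞ := by
  filter_upwards [isOpen_strip.mem_nhds hz] with w hw
  exact hF.lt_top (strip_subset_closedStrip hw)

theorem hasDerivIn_iff (hF : MemCalderon N₀ N₁ F) (hs : IsSolid (sumNorm N₀ N₁)) {z : ℂ}
    (hz : z ∈ strip) {D : α →ₘ[μ] ℂ} :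
    HasDerivIn (sumNorm N₀ N₁) F z D ↔
      sumNorm N₀ N₁ D < ∞ ∧ HasDerivAt (fun w => Sp.of hs (F w)) (Sp.of hs D) z :=
  Sp.hasDerivIn_iff hs (hF.eventually_lt_top hz)

theorem norm_of_le (hF : MemCalderon N₀ N₁ F) (hs : IsSolid (sumNorm N₀ N₁)) :
    ∃ C : ℝ≥0, ∀ z ∈ closedStrip, ‖Sp.of hs (F z)‖ ≤ C := by
  obtain ⟨C, hC⟩ := hF.bounded
  refine ⟨C, fun z hz => ?_⟩
  rw [Sp.norm_le_iff, Sp.val_of (hF.lt_top hz)]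
  exact hC z hz

theorem diffContOnCl (hF : MemCalderon N₀ N₁ F) (hs : IsSolid (sumNorm N₀ N₁)) :
    DiffContOnCl ℂ (fun z => Sp.of hs (F z)) strip where
  differentiableOn z hz := by
    obtain ⟨D, hD⟩ := hF.analytic z hz
    exact ((hF.hasDerivIn_iff hs hz).1 hD).2.differentiableAt.differentiableWithinAt
  continuousOn := by
    rw [closure_strip]
    intro z hz
    refine Sp.tendsto_iff.2 ((tendsto_congr' ?_).1 (hF.continuous z hz))
    filter_upwards [self_mem_nhdsWithin] with w hw
    rw [Sp.val_of (hF.lt_top hw), Sp.val_of (hF.lt_top hz)]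

theorem continuous_of_left (hF : MemCalderon N₀ N₁ F) (h₀ : IsSolid N₀) :
    Continuous (fun t : ℝ => Sp.of h₀ (F (t * Complex.I))) :=
  continuous_iff_continuousAt.2 fun t => Sp.tendsto_iff.2 (by
    simpa only [Sp.val_of (hF.mem_left _)] using hF.continuous_left t)

theorem continuous_of_right (hF : MemCalderon N₀ N₁ F) (h₁ : IsSolid N₁) :
    Continuous (fun t : ℝ => Sp.of h₁ (F (1 + t * Complex.I))) :=
  continuous_iff_continuousAt.2 fun t => Sp.tendsto_iff.2 (by
    simpa only [Sp.val_of (hF.mem_right _)] using hF.continuous_right t)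

theorem tendsto_of_left (hF : MemCalderon N₀ N₁ F) (h₀ : IsSolid N₀) :
    Tendsto (fun t : ℝ => Sp.of h₀ (F (t * Complex.I))) (cocompact ℝ) (𝓝 0) :=
  Sp.tendsto_iff.2 (by
    simpa only [Sp.val_of (hF.mem_left _), Sp.val_zero, sub_zero] using hF.decay_left)

theorem tendsto_of_right (hF : MemCalderon N₀ N₁ F) (h₁ : IsSolid N₁) :
    Tendsto (fun t : ℝ => Sp.of h₁ (F (1 + t * Complex.I))) (cocompact ℝ) (𝓝 0) :=
  Sp.tendsto_iff.2 (by
    simpa only [Sp.val_of (hF.mem_right _), Sp.val_zero, sub_zero] using hF.decay_right)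

/-- A function of Calderón's space amounts to three lifts with the same underlying values: one on
the strip into the sum, one on each edge into its own space. The closure properties below are
checked on these lifts. -/
theorem of_lift {h₀ : IsSolid N₀} {h₁ : IsSolid N₁} {hs : IsSolid (sumNorm N₀ N₁)}
    {S : ℂ → Sp hs} {L : ℝ → Sp h₀} {R : ℝ → Sp h₁}
    (hS : ∀ z ∈ closedStrip, (S z).val = F z) (hL : ∀ t : ℝ, (L t).val = F (t * Complex.I))
    (hR : ∀ t : ℝ, (R t).val = F (1 + t * Complex.I)) (hd : DiffContOnCl ℂ S strip)
    (hb : ∃ C : ℝ, ∀ z ∈ closedStrip, ‖S z‖ ≤ C) (hLc : Continuous L) (hRc : Continuous R)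
    (hL0 : Tendsto L (cocompact ℝ) (𝓝 0)) (hR0 : Tendsto R (cocompact ℝ) (𝓝 0)) :
    MemCalderon N₀ N₁ F where
  bounded := by
    obtain ⟨C, hC⟩ := hb
    refine ⟨C.toNNReal, fun z hz => ?_⟩
    rw [← hS z hz, ← Sp.norm_le_iff]
    exact (hC z hz).trans (Real.le_coe_toNNReal C)
  continuous z hz := by
    have hc := hd.continuousOn
    rw [closure_strip] at hc
    refine (tendsto_congr' ?_).1 (Sp.tendsto_iff.1 (hc z hz))
    filter_upwards [self_mem_nhdsWithin] with w hw
    rw [hS w hw, hS z hz]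
  analytic z hz := by
    have hfin : ∀ᶠ w in 𝓝 z, sumNorm N₀ N₁ (F w) < ∞ := by
      filter_upwards [isOpen_strip.mem_nhds hz] with w hw
      rw [← hS w (strip_subset_closedStrip hw)]
      exact (S w).val_lt_top
    refine ⟨(deriv S z).val, (Sp.hasDerivIn_iff hs hfin).2 ⟨(deriv S z).val_lt_top, ?_⟩⟩
    rw [Sp.of_val]
    refine ((hd.differentiableAt isOpen_strip hz).hasDerivAt).congr_of_eventuallyEq ?_
    filter_upwards [isOpen_strip.mem_nhds hz] with w hw
    rw [← hS w (strip_subset_closedStrip hw), Sp.of_val]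
  mem_left t := by rw [← hL]; exact (L t).val_lt_top
  mem_right t := by rw [← hR]; exact (R t).val_lt_top
  continuous_left t := by simpa only [hL] using Sp.tendsto_iff.1 (hLc.tendsto t)
  continuous_right t := by simpa only [hR] using Sp.tendsto_iff.1 (hRc.tendsto t)
  decay_left := by simpa only [hL, Sp.val_zero, sub_zero] using Sp.tendsto_iff.1 hL0
  decay_right := by simpa only [hR, Sp.val_zero, sub_zero] using Sp.tendsto_iff.1 hR0

theorem add (h₀ : IsKothe N₀) (h₁ : IsKothe N₁) (hF : MemCalderon N₀ N₁ F)
    (hG : MemCalderon N₀ N₁ G) : MemCalderon N₀ N₁ (fun z => F z + G z) := by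
  have hs := sumNorm_isSolid h₀ h₁
  obtain ⟨C, hC⟩ := hF.norm_of_le hs
  obtain ⟨C', hC'⟩ := hG.norm_of_le hs
  exact of_lift (S := fun z => Sp.of hs (F z) + Sp.of hs (G z))
    (L := fun t => Sp.of h₀.isSolid (F (t * Complex.I)) + Sp.of h₀.isSolid (G (t * Complex.I)))
    (R := fun t =>
      Sp.of h₁.isSolid (F (1 + t * Complex.I)) + Sp.of h₁.isSolid (G (1 + t * Complex.I)))
    (fun z hz => by rw [Sp.val_add, Sp.val_of (hF.lt_top hz), Sp.val_of (hG.lt_top hz)])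
    (fun t => by rw [Sp.val_add, Sp.val_of (hF.mem_left t), Sp.val_of (hG.mem_left t)])
    (fun t => by rw [Sp.val_add, Sp.val_of (hF.mem_right t), Sp.val_of (hG.mem_right t)])
    ((hF.diffContOnCl hs).add (hG.diffContOnCl hs))
    ⟨C + C', fun z hz => (norm_add_le _ _).trans (add_le_add (hC z hz) (hC' z hz))⟩
    ((hF.continuous_of_left _).add (hG.continuous_of_left _))
    ((hF.continuous_of_right _).add (hG.continuous_of_right _))
    (by simpa using (hF.tendsto_of_left h₀.isSolid).add (hG.tendsto_of_left _))
    (by simpa using (hF.tendsto_of_right h₁.isSolid).add (hG.tendsto_of_right _))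

theorem _root_.Kothe.tendsto_smul_zero_of_bounded {E : Type*} [NormedAddCommGroup E]
    [NormedSpace ℂ E] {l : Filter ℝ} {c : ℝ → ℂ} {v : ℝ → E} {C : ℝ} (hc : ∀ t, ‖c t‖ ≤ C)
    (hv : Tendsto v l (𝓝 0)) : Tendsto (fun t => c t • v t) l (𝓝 0) := by
  refine squeeze_zero_norm (a := fun t => C * ‖v t‖) (fun t => ?_) ?_
  · rw [norm_smul]
    gcongr
    exact hc t
  · simpa using hv.norm.const_mul C

theorem smul_fun (h₀ : IsKothe N₀) (h₁ : IsKothe N₁) (hF : MemCalderon N₀ N₁ F) {ψ : ℂ → ℂ}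
    (hψ : DiffContOnCl ℂ ψ strip) {C : ℝ} (hC : ∀ z ∈ closedStrip, ‖ψ z‖ ≤ C) :
    MemCalderon N₀ N₁ (fun z => ψ z • F z) := by
  have hs := sumNorm_isSolid h₀ h₁
  obtain ⟨C', hC'⟩ := hF.norm_of_le hs
  have hψc : ContinuousOn ψ closedStrip := closure_strip ▸ hψ.continuousOn
  exact of_lift (S := fun z => ψ z • Sp.of hs (F z))
    (L := fun t => ψ (t * Complex.I) • Sp.of h₀.isSolid (F (t * Complex.I)))
    (R := fun t => ψ (1 + t * Complex.I) • Sp.of h₁.isSolid (F (1 + t * Complex.I)))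
    (fun z hz => by rw [Sp.val_smul, Sp.val_of (hF.lt_top hz)])
    (fun t => by rw [Sp.val_smul, Sp.val_of (hF.mem_left t)])
    (fun t => by rw [Sp.val_smul, Sp.val_of (hF.mem_right t)])
    (hψ.smul (hF.diffContOnCl hs))
    ⟨C * C', fun z hz => by
      rw [norm_smul]
      exact mul_le_mul (hC z hz) (hC' z hz) (norm_nonneg _) ((norm_nonneg _).trans (hC z hz))⟩
    ((hψc.comp_continuous (by fun_prop) left_mem_closedStrip).smul (hF.continuous_of_left _))
    ((hψc.comp_continuous (by fun_prop) right_mem_closedStrip).smul (hF.continuous_of_right _))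
    (tendsto_smul_zero_of_bounded (fun t => hC _ (left_mem_closedStrip t)) (hF.tendsto_of_left _))
    (tendsto_smul_zero_of_bounded (fun t => hC _ (right_mem_closedStrip t))
      (hF.tendsto_of_right _))

theorem const_smul (h₀ : IsKothe N₀) (h₁ : IsKothe N₁) (hF : MemCalderon N₀ N₁ F) (c : ℂ) :
    MemCalderon N₀ N₁ (c • F) :=
  hF.smul_fun h₀ h₁ (ψ := fun _ => c) diffContOnCl_const (C := ‖c‖) fun _ _ => le_rfl

theorem sub (h₀ : IsKothe N₀) (h₁ : IsKothe N₁) (hF : MemCalderon N₀ N₁ F)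
    (hG : MemCalderon N₀ N₁ G) : MemCalderon N₀ N₁ (fun z => F z - G z) := by
  have := hF.add h₀ h₁ (hG.const_smul h₀ h₁ (-1))
  convert this using 2 with z
  rw [Pi.smul_apply, show (-1 : ℂ) • G z = -G z from neg_one_smul ℂ (G z), sub_eq_add_neg]

theorem mul_left (h₀ : IsKothe N₀) (h₁ : IsKothe N₁) (hF : MemCalderon N₀ N₁ F)
    {m : α →ₘ[μ] ℂ} (hm : ∀ᵐ x ∂μ, ‖m x‖ ≤ 1) : MemCalderon N₀ N₁ (fun z => m * F z) := by
  have hs := sumNorm_isSolid h₀ h₁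
  have hm' : ∀ᵐ x ∂μ, ‖m x‖ ≤ (1 : ℝ≥0) := by simpa using hm
  obtain ⟨C, hC⟩ := hF.norm_of_le hs
  refine of_lift (S := fun z => Sp.mulBdd hs m 1 hm' (Sp.of hs (F z)))
    (L := fun t => Sp.mulBdd h₀.isSolid m 1 hm' (Sp.of h₀.isSolid (F (t * Complex.I))))
    (R := fun t => Sp.mulBdd h₁.isSolid m 1 hm' (Sp.of h₁.isSolid (F (1 + t * Complex.I))))
    (fun z hz => by rw [Sp.val_mulBdd, Sp.val_of (hF.lt_top hz)])
    (fun t => by rw [Sp.val_mulBdd, Sp.val_of (hF.mem_left t)])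
    (fun t => by rw [Sp.val_mulBdd, Sp.val_of (hF.mem_right t)])
    ((Sp.mulBdd hs m 1 hm').differentiable.comp_diffContOnCl (hF.diffContOnCl hs))
    ⟨‖Sp.mulBdd hs m 1 hm'‖ * C, fun z hz => (ContinuousLinearMap.le_opNorm _ _).trans
      (mul_le_mul_of_nonneg_left (hC z hz) (norm_nonneg _))⟩
    ((ContinuousLinearMap.continuous _).comp (hF.continuous_of_left _))
    ((ContinuousLinearMap.continuous _).comp (hF.continuous_of_right _)) ?_ ?_
  · have := ((Sp.mulBdd h₀.isSolid m 1 hm').continuous.tendsto 0).comp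
      (hF.tendsto_of_left h₀.isSolid)
    rwa [map_zero] at this
  · have := ((Sp.mulBdd h₁.isSolid m 1 hm').continuous.tendsto 0).comp
      (hF.tendsto_of_right h₁.isSolid)
    rwa [map_zero] at this

theorem zero (h₀ : IsKothe N₀) (h₁ : IsKothe N₁) : MemCalderon N₀ N₁ (fun _ => 0) :=
  of_lift (S := fun _ => (0 : Sp (sumNorm_isSolid h₀ h₁))) (L := fun _ => (0 : Sp h₀.isSolid))
    (R := fun _ => (0 : Sp h₁.isSolid)) (fun _ _ => rfl) (fun _ => rfl) (fun _ => rfl)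
    diffContOnCl_const ⟨0, fun _ _ => norm_zero.le⟩ continuous_const continuous_const
    tendsto_const_nhds tendsto_const_nhds

/-- Hadamard's three lines theorem in the sum space, whose norm is at most the edge norms. The value
`b = 0` is allowed and is used later to show that a function vanishes. -/
theorem sumNorm_le_rpow (h₀ : IsKothe N₀) (h₁ : IsKothe N₁) (hF : MemCalderon N₀ N₁ F) {a b : ℝ≥0}
    (ha : ∀ t : ℝ, N₀ (F (t * Complex.I)) ≤ a) (hb : ∀ t : ℝ, N₁ (F (1 + t * Complex.I)) ≤ b)
    {z : ℂ} (hz : z ∈ closedStrip) :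
    ‖Sp.of (sumNorm_isSolid h₀ h₁) (F z)‖ ≤ (a : ℝ) ^ (1 - z.re) * (b : ℝ) ^ z.re := by
  have hs := sumNorm_isSolid h₀ h₁
  obtain ⟨C, hC⟩ := hF.norm_of_le hs
  refine Complex.HadamardThreeLines.norm_le_interp_of_mem_verticalClosedStrip₀₁' _ hz
    (hF.diffContOnCl hs) ⟨C, ?_⟩ (fun w hw => ?_) (fun w hw => ?_)
  · rintro _ ⟨w, hw, rfl⟩
    exact hC w hw
  · have hw' : w = (w.im : ℂ) * Complex.I := by
      apply Complex.ext <;> simp [show w.re = 0 from hw]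
    rw [hw', Sp.norm_le_iff, Sp.val_of (hF.lt_top (left_mem_closedStrip _))]
    exact (sumNorm_le_left h₁.map_zero _).trans (ha _)
  · have hw' : w = 1 + (w.im : ℂ) * Complex.I := by
      apply Complex.ext <;> simp [show w.re = 1 from hw]
    rw [hw', Sp.norm_le_iff, Sp.val_of (hF.lt_top (right_mem_closedStrip _))]
    exact (sumNorm_le_right h₀.map_zero _).trans (hb _)

theorem sumNorm_le (h₀ : IsKothe N₀) (h₁ : IsKothe N₁) (hF : MemCalderon N₀ N₁ F) {z : ℂ}
    (hz : z ∈ closedStrip) : sumNorm N₀ N₁ (F z) ≤ calderonNorm N₀ N₁ F := by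
  rcases eq_or_ne (calderonNorm N₀ N₁ F) ∞ with h | h
  · rw [h]; exact le_top
  lift calderonNorm N₀ N₁ F to ℝ≥0 using h with C hC
  have := hF.sumNorm_le_rpow h₀ h₁ (a := C) (b := C) (fun t => hC ▸ le_calderonNorm_left t)
    (fun t => hC ▸ le_calderonNorm_right t) hz
  rw [← Real.rpow_add_of_nonneg C.coe_nonneg (by linarith [hz.2]) hz.1, sub_add_cancel,
    Real.rpow_one, Sp.norm_le_iff, Sp.val_of (hF.lt_top hz)] at this
  exact this

/-- Completeness of Calderón's space: the Weierstrass test with the majorants `calderonNorm N₀ N₁ (F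
n)`, on the strip by the three lines bound and on the edges directly. -/
theorem exists_tsum (h₀ : IsKothe N₀) (h₁ : IsKothe N₁) {F : ℕ → ℂ → α →ₘ[μ] ℂ}
    (hF : ∀ n, MemCalderon N₀ N₁ (F n)) (hsum : ∑' n, calderonNorm N₀ N₁ (F n) ≠ ∞) :
    ∃ G, MemCalderon N₀ N₁ G ∧ calderonNorm N₀ N₁ G ≤ ∑' n, calderonNorm N₀ N₁ (F n) ∧
      ∀ z ∈ closedStrip, Tendsto
        (fun k => sumNorm N₀ N₁ (∑ n ∈ Finset.range k, F n z - G z)) atTop (𝓝 0) := by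
  have hs := sumNorm_isSolid h₀ h₁
  have := Sp.completeSpace h₀ h₀.isSolid
  have := Sp.completeSpace h₁ h₁.isSolid
  have := Sp.completeSpace (sumNorm_isKothe h₀ h₁) hs
  set v : ℕ → ℝ := fun n => (calderonNorm N₀ N₁ (F n)).toReal with hv
  have hvs : Summable v := ENNReal.summable_toReal hsum
  have hfin : ∀ n, calderonNorm N₀ N₁ (F n) ≠ ∞ := ENNReal.ne_top_of_tsum_ne_top hsum
  set S : ℕ → ℂ → Sp hs := fun n z => Sp.of hs (F n z)
  set L : ℕ → ℝ → Sp h₀.isSolid := fun n t => Sp.of h₀.isSolid (F n (t * Complex.I))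
  set R : ℕ → ℝ → Sp h₁.isSolid := fun n t => Sp.of h₁.isSolid (F n (1 + t * Complex.I))
  have hSb : ∀ n, ∀ z ∈ closedStrip, ‖S n z‖ ≤ v n := fun n z hz => by
    rw [Sp.norm_of ((hF n).lt_top hz)]
    exact ENNReal.toReal_mono (hfin n) ((hF n).sumNorm_le h₀ h₁ hz)
  have hLb : ∀ n t, ‖L n t‖ ≤ v n := fun n t => by
    rw [Sp.norm_of ((hF n).mem_left t)]
    exact ENNReal.toReal_mono (hfin n) (le_calderonNorm_left t)
  have hRb : ∀ n t, ‖R n t‖ ≤ v n := fun n t => by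
    rw [Sp.norm_of ((hF n).mem_right t)]
    exact ENNReal.toReal_mono (hfin n) (le_calderonNorm_right t)
  have hSsum : ∀ z ∈ closedStrip, Summable (fun n => S n z) := fun z hz =>
    (Summable.of_nonneg_of_le (fun _ => norm_nonneg _) (fun n => hSb n z hz) hvs).of_norm
  have hLsum : ∀ t, Summable (fun n => L n t) := fun t =>
    (Summable.of_nonneg_of_le (fun _ => norm_nonneg _) (fun n => hLb n t) hvs).of_norm
  have hRsum : ∀ t, Summable (fun n => R n t) := fun t =>
    (Summable.of_nonneg_of_le (fun _ => norm_nonneg _) (fun n => hRb n t) hvs).of_norm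
  have hSv : ∀ n, ∀ z ∈ closedStrip, (S n z).val = F n z := fun n z hz =>
    Sp.val_of ((hF n).lt_top hz)
  have hLv : ∀ n t, (L n t).val = F n (t * Complex.I) := fun n t => Sp.val_of ((hF n).mem_left t)
  have hRv : ∀ n t, (R n t).val = F n (1 + t * Complex.I) :=
    fun n t => Sp.val_of ((hF n).mem_right t)
  -- The series is summed in two different spaces; the continuous inclusion identifies the two
  -- limits as functions.
  have hL : ∀ t : ℝ, (∑' n, L n t).val = (∑' n, S n (t * Complex.I)).val := fun t => by
    rw [← Sp.val_incl h₀.isSolid hs (sumNorm_le_left h₁.map_zero), ContinuousLinearMap.map_tsum _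
      (hLsum t)]
    congr 2
    ext1 n
    apply Sp.ext
    rw [Sp.val_incl, hLv, hSv n _ (left_mem_closedStrip t)]
  have hR : ∀ t : ℝ, (∑' n, R n t).val = (∑' n, S n (1 + t * Complex.I)).val := fun t => by
    rw [← Sp.val_incl h₁.isSolid hs (sumNorm_le_right h₀.map_zero), ContinuousLinearMap.map_tsum _
      (hRsum t)]
    congr 2
    ext1 n
    apply Sp.ext
    rw [Sp.val_incl, hRv, hSv n _ (right_mem_closedStrip t)]
  refine ⟨fun z => (∑' n, S n z).val, ?_, calderonNorm_le (fun t => ?_) (fun t => ?_), ?_⟩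
  · refine of_lift (S := fun z => ∑' n, S n z) (L := fun t => ∑' n, L n t)
      (R := fun t => ∑' n, R n t) (fun _ _ => rfl) hL hR ⟨?_, ?_⟩
      ⟨∑' n, v n, fun z hz => tsum_of_norm_bounded hvs.hasSum fun n => hSb n z hz⟩ ?_ ?_ ?_ ?_
    · exact Complex.differentiableOn_tsum_of_summable_norm hvs
        (fun n => ((hF n).diffContOnCl hs).differentiableOn) isOpen_strip
        (fun n z hz => hSb n z (strip_subset_closedStrip hz))
    · rw [closure_strip]
      exact continuousOn_tsum
        (fun n => closure_strip ▸ ((hF n).diffContOnCl hs).continuousOn) hvs hSb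
    · exact continuous_tsum (fun n => (hF n).continuous_of_left _) hvs hLb
    · exact continuous_tsum (fun n => (hF n).continuous_of_right _) hvs hRb
    · simpa using tendsto_tsum_of_dominated_convergence hvs
        (fun n => (hF n).tendsto_of_left h₀.isSolid) (Eventually.of_forall fun t n => hLb n t)
    · simpa using tendsto_tsum_of_dominated_convergence hvs
        (fun n => (hF n).tendsto_of_right h₁.isSolid) (Eventually.of_forall fun t n => hRb n t)
  · rw [← hL, ← Sp.enorm_eq (∑' n, L n t)]
    refine enorm_tsum_le_tsum_enorm.trans (ENNReal.tsum_le_tsum fun n => ?_)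
    rw [Sp.enorm_eq, hLv]
    exact le_calderonNorm_left t
  · rw [← hR, ← Sp.enorm_eq (∑' n, R n t)]
    refine enorm_tsum_le_tsum_enorm.trans (ENNReal.tsum_le_tsum fun n => ?_)
    rw [Sp.enorm_eq, hRv]
    exact le_calderonNorm_right t
  · intro z hz
    have := Sp.tendsto_iff.1 (hSsum z hz).hasSum.tendsto_sum_nat
    simpa only [Sp.val_sum, hSv _ z hz] using this

end MemCalderon

theorem interp_le {s : ℝ} (hF : MemCalderon N₀ N₁ F) :
    interp N₀ N₁ s (F s) ≤ calderonNorm N₀ N₁ F :=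
  iInf_le (fun G : {G : ℂ → (α →ₘ[μ] ℂ) // MemCalderon N₀ N₁ G ∧ G (s : ℂ) = F s} =>
    calderonNorm N₀ N₁ G.1) ⟨F, hF, rfl⟩

theorem exists_of_interp_lt {s : ℝ} {f : α →ₘ[μ] ℂ} {c : ℝ≥0∞} (h : interp N₀ N₁ s f < c) :
    ∃ F, MemCalderon N₀ N₁ F ∧ F s = f ∧ calderonNorm N₀ N₁ F < c := by
  obtain ⟨⟨F, h1, h2⟩, h3⟩ := iInf_lt_iff.1 h
  exact ⟨F, h1, h2, h3⟩

theorem le_interp {s : ℝ} {f : α →ₘ[μ] ℂ} {c : ℝ≥0∞}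
    (H : ∀ F, MemCalderon N₀ N₁ F → F s = f → c ≤ calderonNorm N₀ N₁ F) :
    c ≤ interp N₀ N₁ s f :=
  le_iInf fun F => H _ F.2.1 F.2.2

end calderon

/-! ### A Poisson-type estimate on the strip. -/

section kernel

/-- A kernel on the strip with its only pole, a simple one, at `s`. -/
def stripKernel (s : ℝ) (z : ℂ) : ℂ := (z - s)⁻¹ * ((z + 1) * (2 - z))⁻¹

/-- The zeros `-1` and `2` of the denominator are at distance at least `1` from the strip, so each
factor has modulus at least `√(1 + y²)`. This makes the kernel integrable along the edges. -/
theorem norm_stripKernel_factor_le {z : ℂ} (hz : z ∈ closedStrip) :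
    ‖((z + 1) * (2 - z))⁻¹‖ ≤ (1 + z.im ^ 2)⁻¹ := by
  have h1 : 1 + z.im ^ 2 ≤ ‖z + 1‖ ^ 2 := by
    rw [← Complex.normSq_eq_norm_sq, Complex.normSq_apply]
    simp only [Complex.add_re, Complex.one_re, Complex.add_im, Complex.one_im, add_zero]
    nlinarith [hz.1]
  have h2 : 1 + z.im ^ 2 ≤ ‖2 - z‖ ^ 2 := by
    rw [← Complex.normSq_eq_norm_sq, Complex.normSq_apply]
    simp only [Complex.sub_re, Complex.re_ofNat, Complex.sub_im, Complex.im_ofNat]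
    nlinarith [hz.2]
  rw [norm_inv, norm_mul]
  gcongr
  have h3 : (1 + z.im ^ 2) ^ 2 ≤ (‖z + 1‖ * ‖2 - z‖) ^ 2 := by
    rw [mul_pow, sq (1 + z.im ^ 2)]
    exact mul_le_mul h1 h2 (by positivity) (by positivity)
  exact le_of_sq_le_sq h3 (by positivity)

theorem stripKernel_factor_ne_zero {z : ℂ} (hz : z ∈ closedStrip) : (z + 1) * (2 - z) ≠ 0 := by
  refine mul_ne_zero (fun h => ?_) (fun h => ?_)
  · have := congrArg Complex.re h
    simp at this
    linarith [hz.1]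
  · have := congrArg Complex.re h
    simp at this
    linarith [hz.2]

theorem norm_stripKernel_edge_le {s δ : ℝ} (hδ : 0 < δ) {j t : ℝ}
    (hj : (j + t * Complex.I : ℂ) ∈ closedStrip) (hjs : δ ≤ |j - s|) :
    ‖stripKernel s (j + t * Complex.I)‖ ≤ δ⁻¹ * (1 + t ^ 2)⁻¹ := by
  rw [stripKernel, norm_mul]
  have h1 := norm_stripKernel_factor_le hj
  have h2 : (j + t * Complex.I : ℂ).im = t := by simp
  rw [h2] at h1
  refine mul_le_mul ?_ h1 (norm_nonneg _) (by positivity)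
  rw [norm_inv]
  gcongr
  refine hjs.trans ?_
  have := Complex.abs_re_le_norm (j + t * Complex.I - s : ℂ)
  simpa using this

theorem continuous_stripKernel_edge {s j : ℝ} (hj : ∀ t : ℝ, (j + t * Complex.I : ℂ) ∈ closedStrip)
    (hjs : j ≠ s) : Continuous (fun t : ℝ => stripKernel s (j + t * Complex.I)) := by
  unfold stripKernel
  refine Continuous.mul (Continuous.inv₀ (by fun_prop) fun t h => ?_)
    (Continuous.inv₀ (by fun_prop) fun t => stripKernel_factor_ne_zero (hj t))
  have := congrArg Complex.re h
  simp at this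
  exact hjs (by linarith)

theorem integrable_stripKernel_edge {s j : ℝ}
    (hj : ∀ t : ℝ, (j + t * Complex.I : ℂ) ∈ closedStrip) (hjs : j ≠ s) :
    Integrable (fun t : ℝ => stripKernel s (j + t * Complex.I)) :=
  Integrable.mono' (integrable_inv_one_add_sq.const_mul |j - s|⁻¹)
    (continuous_stripKernel_edge hj hjs).aestronglyMeasurable
    (Eventually.of_forall fun t => norm_stripKernel_edge_le
      (abs_pos.2 (sub_ne_zero.2 hjs)) (hj t) le_rfl)

theorem re_stripKernel_left {s : ℝ} (h0 : 0 < s) (t : ℝ) :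
    (stripKernel s (t * Complex.I)).re < 0 := by
  rw [stripKernel, ← mul_inv, Complex.inv_re]
  apply div_neg_of_neg_of_pos
  · simp only [Complex.mul_re, Complex.sub_re, Complex.ofReal_re, Complex.I_re, mul_zero,
      Complex.ofReal_im, Complex.I_im, mul_one, sub_self, zero_sub, Complex.add_re, Complex.one_re,
      Complex.re_ofNat, Complex.add_im, Complex.mul_im, Complex.one_im, Complex.sub_im,
      Complex.im_ofNat]
    nlinarith [sq_nonneg t, mul_pos h0 (by positivity : 0 < 1 + t ^ 2)]
  · refine Complex.normSq_pos.2 (mul_ne_zero (fun h => ?_)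
      (stripKernel_factor_ne_zero (left_mem_closedStrip t)))
    have := congrArg Complex.re h
    simp at this
    linarith

theorem re_stripKernel_right {s : ℝ} (h1 : s < 1) (t : ℝ) :
    0 < (stripKernel s (1 + t * Complex.I)).re := by
  rw [stripKernel, ← mul_inv, Complex.inv_re]
  apply div_pos
  · simp only [Complex.mul_re, Complex.sub_re, Complex.ofReal_re, Complex.I_re, mul_zero,
      Complex.ofReal_im, Complex.I_im, mul_one, sub_self, Complex.add_re, Complex.one_re,
      Complex.re_ofNat, Complex.add_im, Complex.mul_im, Complex.one_im, Complex.sub_im,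
      Complex.im_ofNat]
    nlinarith [sq_nonneg t, mul_pos (sub_pos.2 h1) (by positivity : 0 < 1 + t ^ 2)]
  · refine Complex.normSq_pos.2 (mul_ne_zero (fun h => ?_)
      (stripKernel_factor_ne_zero (right_mem_closedStrip t)))
    have := congrArg Complex.re h
    simp at this
    linarith

theorem left_mem_closedStrip' (t : ℝ) : (((0 : ℝ) : ℂ) + t * Complex.I : ℂ) ∈ closedStrip := by
  simpa using left_mem_closedStrip t

theorem right_mem_closedStrip' (t : ℝ) : (((1 : ℝ) : ℂ) + t * Complex.I : ℂ) ∈ closedStrip := by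
  simpa using right_mem_closedStrip t

/-- This difference is a multiple of the residue at `s`. Residue calculus is avoided: the real part
of the kernel is negative on the left edge and positive on the right one. -/
theorem integral_stripKernel_sub_ne_zero {s : ℝ} (h0 : 0 < s) (h1 : s < 1) :
    (∫ t : ℝ, stripKernel s (1 + t * Complex.I)) - ∫ t : ℝ, stripKernel s (t * Complex.I) ≠ 0 := by
  have i0 : Integrable (fun t : ℝ => stripKernel s (t * Complex.I)) := by
    simpa using integrable_stripKernel_edge left_mem_closedStrip' h0.ne
  have i1 : Integrable (fun t : ℝ => stripKernel s (1 + t * Complex.I)) := by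
    simpa using integrable_stripKernel_edge right_mem_closedStrip' h1.ne'
  rw [← integral_sub i1 i0]
  intro h
  have hre := integral_re (i1.sub i0)
  simp only [Pi.sub_apply] at hre
  rw [h] at hre
  have hpos : ∀ t : ℝ, 0 < RCLike.re (stripKernel s (1 + t * Complex.I) -
      stripKernel s (t * Complex.I)) := fun t => by
    have a := re_stripKernel_left h0 t
    have b := re_stripKernel_right h1 t
    simp only [RCLike.re_eq_complex_re, Complex.sub_re]
    linarith
  have := (integral_pos_iff_support_of_nonneg (fun t => (hpos t).le) (i1.sub i0).re).2 (by
    refine lt_of_lt_of_le ?_ (measure_mono (s := Set.univ) fun t _ => (hpos t).ne')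
    simp)
  simp only [hre, map_zero, lt_self_iff_false] at this

/-- Cauchy's theorem on rectangles of height `2T`; the horizontal sides contribute `O(1/T)`. -/
theorem integral_edges_eq {h : ℂ → ℂ} (hd : DiffContOnCl ℂ h strip)
    (i0 : Integrable (fun t : ℝ => h (t * Complex.I)))
    (i1 : Integrable (fun t : ℝ => h (1 + t * Complex.I))) {C : ℝ}
    (hC : ∀ z ∈ closedStrip, 1 ≤ |z.im| → ‖h z‖ ≤ C * |z.im|⁻¹) :
    ∫ t : ℝ, h (1 + t * Complex.I) = ∫ t : ℝ, h (t * Complex.I) := by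
  have hc : ContinuousOn h closedStrip := closure_strip ▸ hd.continuousOn
  have hrect : ∀ T : ℝ, 0 < T →
      (∫ x : ℝ in (0 : ℝ)..1, h (x + (-T : ℝ) * Complex.I))
        - (∫ x : ℝ in (0 : ℝ)..1, h (x + T * Complex.I))
        + Complex.I • (∫ y : ℝ in (-T)..T, h (1 + y * Complex.I))
        - Complex.I • (∫ y : ℝ in (-T)..T, h (y * Complex.I)) = 0 := by
    intro T hT
    have := Complex.integral_boundary_rect_eq_zero_of_continuousOn_of_differentiableOn h
      (⟨0, -T⟩ : ℂ) (⟨1, T⟩ : ℂ) (hc.mono ?_) (hd.differentiableOn.mono ?_)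
    · simpa using this
    · intro z hz
      rw [Complex.mem_reProdIm] at hz
      simp only [Set.uIcc_of_le zero_le_one] at hz
      exact hz.1
    · intro z hz
      rw [Complex.mem_reProdIm] at hz
      simp only [min_eq_left zero_le_one, max_eq_right zero_le_one] at hz
      exact hz.1
  have hhor : ∀ σ : ℝ, |σ| = 1 → Tendsto
      (fun T : ℝ => ∫ x : ℝ in (0 : ℝ)..1, h (x + (σ * T : ℝ) * Complex.I)) atTop (𝓝 0) := by
    intro σ hσ
    have hlim : Tendsto (fun T : ℝ => C * T⁻¹) atTop (𝓝 0) := by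
      simpa using tendsto_inv_atTop_zero.const_mul C
    refine squeeze_zero_norm' ?_ hlim
    filter_upwards [eventually_ge_atTop 1] with T hT
    have hT' : |σ * T| = T := by rw [abs_mul, hσ, one_mul, abs_of_nonneg (by linarith)]
    have := intervalIntegral.norm_integral_le_of_norm_le_const (a := (0 : ℝ)) (b := 1)
      (C := C * T⁻¹) (f := fun x : ℝ => h (x + (σ * T : ℝ) * Complex.I)) (fun x hx => by
        rw [Set.uIoc_of_le zero_le_one] at hx
        have := hC (x + (σ * T : ℝ) * Complex.I) (by
          constructor
          · simpa using hx.1.le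
          · simpa using hx.2) (by
            simp only [Complex.add_im, Complex.ofReal_im, Complex.mul_im, Complex.ofReal_re,
              Complex.I_im, mul_one, Complex.I_re, mul_zero, add_zero, zero_add]
            rw [hT']; exact hT)
        simp only [Complex.add_im, Complex.ofReal_im, Complex.mul_im, Complex.ofReal_re,
              Complex.I_im, mul_one, Complex.I_re, mul_zero, add_zero, zero_add] at this
        rwa [hT'] at this)
    simpa using this
  have hm := hhor (-1) (by simp)
  have hp := hhor 1 (by simp)
  simp only [neg_mul, one_mul] at hm hp
  have v1 := intervalIntegral_tendsto_integral i1 tendsto_neg_atTop_atBot tendsto_id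
  have v0 := intervalIntegral_tendsto_integral i0 tendsto_neg_atTop_atBot tendsto_id
  have hall := ((hm.sub hp).add (v1.const_smul Complex.I)).sub (v0.const_smul Complex.I)
  have hz := hall.congr' (f₂ := fun _ => (0 : ℂ)) (by
    filter_upwards [eventually_gt_atTop 0] with T hT
    exact hrect T hT)
  have := tendsto_nhds_unique hz tendsto_const_nhds
  simp only [sub_zero, zero_add, smul_eq_mul] at this
  rw [← mul_sub] at this
  exact sub_eq_zero.1 ((mul_eq_zero.1 this).resolve_left Complex.I_ne_zero)

/-- The product of `φ - φ s` and the kernel has a removable singularity at `s`, so its two edge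
integrals agree. Solving for `φ s` expresses it by edge integrals of `φ` times the kernel. Only the
modulus of the kernel matters, so harmonic measure is not needed. -/
theorem exists_strip_kernel {s : ℝ} (h0 : 0 < s) (h1 : s < 1) :
    ∃ k₀ k₁ : ℝ → ℝ, (∀ t, 0 ≤ k₀ t) ∧ (∀ t, 0 ≤ k₁ t) ∧ Continuous k₀ ∧ Continuous k₁ ∧
      Integrable k₀ ∧ Integrable k₁ ∧
      ∀ φ : ℂ → ℂ, DiffContOnCl ℂ φ strip → (∃ C, ∀ z ∈ closedStrip, ‖φ z‖ ≤ C) →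
        ‖φ s‖ ≤ (∫ t, k₀ t * ‖φ (t * Complex.I)‖) + ∫ t, k₁ t * ‖φ (1 + t * Complex.I)‖ := by
  set J := (∫ t : ℝ, stripKernel s (1 + t * Complex.I)) - ∫ t : ℝ, stripKernel s (t * Complex.I)
    with hJdef
  have hJ : J ≠ 0 := integral_stripKernel_sub_ne_zero h0 h1
  have c0 : Continuous (fun t : ℝ => stripKernel s (t * Complex.I)) := by
    simpa using continuous_stripKernel_edge left_mem_closedStrip' h0.ne
  have c1 : Continuous (fun t : ℝ => stripKernel s (1 + t * Complex.I)) := by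
    simpa using continuous_stripKernel_edge right_mem_closedStrip' h1.ne'
  have i0 : Integrable (fun t : ℝ => stripKernel s (t * Complex.I)) := by
    simpa using integrable_stripKernel_edge left_mem_closedStrip' h0.ne
  have i1 : Integrable (fun t : ℝ => stripKernel s (1 + t * Complex.I)) := by
    simpa using integrable_stripKernel_edge right_mem_closedStrip' h1.ne'
  refine ⟨fun t => ‖J‖⁻¹ * ‖stripKernel s (t * Complex.I)‖,
    fun t => ‖J‖⁻¹ * ‖stripKernel s (1 + t * Complex.I)‖, fun t => by positivity,
    fun t => by positivity, by fun_prop, by fun_prop, i0.norm.const_mul _, i1.norm.const_mul _, ?_⟩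
  rintro φ hφ ⟨C, hC⟩
  have hs := ofReal_mem_strip h0 h1
  have hs' := strip_subset_closedStrip hs
  have hφc : ContinuousOn φ closedStrip := closure_strip ▸ hφ.continuousOn
  set h : ℂ → ℂ := fun z => dslope φ s z * ((z + 1) * (2 - z))⁻¹ with hh
  have hhs : ∀ z, z ≠ (s : ℂ) → h z = φ z * stripKernel s z - φ s * stripKernel s z := by
    intro z hz
    rw [hh]
    simp only
    rw [dslope_of_ne _ hz, slope_def_module, stripKernel, smul_eq_mul]
    ring
  have hd : DiffContOnCl ℂ h strip := by
    refine ⟨DifferentiableOn.mul ((Complex.differentiableOn_dslope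
      (isOpen_strip.mem_nhds hs)).2 hφ.differentiableOn) (DifferentiableOn.inv (by fun_prop)
        fun z hz => stripKernel_factor_ne_zero (strip_subset_closedStrip hz)), ?_⟩
    rw [closure_strip]
    refine ContinuousOn.mul ((continuousOn_dslope (mem_of_superset (isOpen_strip.mem_nhds hs)
      strip_subset_closedStrip)).2 ⟨hφc, hφ.differentiableAt isOpen_strip hs⟩)
      (ContinuousOn.inv₀ (by fun_prop) fun z hz => stripKernel_factor_ne_zero hz)
  have ne0 : ∀ t : ℝ, (t * Complex.I : ℂ) ≠ s := fun t ht => by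
    have := congrArg Complex.re ht
    simp at this
    linarith
  have ne1 : ∀ t : ℝ, (1 + t * Complex.I : ℂ) ≠ s := fun t ht => by
    have := congrArg Complex.re ht
    simp at this
    linarith
  have j0 : Integrable (fun t : ℝ => φ (t * Complex.I) * stripKernel s (t * Complex.I)) :=
    i0.bdd_mul (c := C)
      (hφc.comp_continuous (by fun_prop) left_mem_closedStrip).aestronglyMeasurable
      (Eventually.of_forall fun t => hC _ (left_mem_closedStrip t))
  have j1 : Integrable (fun t : ℝ => φ (1 + t * Complex.I) * stripKernel s (1 + t * Complex.I)) :=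
    i1.bdd_mul (c := C)
      (hφc.comp_continuous (by fun_prop) right_mem_closedStrip).aestronglyMeasurable
      (Eventually.of_forall fun t => hC _ (right_mem_closedStrip t))
  have e0 : (fun t : ℝ => h (t * Complex.I)) = fun t : ℝ =>
      φ (t * Complex.I) * stripKernel s (t * Complex.I) - φ s * stripKernel s (t * Complex.I) :=
    funext fun t => hhs _ (ne0 t)
  have e1 : (fun t : ℝ => h (1 + t * Complex.I)) = fun t : ℝ =>
      φ (1 + t * Complex.I) * stripKernel s (1 + t * Complex.I)
        - φ s * stripKernel s (1 + t * Complex.I) :=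
    funext fun t => hhs _ (ne1 t)
  have hC0 : 0 ≤ C := (norm_nonneg _).trans (hC _ hs')
  -- Decay along the strip comes from the difference quotient, at most `2C / |Im z|`; the other
  -- factor has modulus at most `1`.
  have heq := integral_edges_eq hd (by rw [e0]; exact j0.sub (i0.const_mul _))
    (by rw [e1]; exact j1.sub (i1.const_mul _)) (C := 2 * C) (fun z hz him => by
      have hzs : z ≠ s := by
        rintro rfl
        simp at him
        linarith
      rw [hh]
      simp only
      rw [dslope_of_ne _ hzs, slope_def_module, norm_mul, norm_smul, norm_inv]
      have a1 : |z.im| ≤ ‖z - s‖ := by simpa using Complex.abs_im_le_norm (z - s)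
      have a2 : ‖φ z - φ s‖ ≤ 2 * C := (norm_sub_le _ _).trans (by linarith [hC z hz, hC _ hs'])
      have a3 : ‖((z + 1) * (2 - z))⁻¹‖ ≤ 1 := (norm_stripKernel_factor_le hz).trans
        (inv_le_one_of_one_le₀ (by nlinarith [sq_nonneg z.im]))
      calc ‖z - s‖⁻¹ * ‖φ z - φ s‖ * ‖((z + 1) * (2 - z))⁻¹‖ ≤ |z.im|⁻¹ * (2 * C) * 1 := by
            gcongr
        _ = 2 * C * |z.im|⁻¹ := by ring)
  rw [e0, e1, integral_sub j1 (i1.const_mul _), integral_sub j0 (i0.const_mul _),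
    integral_const_mul, integral_const_mul] at heq
  have hfin : φ s = J⁻¹ * ((∫ t : ℝ, φ (1 + t * Complex.I) * stripKernel s (1 + t * Complex.I))
      - ∫ t : ℝ, φ (t * Complex.I) * stripKernel s (t * Complex.I)) := by
    have : φ s * J = (∫ t : ℝ, φ (1 + t * Complex.I) * stripKernel s (1 + t * Complex.I))
      - ∫ t : ℝ, φ (t * Complex.I) * stripKernel s (t * Complex.I) := by
      rw [hJdef]; linear_combination -heq
    rw [← this]
    field_simp
  rw [hfin, norm_mul, norm_inv]
  have b0 : ‖∫ t : ℝ, φ (t * Complex.I) * stripKernel s (t * Complex.I)‖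
      ≤ ∫ t : ℝ, ‖stripKernel s (t * Complex.I)‖ * ‖φ (t * Complex.I)‖ :=
    (norm_integral_le_integral_norm _).trans_eq (by simp_rw [norm_mul, mul_comm])
  have b1 : ‖∫ t : ℝ, φ (1 + t * Complex.I) * stripKernel s (1 + t * Complex.I)‖
      ≤ ∫ t : ℝ, ‖stripKernel s (1 + t * Complex.I)‖ * ‖φ (1 + t * Complex.I)‖ :=
    (norm_integral_le_integral_norm _).trans_eq (by simp_rw [norm_mul, mul_comm])
  simp_rw [mul_assoc, integral_const_mul]
  rw [← mul_add]
  gcongr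
  exact (norm_sub_le _ _).trans (by linarith)

end kernel

/-- When `φ s = 0`, the estimate is applied to `dslope φ s`, whose value at `s` is the derivative
and whose modulus on the edges is at most `δ⁻¹ |φ|`, with `δ` the distance from `s` to the edges.
Since `δ⁻¹ ≥ 1`, the enlarged kernels serve for both inequalities. -/
theorem exists_strip_kernel_deriv {s : ℝ} (h0 : 0 < s) (h1 : s < 1) :
    ∃ k₀ k₁ : ℝ → ℝ, (∀ t, 0 ≤ k₀ t) ∧ (∀ t, 0 ≤ k₁ t) ∧ Continuous k₀ ∧ Continuous k₁ ∧
      Integrable k₀ ∧ Integrable k₁ ∧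
      ∀ φ : ℂ → ℂ, DiffContOnCl ℂ φ strip → (∃ C, ∀ z ∈ closedStrip, ‖φ z‖ ≤ C) →
        ‖φ s‖ ≤ (∫ t, k₀ t * ‖φ (t * Complex.I)‖) + (∫ t, k₁ t * ‖φ (1 + t * Complex.I)‖) ∧
        (φ s = 0 → ‖deriv φ s‖ ≤
          (∫ t, k₀ t * ‖φ (t * Complex.I)‖) + ∫ t, k₁ t * ‖φ (1 + t * Complex.I)‖) := by
  obtain ⟨k₀, k₁, p0, p1, c0, c1, i0, i1, H⟩ := exists_strip_kernel h0 h1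
  set δ := min s (1 - s) with hδ
  have hδ0 : 0 < δ := lt_min h0 (by linarith)
  have hδs : δ ≤ s := min_le_left _ _
  have hδs' : δ ≤ 1 - s := min_le_right _ _
  have hδ1 : 1 ≤ δ⁻¹ := (one_le_inv₀ hδ0).2 (by linarith)
  refine ⟨fun t => δ⁻¹ * k₀ t, fun t => δ⁻¹ * k₁ t, fun t => mul_nonneg (by positivity) (p0 t),
    fun t => mul_nonneg (by positivity) (p1 t), c0.const_mul _, c1.const_mul _,
    i0.const_mul _, i1.const_mul _, ?_⟩
  rintro φ hφ ⟨C, hC⟩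
  have hφc : ContinuousOn φ closedStrip := closure_strip ▸ hφ.continuousOn
  have hs := ofReal_mem_strip h0 h1
  have n0 : 0 ≤ ∫ t, k₀ t * ‖φ (t * Complex.I)‖ :=
    integral_nonneg fun t => mul_nonneg (p0 t) (norm_nonneg _)
  have n1 : 0 ≤ ∫ t, k₁ t * ‖φ (1 + t * Complex.I)‖ :=
    integral_nonneg fun t => mul_nonneg (p1 t) (norm_nonneg _)
  simp_rw [mul_assoc, integral_const_mul, ← mul_add]
  refine ⟨(H φ hφ ⟨C, hC⟩).trans (le_mul_of_one_le_left (by positivity) hδ1), fun hφs => ?_⟩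
  have hc : ContinuousOn (dslope φ s) closedStrip :=
    (continuousOn_dslope (mem_of_superset (isOpen_strip.mem_nhds hs)
      strip_subset_closedStrip)).2 ⟨hφc, hφ.differentiableAt isOpen_strip hs⟩
  have hd : DiffContOnCl ℂ (dslope φ s) strip :=
    ⟨(Complex.differentiableOn_dslope (isOpen_strip.mem_nhds hs)).2 hφ.differentiableOn,
      by rwa [closure_strip]⟩
  have hval : ∀ z, z ≠ (s : ℂ) → ‖dslope φ s z‖ = ‖z - s‖⁻¹ * ‖φ z‖ := fun z hz => by
    rw [dslope_of_ne _ hz, slope_def_module, hφs, sub_zero, norm_smul, norm_inv]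
  have hbd : ∃ C', ∀ z ∈ closedStrip, ‖dslope φ s z‖ ≤ C' := by
    obtain ⟨C', hC'⟩ := ((isCompact_closedBall (s : ℂ) 1).inter_right
      (show IsClosed closedStrip by rw [← closure_strip]; exact isClosed_closure)).exists_bound_of_continuousOn
      (hc.mono Set.inter_subset_right)
    refine ⟨max C C', fun z hz => ?_⟩
    by_cases hzs : ‖z - s‖ ≤ 1
    · exact (hC' z ⟨by simpa [dist_eq_norm] using hzs, hz⟩).trans (le_max_right _ _)
    · push Not at hzs
      rw [hval z (by rintro rfl; simp at hzs; linarith)]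
      refine le_trans ?_ (le_max_left _ _)
      exact (mul_le_of_le_one_left (norm_nonneg _) (inv_le_one_of_one_le₀ hzs.le)).trans (hC z hz)
  have hedge : ∀ z : ℂ, δ ≤ ‖z - s‖ → ‖dslope φ s z‖ ≤ δ⁻¹ * ‖φ z‖ := fun z hz => by
    have hne : z ≠ s := by
      rintro rfl
      simp at hz
      linarith
    rw [hval z hne]
    gcongr
  have d0 : ∀ t : ℝ, δ ≤ ‖(t * Complex.I : ℂ) - s‖ := fun t => by
    have := Complex.abs_re_le_norm ((t * Complex.I : ℂ) - s)
    simp [abs_of_pos h0] at this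
    linarith
  have d1 : ∀ t : ℝ, δ ≤ ‖(1 + t * Complex.I : ℂ) - s‖ := fun t => by
    have := Complex.abs_re_le_norm ((1 + t * Complex.I : ℂ) - s)
    simp [abs_of_pos (sub_pos.2 h1)] at this
    linarith
  have hmain := H _ hd hbd
  rw [dslope_same] at hmain
  have j0 : Integrable (fun t : ℝ => k₀ t * ‖φ (t * Complex.I)‖) :=
    i0.mul_bdd (c := C) (hφc.comp_continuous (by fun_prop)
      left_mem_closedStrip).norm.aestronglyMeasurable
      (Eventually.of_forall fun t => by simpa using hC _ (left_mem_closedStrip t))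
  have j1 : Integrable (fun t : ℝ => k₁ t * ‖φ (1 + t * Complex.I)‖) :=
    i1.mul_bdd (c := C) (hφc.comp_continuous (by fun_prop)
      right_mem_closedStrip).norm.aestronglyMeasurable
      (Eventually.of_forall fun t => by simpa using hC _ (right_mem_closedStrip t))
  refine hmain.trans ?_
  rw [mul_add, ← integral_const_mul, ← integral_const_mul]
  refine add_le_add (integral_mono_of_nonneg (Eventually.of_forall fun t =>
    mul_nonneg (p0 t) (norm_nonneg _)) (j0.const_mul _) (Eventually.of_forall fun t => ?_))
    (integral_mono_of_nonneg (Eventually.of_forall fun t =>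
    mul_nonneg (p1 t) (norm_nonneg _)) (j1.const_mul _) (Eventually.of_forall fun t => ?_))
  · have := mul_le_mul_of_nonneg_left (hedge _ (d0 t)) (p0 t)
    simp only
    linarith
  · have := mul_le_mul_of_nonneg_left (hedge _ (d1 t)) (p1 t)
    simp only
    linarith

/-- Optimising the weight in a weighted arithmetic mean gives the geometric mean. -/
theorem le_rpow_mul_rpow_of_forall_rat {s d A B : ℝ} (h0 : 0 < s) (h1 : s < 1) (hA : 0 ≤ A)
    (hB : 0 ≤ B)
    (H : ∀ q : ℚ, d ≤ Real.exp (-s * q) * A + Real.exp ((1 - s) * q) * B) :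
    d ≤ (2 * A) ^ (1 - s) * (2 * B) ^ s := by
  have hreal : ∀ c : ℝ, d ≤ Real.exp (-s * c) * A + Real.exp ((1 - s) * c) * B := by
    intro c
    have hcl : IsClosed {c : ℝ | d ≤ Real.exp (-s * c) * A + Real.exp ((1 - s) * c) * B} :=
      isClosed_le continuous_const (by fun_prop)
    exact (Rat.denseRange_cast (𝕜 := ℝ)).induction_on c hcl H
  -- With `A + ε` and `B + ε` in place of `A` and `B`, the two terms are equal at `c = log ((A + ε)
  -- / (B + ε))`. The shift by `ε` covers the cases `A = 0` and `B = 0`.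
  have hpos : ∀ ε : ℝ, 0 < ε → d ≤ (2 * (A + ε)) ^ (1 - s) * (2 * (B + ε)) ^ s := by
    intro ε hε
    have hA' : 0 < A + ε := by linarith
    have hB' : 0 < B + ε := by linarith
    have := hreal (Real.log (A + ε) - Real.log (B + ε))
    refine this.trans ?_
    have e1 : Real.exp (-s * (Real.log (A + ε) - Real.log (B + ε))) * (A + ε)
        = (A + ε) ^ (1 - s) * (B + ε) ^ s := by
      rw [Real.rpow_def_of_pos hA', Real.rpow_def_of_pos hB', ← Real.exp_add]
      nth_rewrite 2 [← Real.exp_log hA']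
      rw [← Real.exp_add]
      ring_nf
    have e2 : Real.exp ((1 - s) * (Real.log (A + ε) - Real.log (B + ε))) * (B + ε)
        = (A + ε) ^ (1 - s) * (B + ε) ^ s := by
      rw [Real.rpow_def_of_pos hA', Real.rpow_def_of_pos hB', ← Real.exp_add]
      nth_rewrite 2 [← Real.exp_log hB']
      rw [← Real.exp_add]
      ring_nf
    have e3 : (2 * (A + ε)) ^ (1 - s) * (2 * (B + ε)) ^ s
        = 2 * ((A + ε) ^ (1 - s) * (B + ε) ^ s) := by
      rw [Real.mul_rpow (by norm_num) hA'.le, Real.mul_rpow (by norm_num) hB'.le]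
      have : (2 : ℝ) ^ (1 - s) * 2 ^ s = 2 := by
        rw [← Real.rpow_add (by norm_num)]; simp
      linear_combination ((A + ε) ^ (1 - s) * (B + ε) ^ s) * this
    have e4 : Real.exp (-s * (Real.log (A + ε) - Real.log (B + ε))) * A ≤
        Real.exp (-s * (Real.log (A + ε) - Real.log (B + ε))) * (A + ε) := by gcongr; linarith
    have e5 : Real.exp ((1 - s) * (Real.log (A + ε) - Real.log (B + ε))) * B ≤
        Real.exp ((1 - s) * (Real.log (A + ε) - Real.log (B + ε))) * (B + ε) := by gcongr; linarith
    linarith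
  have hcont : Continuous (fun ε : ℝ => (2 * (A + ε)) ^ (1 - s) * (2 * (B + ε)) ^ s) :=
    (Continuous.rpow_const (by fun_prop) fun _ => Or.inr (by linarith)).mul
      (Continuous.rpow_const (by fun_prop) fun _ => Or.inr h0.le)
  have hlim : Tendsto (fun ε : ℝ => (2 * (A + ε)) ^ (1 - s) * (2 * (B + ε)) ^ s) (𝓝[>] 0)
      (𝓝 ((2 * A) ^ (1 - s) * (2 * B) ^ s)) := by
    have := (hcont.tendsto 0).mono_left (nhdsWithin_le_nhds (s := Set.Ioi 0))
    simpa using this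
  exact ge_of_tendsto hlim (by filter_upwards [self_mem_nhdsWithin] with ε hε using hpos ε hε)

/-! ### Pointwise domination by geometric means. -/

namespace Sp

variable {N : ExtNorm μ}

/-- Integration against a function, as a functional. -/
def pairing (h : IsSolid N) (g : α →ₘ[μ] ℂ) (C : ℝ≥0)
    (hC : ∀ f, N f ≠ ∞ → ∫⁻ x, ‖f x‖ₑ * ‖g x‖ₑ ∂μ ≤ N f * C) : Sp h →L[ℂ] ℂ :=
  have int (f : Sp h) : Integrable (fun x => f.val x * g x) μ :=
    ⟨f.val.aestronglyMeasurable.mul g.aestronglyMeasurable, by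
      simp only [HasFiniteIntegral, enorm_mul]
      exact (hC _ f.val_ne_top).trans_lt (ENNReal.mul_lt_top f.val_lt_top ENNReal.coe_lt_top)⟩
  LinearMap.mkContinuous
    { toFun := fun f => ∫ x, f.val x * g x ∂μ
      map_add' := fun f₁ f₂ => by
        rw [← integral_add (int f₁) (int f₂)]
        refine integral_congr_ae ?_
        filter_upwards [AEEqFun.coeFn_add f₁.val f₂.val] with x hx
        rw [val_add, hx, Pi.add_apply, add_mul]
      map_smul' := fun c f => by
        rw [RingHom.id_apply, ← integral_smul]
        refine integral_congr_ae ?_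
        filter_upwards [AEEqFun.coeFn_smul c f.val] with x hx
        rw [val_smul, hx, Pi.smul_apply, smul_eq_mul, smul_eq_mul, mul_assoc] } C
    (fun f => by
      have h1 : ‖∫ x, f.val x * g x ∂μ‖ₑ ≤ N f.val * C :=
        (enorm_integral_le_lintegral_enorm _).trans (by
          simp only [enorm_mul]; exact hC _ f.val_ne_top)
      have h2 := ENNReal.toReal_mono
        (ENNReal.mul_ne_top f.val_ne_top ENNReal.coe_ne_top) h1
      rw [ENNReal.toReal_mul, ENNReal.coe_toReal, toReal_enorm] at h2
      rw [norm_def, mul_comm]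
      exact h2)

theorem pairing_apply (h : IsSolid N) (g : α →ₘ[μ] ℂ) (C : ℝ≥0)
    (hC : ∀ f, N f ≠ ∞ → ∫⁻ x, ‖f x‖ₑ * ‖g x‖ₑ ∂μ ≤ N f * C) (f : Sp h) :
    pairing h g C hC f = ∫ x, f.val x * g x ∂μ := rfl

/-- The absolute value on the space. -/
def abs {h : IsSolid N} (f : Sp h) : Sp h := of h (absL f.val)

theorem val_abs {h : IsSolid N} (f : Sp h) : (abs f).val = absL f.val :=
  val_of (by rw [h.abs_eq]; exact f.val_lt_top)

theorem norm_abs {h : IsSolid N} (f : Sp h) : ‖abs f‖ = ‖f‖ := by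
  rw [norm_def, val_abs, h.abs_eq, norm_def]

theorem continuous_abs {h : IsSolid N} : Continuous (abs : Sp h → Sp h) := by
  refine (LipschitzWith.of_edist_le fun f g => ?_).continuous
  rw [edist_eq, edist_eq, val_abs, val_abs]
  apply h.mono
  filter_upwards [AEEqFun.coeFn_sub (absL f.val) (absL g.val), AEEqFun.coeFn_sub f.val g.val,
    coeFn_absL f.val, coeFn_absL g.val] with x h1 h2 h3 h4
  rw [h1, h2, Pi.sub_apply, Pi.sub_apply, h3, h4, ← Complex.ofReal_sub, Complex.norm_real]
  exact abs_norm_sub_norm_le _ _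

end Sp

/-- The summand `1` keeps `C` nonzero, so that multiplication by `C` commutes with the infimum
defining `sumNorm`. -/
theorem lintegral_mul_le_sumNorm {N₀ N₁ : ExtNorm μ} (h₀ : IsSolid N₀) (h₁ : IsSolid N₁)
    (f g : α →ₘ[μ] ℂ) (C : ℝ≥0) (hC : dual N₀ g + dual N₁ g + 1 ≤ C) :
    ∫⁻ x, ‖f x‖ₑ * ‖g x‖ₑ ∂μ ≤ sumNorm N₀ N₁ f * C := by
  have hC0 : (C : ℝ≥0∞) ≠ 0 := fun h => by simp [h] at hC
  rw [sumNorm, ENNReal.iInf_mul_of_ne hC0 ENNReal.coe_ne_top]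
  refine le_iInf fun ⟨⟨x, y⟩, hxy⟩ => ?_
  simp only at hxy ⊢
  rcases eq_or_ne (N₀ x + N₁ y) ∞ with htop | hfin
  · rw [htop, ENNReal.top_mul hC0]; exact le_top
  obtain ⟨hx, hy⟩ := ENNReal.add_ne_top.1 hfin
  calc ∫⁻ t, ‖f t‖ₑ * ‖g t‖ₑ ∂μ ≤ ∫⁻ t, ‖x t‖ₑ * ‖g t‖ₑ + ‖y t‖ₑ * ‖g t‖ₑ ∂μ := by
        refine lintegral_mono_ae ?_
        filter_upwards [AEEqFun.coeFn_add x y] with t ht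
        rw [← hxy, ht, Pi.add_apply, ← add_mul]
        gcongr
        exact enorm_add_le _ _
    _ = ∫⁻ t, ‖x t‖ₑ * ‖g t‖ₑ ∂μ + ∫⁻ t, ‖y t‖ₑ * ‖g t‖ₑ ∂μ :=
        lintegral_add_left' ((aemeasurable_enorm_L0 x).mul (aemeasurable_enorm_L0 g)) _
    _ ≤ N₀ x * dual N₀ g + N₁ y * dual N₁ g :=
        add_le_add (lintegral_mul_le_dual h₀ hx g) (lintegral_mul_le_dual h₁ hy g)
    _ ≤ N₀ x * C + N₁ y * C := by
        gcongr
        · exact le_trans (le_trans le_self_add le_self_add) hC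
        · exact le_trans (le_trans le_add_self le_self_add) hC
    _ = (N₀ x + N₁ y) * C := (add_mul _ _ _).symm

/-- The hypothesis is tested on integration against the conjugate phase of `D` on `E`: this
functional sends `D` to `∫_E |D|`, and on the edges it is bounded by `∫_E` of the absolute value. -/
theorem setLIntegral_le_of_functional_bound {N₀ N₁ : ExtNorm μ} (h₀ : IsKothe N₀) (h₁ : IsKothe N₁)
    {k₀ k₁ : ℝ → ℝ} (p0 : ∀ t, 0 ≤ k₀ t) (p1 : ∀ t, 0 ≤ k₁ t)
    {L : ℝ → Sp h₀.isSolid} {R : ℝ → Sp h₁.isSolid} {hs : IsSolid (sumNorm N₀ N₁)}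
    {SL SR : ℝ → Sp hs} (hSL : ∀ t, (SL t).val = (L t).val) (hSR : ∀ t, (SR t).val = (R t).val)
    (iL : Integrable (fun t => (k₀ t : ℂ) • (L t).abs))
    (iR : Integrable (fun t => (k₁ t : ℂ) • (R t).abs))
    {D : Sp hs} {u v : ℝ} (hu : 0 ≤ u) (hv : 0 ≤ v)
    (H : ∀ ℓ : Sp hs →L[ℂ] ℂ, ‖ℓ D‖ ≤
      (∫ t, k₀ t * (u * ‖ℓ (SL t)‖)) + ∫ t, k₁ t * (v * ‖ℓ (SR t)‖))
    {E : Set α} (hE₀ : MemInd (dual N₀) E) (hE₁ : MemInd (dual N₁) E) :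
    ∫⁻ x in E, ‖D.val x‖ₑ ∂μ ≤
      ∫⁻ x in E, ENNReal.ofReal u * ‖(∫ t, (k₀ t : ℂ) • (L t).abs).val x‖ₑ
        + ENNReal.ofReal v * ‖(∫ t, (k₁ t : ℂ) • (R t).abs).val x‖ₑ ∂μ := by
  have := Sp.completeSpace h₀ h₀.isSolid
  have := Sp.completeSpace h₁ h₁.isSolid
  obtain ⟨hE, hE₀⟩ := hE₀
  obtain ⟨_, hE₁⟩ := hE₁
  -- the phase of `D`, restricted to `E`
  have hgm : Measurable (E.indicator fun x => (starRingEnd ℂ) (D.val x) / (‖D.val x‖ : ℂ)) := by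
    have h1 : Measurable D.val := D.val.measurable
    exact (((Complex.continuous_conj.measurable.comp h1).div
      (Complex.measurable_ofReal.comp h1.norm))).indicator hE
  set g : α →ₘ[μ] ℂ := AEEqFun.mk _ hgm.aestronglyMeasurable with hg
  have hgv : ∀ᵐ x ∂μ, g x = E.indicator (fun x => (starRingEnd ℂ) (D.val x) / (‖D.val x‖ : ℂ)) x :=
    AEEqFun.coeFn_mk _ _
  have hg1 : ∀ᵐ x ∂μ, ‖g x‖ ≤ ‖chi μ hE x‖ := by
    filter_upwards [hgv, coeFn_chi (μ := μ) hE] with x h1 h2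
    rw [h1, h2]
    by_cases hx : x ∈ E
    · simp only [hx, Set.indicator_of_mem, Pi.one_apply, norm_one, norm_div, RCLike.norm_conj,
        Complex.norm_real, norm_norm]
      exact div_self_le_one _
    · simp [hx]
  have hfin : dual N₀ g + dual N₁ g + 1 ≠ ∞ := by
    simp only [ne_eq, ENNReal.add_eq_top, ENNReal.one_ne_top, or_false, not_or]
    exact ⟨((dual_mono hg1).trans_lt hE₀).ne, ((dual_mono hg1).trans_lt hE₁).ne⟩
  set ℓ := Sp.pairing hs g _ (fun f _ => lintegral_mul_le_sumNorm h₀.isSolid h₁.isSolid f g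
    (dual N₀ g + dual N₁ g + 1).toNNReal (ENNReal.coe_toNNReal hfin).ge) with hℓ
  have hpair : ∀ {N : ExtNorm μ} (h : IsSolid N), dual N (chi μ hE) < ∞ →
      ∃ ℓ' : Sp h →L[ℂ] ℂ, ∀ f, ℓ' f = ∫ x, f.val x * chi μ hE x ∂μ := fun h hlt =>
    ⟨Sp.pairing h (chi μ hE) (dual _ (chi μ hE)).toNNReal (fun f hf => by
      rw [ENNReal.coe_toNNReal hlt.ne]; exact lintegral_mul_le_dual h hf _), fun f => rfl⟩
  obtain ⟨ℓ₀, hℓ₀⟩ := hpair h₀.isSolid hE₀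
  obtain ⟨ℓ₁, hℓ₁⟩ := hpair h₁.isSolid hE₁
  have hD : ℓ D = ((∫ x in E, ‖D.val x‖ ∂μ : ℝ) : ℂ) := by
    rw [hℓ, Sp.pairing_apply, ← integral_complex_ofReal, ← integral_indicator hE]
    refine integral_congr_ae ?_
    filter_upwards [hgv] with x hx
    rw [hx]
    by_cases hxE : x ∈ E
    · simp only [hxE, Set.indicator_of_mem]
      rcases eq_or_ne (D.val x) 0 with h0 | h0
      · simp [h0]
      · have : (‖D.val x‖ : ℂ) ≠ 0 := by simpa using h0
        rw [mul_div_assoc', Complex.mul_conj, Complex.normSq_eq_norm_sq]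
        push_cast
        field_simp
    · simp [hxE]
  have hchi_re : ∀ {N : ExtNorm μ} {h : IsSolid N} (f : Sp h),
      ∫ x, f.abs.val x * chi μ hE x ∂μ = ((∫ x in E, ‖f.val x‖ ∂μ : ℝ) : ℂ) := by
    intro N h f
    rw [← integral_complex_ofReal, ← integral_indicator hE]
    refine integral_congr_ae ?_
    filter_upwards [coeFn_chi (μ := μ) hE, coeFn_absL f.val] with x h1 h2
    rw [h1, Sp.val_abs, h2]
    by_cases hxE : x ∈ E <;> simp [hxE]
  have hint : ∀ {N : ExtNorm μ} {h : IsSolid N} (f : Sp h), dual N (chi μ hE) < ∞ →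
      IntegrableOn (fun x => ‖f.val x‖) E μ := by
    intro N h f hlt
    refine ⟨f.val.aestronglyMeasurable.norm.restrict, ?_⟩
    have := lintegral_mul_le_dual h f.val_ne_top (chi μ hE)
    simp_rw [mul_comm ‖f.val _‖ₑ] at this
    rw [lintegral_chi_mul] at this
    simp only [HasFiniteIntegral, enorm_norm]
    exact this.trans_lt (ENNReal.mul_lt_top f.val_lt_top hlt)
  have hbd : ∀ {N : ExtNorm μ} {h : IsSolid N} (S : Sp hs) (f : Sp h), S.val = f.val →
      dual N (chi μ hE) < ∞ → ‖ℓ S‖ ≤ ∫ x in E, ‖f.val x‖ ∂μ := by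
    intro N h S f hSf hlt
    rw [hℓ, Sp.pairing_apply, ← integral_indicator hE]
    refine norm_integral_le_of_norm_le ((integrable_indicator_iff hE).2 (hint f hlt)) ?_
    filter_upwards [hg1, coeFn_chi (μ := μ) hE] with x h1 h2
    rw [h2] at h1
    rw [hSf, norm_mul]
    by_cases hxE : x ∈ E
    · simp only [hxE, Set.indicator_of_mem, Pi.one_apply, norm_one] at h1 ⊢
      exact mul_le_of_le_one_right (norm_nonneg _) h1
    · simp only [hxE, not_false_eq_true, Set.indicator_of_notMem, norm_zero, norm_le_zero_iff]
        at h1 ⊢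
      simp [h1]
  -- The integrals over `t` and over `E` are interchanged by applying the functional `∫_E` to a
  -- Bochner integral, so no joint measurability in `t` and `x` enters.
  have hedge : ∀ {N : ExtNorm μ} {h : IsSolid N} [CompleteSpace (Sp h)] (ℓ' : Sp h →L[ℂ] ℂ)
      (_ : ∀ f, ℓ' f = ∫ x, f.val x * chi μ hE x ∂μ) (_ : dual N (chi μ hE) < ∞)
      {k : ℝ → ℝ} (_ : ∀ t, 0 ≤ k t) {T : ℝ → Sp h} {S : ℝ → Sp hs}
      (_ : ∀ t, (S t).val = (T t).val) (_ : Integrable (fun t => (k t : ℂ) • (T t).abs))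
      {w : ℝ} (_ : 0 ≤ w),
      ENNReal.ofReal (∫ t, k t * (w * ‖ℓ (S t)‖)) ≤
        ∫⁻ x in E, ENNReal.ofReal w * ‖(∫ t, (k t : ℂ) • (T t).abs).val x‖ₑ ∂μ := by
    intro N h _ ℓ' hℓ' hlt k hk T S hST hi w hw
    have hre : ∀ t, ℓ' ((k t : ℂ) • (T t).abs) = ((k t * ∫ x in E, ‖(T t).val x‖ ∂μ : ℝ) : ℂ) := by
      intro t
      rw [map_smul, hℓ', hchi_re, smul_eq_mul, Complex.ofReal_mul]
    have hi' : Integrable (fun t => k t * ∫ x in E, ‖(T t).val x‖ ∂μ) := by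
      have := (ℓ'.integrable_comp hi).re
      simpa only [hre, RCLike.re_eq_complex_re, Complex.ofReal_re] using this
    have h1 : ∫ t, k t * (w * ‖ℓ (S t)‖) ≤ w * ∫ t, k t * ∫ x in E, ‖(T t).val x‖ ∂μ := by
      rw [← integral_const_mul]
      refine integral_mono_of_nonneg (Eventually.of_forall fun t =>
        mul_nonneg (hk t) (mul_nonneg hw (norm_nonneg _))) (hi'.const_mul _)
        (Eventually.of_forall fun t => ?_)
      have := mul_le_mul_of_nonneg_left (hbd (S t) (T t) (hST t) hlt) (mul_nonneg (hk t) hw)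
      simp only
      linarith
    have h2 : ((∫ t, k t * ∫ x in E, ‖(T t).val x‖ ∂μ : ℝ) : ℂ)
        = ℓ' (∫ t, (k t : ℂ) • (T t).abs) := by
      rw [← ContinuousLinearMap.integral_comp_comm _ hi, ← integral_complex_ofReal]
      simp only [hre]
    have h3 : ENNReal.ofReal (∫ t, k t * ∫ x in E, ‖(T t).val x‖ ∂μ)
        ≤ ∫⁻ x in E, ‖(∫ t, (k t : ℂ) • (T t).abs).val x‖ₑ ∂μ := by
      have h4 : ENNReal.ofReal (∫ t, k t * ∫ x in E, ‖(T t).val x‖ ∂μ)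
          ≤ ‖ℓ' (∫ t, (k t : ℂ) • (T t).abs)‖ₑ := by
        rw [← h2, ← ofReal_norm, Complex.norm_real]
        exact ENNReal.ofReal_le_ofReal (le_abs_self _)
      refine h4.trans ?_
      rw [hℓ', ← lintegral_chi_mul hE]
      refine (enorm_integral_le_lintegral_enorm _).trans_eq ?_
      simp_rw [enorm_mul, mul_comm]
    rw [lintegral_const_mul' _ _ ENNReal.ofReal_ne_top]
    calc _ ≤ ENNReal.ofReal (w * ∫ t, k t * ∫ x in E, ‖(T t).val x‖ ∂μ) :=
          ENNReal.ofReal_le_ofReal h1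
      _ = ENNReal.ofReal w * ENNReal.ofReal (∫ t, k t * ∫ x in E, ‖(T t).val x‖ ∂μ) :=
          ENNReal.ofReal_mul hw
      _ ≤ _ := by gcongr
  have hDint : Integrable (fun x => D.val x * g x) μ :=
    ⟨D.val.aestronglyMeasurable.mul g.aestronglyMeasurable, by
      simp only [HasFiniteIntegral, enorm_mul]
      exact (lintegral_mul_le_sumNorm h₀.isSolid h₁.isSolid D.val g
        (dual N₀ g + dual N₁ g + 1).toNNReal (ENNReal.coe_toNNReal hfin).ge).trans_lt
        (ENNReal.mul_lt_top D.val_lt_top ENNReal.coe_lt_top)⟩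
  have hDE : IntegrableOn (fun x => ‖D.val x‖) E μ := by
    rw [← integrable_indicator_iff hE]
    refine hDint.norm.congr ?_
    filter_upwards [hgv] with x hx
    rw [hx, norm_mul]
    by_cases hxE : x ∈ E
    · simp only [hxE, Set.indicator_of_mem, norm_div, RCLike.norm_conj, Complex.norm_real,
        norm_norm]
      rcases eq_or_ne ‖D.val x‖ 0 with h0 | h0
      · simp [h0]
      · field_simp
    · simp [hxE]
  have hleft : ∫⁻ x in E, ‖D.val x‖ₑ ∂μ = ENNReal.ofReal ‖ℓ D‖ := by
    rw [hD, Complex.norm_real, Real.norm_of_nonneg (integral_nonneg fun _ => norm_nonneg _),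
      ofReal_integral_eq_lintegral_ofReal hDE (Eventually.of_forall fun _ => norm_nonneg _)]
    simp only [ofReal_norm]
  rw [hleft, lintegral_add_left' ((aemeasurable_enorm_L0 _).const_mul _).restrict]
  refine (ENNReal.ofReal_le_ofReal (H ℓ)).trans (ENNReal.ofReal_add_le.trans (add_le_add ?_ ?_))
  · exact hedge ℓ₀ hℓ₀ hE₀ p0 hSL iL hu
  · exact hedge ℓ₁ hℓ₁ hE₁ p1 hSR iR hv

theorem memInd_dual_mono {N : ExtNorm μ} {E E' : Set α} (hE : MemInd (dual N) E)
    (hE' : MeasurableSet E') (hsub : E' ⊆ E) : MemInd (dual N) E' := by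
  obtain ⟨hEm, hE⟩ := hE
  refine ⟨hE', (dual_mono ?_).trans_lt hE⟩
  filter_upwards [coeFn_chi (μ := μ) hEm, coeFn_chi (μ := μ) hE'] with x h1 h2
  rw [h1, h2]
  by_cases hx : x ∈ E'
  · simp [hx, hsub hx]
  · simp [hx]

/-- Since the integrated inequality holds on all measurable subsets of a test set, it holds
pointwise there. Rational `c` keep the exceptional set null, and the weight can then be optimised
separately at each point. -/
theorem ae_le_of_functional_bound [SigmaFinite μ] {N₀ N₁ : ExtNorm μ} (h₀ : IsKothe N₀)
    (h₁ : IsKothe N₁) (hA : Ample μ fun E => MemInd (dual N₀) E ∧ MemInd (dual N₁) E)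
    {s : ℝ} (s0 : 0 < s) (s1 : s < 1)
    {k₀ k₁ : ℝ → ℝ} (p0 : ∀ t, 0 ≤ k₀ t) (p1 : ∀ t, 0 ≤ k₁ t)
    {L : ℝ → Sp h₀.isSolid} {R : ℝ → Sp h₁.isSolid} {hs : IsSolid (sumNorm N₀ N₁)}
    {SL SR : ℝ → Sp hs} (hSL : ∀ t, (SL t).val = (L t).val) (hSR : ∀ t, (SR t).val = (R t).val)
    (iL : Integrable (fun t => (k₀ t : ℂ) • (L t).abs))
    (iR : Integrable (fun t => (k₁ t : ℂ) • (R t).abs)) {D : Sp hs}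
    (H : ∀ (c : ℝ) (ℓ : Sp hs →L[ℂ] ℂ), ‖ℓ D‖ ≤
      (∫ t, k₀ t * (Real.exp (-s * c) * ‖ℓ (SL t)‖))
        + ∫ t, k₁ t * (Real.exp ((1 - s) * c) * ‖ℓ (SR t)‖)) :
    ∀ᵐ x ∂μ, ‖D.val x‖ ≤ (2 * ‖(∫ t, (k₀ t : ℂ) • (L t).abs).val x‖) ^ (1 - s)
      * (2 * ‖(∫ t, (k₁ t : ℂ) • (R t).abs).val x‖) ^ s := by
  set a := (∫ t, (k₀ t : ℂ) • (L t).abs).val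
  set b := (∫ t, (k₁ t : ℂ) • (R t).abs).val
  have key : ∀ᵐ x ∂μ, ∀ q : ℚ, ‖D.val x‖ₑ ≤ ENNReal.ofReal (Real.exp (-s * q)) * ‖a x‖ₑ
      + ENNReal.ofReal (Real.exp ((1 - s) * q)) * ‖b x‖ₑ := by
    refine hA.ae (fun E hE => hE.1.1) fun E hE => ?_
    have hEm : MeasurableSet E := hE.1.1
    suffices ∀ q : ℚ, ∀ᵐ x ∂(μ.restrict E), ‖D.val x‖ₑ ≤
        ENNReal.ofReal (Real.exp (-s * q)) * ‖a x‖ₑ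
        + ENNReal.ofReal (Real.exp ((1 - s) * q)) * ‖b x‖ₑ by
      have := ae_all_iff.2 this
      rwa [ae_restrict_iff' hEm] at this
    intro q
    refine ae_le_of_forall_setLIntegral_le_of_sigmaFinite D.val.measurable.enorm fun B hB _ => ?_
    rw [Measure.restrict_restrict hB]
    exact setLIntegral_le_of_functional_bound h₀ h₁ p0 p1 hSL hSR iL iR (Real.exp_nonneg _)
      (Real.exp_nonneg _) (H q) (memInd_dual_mono hE.1 (hB.inter hEm) Set.inter_subset_right)
      (memInd_dual_mono hE.2 (hB.inter hEm) Set.inter_subset_right)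
  filter_upwards [key] with x hx
  refine le_rpow_mul_rpow_of_forall_rat s0 s1 (norm_nonneg _) (norm_nonneg _) fun q => ?_
  have := hx q
  rw [← ofReal_norm, ← ofReal_norm (a x), ← ofReal_norm (b x),
    ← ENNReal.ofReal_mul (Real.exp_nonneg _), ← ENNReal.ofReal_mul (Real.exp_nonneg _),
    ← ENNReal.ofReal_add (by positivity) (by positivity),
    ENNReal.ofReal_le_ofReal_iff (by positivity)] at this
  exact this

/-- Every function of Calderón's space is dominated at `s` by a product of powers of elements of
the two spaces; so is its derivative, if the function vanishes at `s`. -/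
theorem exists_calderon_bound [SigmaFinite μ] {N₀ N₁ : ExtNorm μ} (h₀ : IsKothe N₀)
    (h₁ : IsKothe N₁) (hA : Ample μ fun E => MemInd (dual N₀) E ∧ MemInd (dual N₁) E)
    {s : ℝ} (s0 : 0 < s) (s1 : s < 1) :
    ∃ K : ℝ≥0, ∀ F, MemCalderon N₀ N₁ F → calderonNorm N₀ N₁ F ≠ ∞ → ∃ a b : α →ₘ[μ] ℂ,
      N₀ a ≤ K * calderonNorm N₀ N₁ F ∧ N₁ b ≤ K * calderonNorm N₀ N₁ F ∧
      (∀ᵐ x ∂μ, ‖F s x‖ ≤ ‖a x‖ ^ (1 - s) * ‖b x‖ ^ s) ∧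
      ∀ D, F s = 0 → HasDerivIn (sumNorm N₀ N₁) F s D →
        ∀ᵐ x ∂μ, ‖D x‖ ≤ ‖a x‖ ^ (1 - s) * ‖b x‖ ^ s := by
  obtain ⟨k₀, k₁, p0, p1, c0, c1, i0, i1, H⟩ := exists_strip_kernel_deriv s0 s1
  have hs := sumNorm_isSolid h₀ h₁
  have := Sp.completeSpace h₀ h₀.isSolid
  have := Sp.completeSpace h₁ h₁.isSolid
  refine ⟨2 * ((∫ t, k₀ t).toNNReal + (∫ t, k₁ t).toNNReal), fun F hF hfin => ?_⟩
  have hstrip := ofReal_mem_strip s0 s1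
  have hcstrip := strip_subset_closedStrip hstrip
  lift calderonNorm N₀ N₁ F to ℝ≥0 using hfin with M hM
  set S : ℂ → Sp hs := fun z => Sp.of hs (F z) with hSdef
  set L : ℝ → Sp h₀.isSolid := fun t => Sp.of h₀.isSolid (F (t * Complex.I)) with hLdef
  set R : ℝ → Sp h₁.isSolid := fun t => Sp.of h₁.isSolid (F (1 + t * Complex.I)) with hRdef
  have hLM : ∀ t, ‖(L t).abs‖ ≤ M := fun t => by
    rw [Sp.norm_abs, Sp.norm_le_iff, Sp.val_of (hF.mem_left t), hM]
    exact le_calderonNorm_left t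
  have hRM : ∀ t, ‖(R t).abs‖ ≤ M := fun t => by
    rw [Sp.norm_abs, Sp.norm_le_iff, Sp.val_of (hF.mem_right t), hM]
    exact le_calderonNorm_right t
  have iL : Integrable (fun t => (k₀ t : ℂ) • (L t).abs) :=
    Integrable.smul_bdd (f := fun t => (L t).abs) (φ := fun t => (k₀ t : ℂ)) i0.ofReal M
      (Sp.continuous_abs.comp (hF.continuous_of_left _)).aestronglyMeasurable
      (Eventually.of_forall hLM)
  have iR : Integrable (fun t => (k₁ t : ℂ) • (R t).abs) :=
    Integrable.smul_bdd (f := fun t => (R t).abs) (φ := fun t => (k₁ t : ℂ)) i1.ofReal M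
      (Sp.continuous_abs.comp (hF.continuous_of_right _)).aestronglyMeasurable
      (Eventually.of_forall hRM)
  have hSL : ∀ t : ℝ, (S (t * Complex.I)).val = (L t).val := fun t => by
    rw [Sp.val_of (hF.lt_top (left_mem_closedStrip t)), Sp.val_of (hF.mem_left t)]
  have hSR : ∀ t : ℝ, (S (1 + t * Complex.I)).val = (R t).val := fun t => by
    rw [Sp.val_of (hF.lt_top (right_mem_closedStrip t)), Sp.val_of (hF.mem_right t)]
  have bound : ∀ {N : ExtNorm μ} {h : IsSolid N} {k : ℝ → ℝ} {T : ℝ → Sp h}, (∀ t, 0 ≤ k t) →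
      Integrable k → (∀ t, ‖(T t).abs‖ ≤ M) →
      N ((2 : ℂ) • (∫ t, (k t : ℂ) • (T t).abs).val) ≤ 2 * ((∫ t, k t).toNNReal * M : ℝ≥0) := by
    intro N h k T hk ik hT
    rw [h.smul]
    have h2 : ‖(2 : ℂ)‖ₑ = 2 := by simp [enorm_eq_nnnorm]
    rw [h2]
    gcongr
    rw [← Sp.norm_le_iff, NNReal.coe_mul, Real.coe_toNNReal _ (integral_nonneg hk),
      ← integral_mul_const]
    refine norm_integral_le_of_norm_le (ik.mul_const _) (Eventually.of_forall fun t => ?_)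
    rw [norm_smul, Complex.norm_real, Real.norm_of_nonneg (hk t)]
    exact mul_le_mul_of_nonneg_left (hT t) (hk t)
  obtain ⟨C, hC⟩ := hF.norm_of_le hs
  have hcommon : ∀ (c : ℝ) (ℓ : Sp hs →L[ℂ] ℂ),
      ‖ℓ (S s)‖ ≤ (∫ t : ℝ, k₀ t * (Real.exp (-s * c) * ‖ℓ (S (t * Complex.I))‖))
        + (∫ t : ℝ, k₁ t * (Real.exp ((1 - s) * c) * ‖ℓ (S (1 + t * Complex.I))‖)) ∧
      ∀ D' : Sp hs, S s = 0 → HasDerivAt S D' s →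
        ‖ℓ D'‖ ≤ (∫ t : ℝ, k₀ t * (Real.exp (-s * c) * ‖ℓ (S (t * Complex.I))‖))
        + (∫ t : ℝ, k₁ t * (Real.exp ((1 - s) * c) * ‖ℓ (S (1 + t * Complex.I))‖)) := by
    intro c ℓ
    -- The exponential is `1` at `s` and has constant modulus on each edge, `e^{-sc}` on the left
    -- and `e^{(1-s)c}` on the right.
    set φ : ℂ → ℂ := fun z => Complex.exp ((z - s) * c) * ℓ (S z) with hφ
    have hφd : DiffContOnCl ℂ φ strip := by
      have h1 : DiffContOnCl ℂ (fun z : ℂ => Complex.exp ((z - s) * c)) strip :=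
        Differentiable.diffContOnCl (by fun_prop)
      exact h1.smul (ℓ.differentiable.comp_diffContOnCl (hF.diffContOnCl hs))
    have hφn : ∀ z, ‖φ z‖ = Real.exp ((z.re - s) * c) * ‖ℓ (S z)‖ := fun z => by
      rw [hφ]
      simp only [norm_mul, Complex.norm_exp]
      simp
    have hφb : ∃ C, ∀ z ∈ closedStrip, ‖φ z‖ ≤ C := by
      refine ⟨Real.exp |c| * (‖ℓ‖ * C), fun z hz => ?_⟩
      rw [hφn]
      gcongr
      · calc (z.re - s) * c ≤ |(z.re - s) * c| := le_abs_self _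
          _ = |z.re - s| * |c| := abs_mul _ _
          _ ≤ 1 * |c| := by
              gcongr
              rw [abs_le]
              constructor <;> linarith [hz.1, hz.2]
          _ = |c| := one_mul _
      · exact (ℓ.le_opNorm _).trans (by gcongr; exact hC z hz)
    obtain ⟨H1, H2⟩ := H φ hφd hφb
    have eL : ∀ t : ℝ, ‖φ (t * Complex.I)‖ = Real.exp (-s * c) * ‖ℓ (S (t * Complex.I))‖ :=
      fun t => by rw [hφn]; simp
    have eR : ∀ t : ℝ, ‖φ (1 + t * Complex.I)‖
        = Real.exp ((1 - s) * c) * ‖ℓ (S (1 + t * Complex.I))‖ :=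
      fun t => by rw [hφn]; simp
    simp only [eL, eR] at H1 H2
    constructor
    · have : ‖φ s‖ = ‖ℓ (S s)‖ := by rw [hφn]; simp
      rwa [this] at H1
    · intro D' hS0 hD'
      -- The derivative of the exponential factor is multiplied by `ℓ (S s) = 0`, so `c` does not
      -- affect the derivative.
      have hd : HasDerivAt φ (ℓ D') s := by
        have h1 : HasDerivAt (fun z : ℂ => Complex.exp ((z - s) * c))
            (Complex.exp (((s : ℂ) - s) * c) * (1 * c)) s :=
          (((hasDerivAt_id (s : ℂ)).sub_const _).mul_const _).cexp
        have h2 : HasDerivAt (fun z => ℓ (S z)) (ℓ D') s := ℓ.hasFDerivAt.comp_hasDerivAt _ hD'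
        refine (h1.mul h2).congr_deriv ?_
        simp [hS0]
      have := H2 (by rw [hφ]; simp [hS0])
      rwa [hd.deriv] at this
  have hnorm2 : ∀ f : α →ₘ[μ] ℂ, ∀ᵐ x ∂μ, ‖((2 : ℂ) • f) x‖ = 2 * ‖f x‖ := fun f => by
    filter_upwards [AEEqFun.coeFn_smul (2 : ℂ) f] with x hx
    rw [hx, Pi.smul_apply, norm_smul]
    simp
  -- The factors `2` are those in `le_rpow_mul_rpow_of_forall_rat`.
  refine ⟨(2 : ℂ) • (∫ t, (k₀ t : ℂ) • (L t).abs).val,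
    (2 : ℂ) • (∫ t, (k₁ t : ℂ) • (R t).abs).val, (bound p0 i0 hLM).trans ?_,
    (bound p1 i1 hRM).trans ?_, ?_, fun D hF0 hD => ?_⟩
  · norm_cast
    rw [← mul_assoc]
    gcongr
    exact le_self_add
  · norm_cast
    rw [← mul_assoc]
    gcongr
    exact le_add_self
  · have := ae_le_of_functional_bound h₀ h₁ hA s0 s1 p0 p1 hSL hSR iL iR (D := S s)
      fun c ℓ => (hcommon c ℓ).1
    filter_upwards [this, hnorm2 (∫ t, (k₀ t : ℂ) • (L t).abs).val,
      hnorm2 (∫ t, (k₁ t : ℂ) • (R t).abs).val] with x h1 h2 h3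
    rw [h2, h3, ← Sp.val_of (h := hs) (hF.lt_top hcstrip)]
    exact h1
  · obtain ⟨hDfin, hD'⟩ := (hF.hasDerivIn_iff hs hstrip).1 hD
    have hS0 : S s = 0 := Sp.ext (by rw [Sp.val_of (hF.lt_top hcstrip), hF0, Sp.val_zero])
    have := ae_le_of_functional_bound h₀ h₁ hA s0 s1 p0 p1 hSL hSR iL iR (D := Sp.of hs D)
      fun c ℓ => (hcommon c ℓ).2 _ hS0 hD'
    filter_upwards [this, hnorm2 (∫ t, (k₀ t : ℂ) • (L t).abs).val,
      hnorm2 (∫ t, (k₁ t : ℂ) • (R t).abs).val] with x h1 h2 h3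
    rw [h2, h3, ← Sp.val_of (h := hs) hDfin]
    exact h1

/-! ### The midpoint of a space and its dual, and the supports of the two spaces. -/

theorem normLp_two_sq (f : α →ₘ[μ] ℂ) : normLp μ 2 f ^ 2 = ∫⁻ x, ‖f x‖ₑ ^ 2 ∂μ := by
  rw [normLp, eLpNorm_eq_lintegral_rpow_enorm_toReal (by simp) (by simp), ← ENNReal.rpow_natCast,
    ← ENNReal.rpow_mul]
  simp

theorem normLp_two_le_iff {f : α →ₘ[μ] ℂ} {c : ℝ≥0∞} :
    normLp μ 2 f ≤ c ↔ ∫⁻ x, ‖f x‖ₑ ^ 2 ∂μ ≤ c ^ 2 := by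
  rw [← normLp_two_sq, ENNReal.pow_le_pow_left_iff (by simp)]

/-- At `s = 1/2` the geometric mean gives `|f|² ≤ |a| |b|`, whose integral is the duality pairing.
-/
theorem normLp_two_le_of_le_rpow_mul {N : ExtNorm μ} (h : IsSolid N) {f a b : α →ₘ[μ] ℂ}
    {c : ℝ≥0∞} (hc : c ≠ ∞)
    (hf : ∀ᵐ x ∂μ, ‖f x‖ ≤ ‖a x‖ ^ (1 - (1 / 2 : ℝ)) * ‖b x‖ ^ (1 / 2 : ℝ))
    (ha : N a ≤ c) (hb : dual N b ≤ c) : normLp μ 2 f ≤ c := by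
  rw [normLp_two_le_iff]
  calc ∫⁻ x, ‖f x‖ₑ ^ 2 ∂μ ≤ ∫⁻ x, ‖a x‖ₑ * ‖b x‖ₑ ∂μ := by
        refine lintegral_mono_ae ?_
        filter_upwards [hf] with x hx
        rw [← enorm_pow, ← enorm_mul, enorm_le_iff_norm_le, norm_pow, norm_mul]
        refine (pow_le_pow_left₀ (norm_nonneg _) hx 2).trans_eq ?_
        rw [mul_pow, ← Real.rpow_natCast, ← Real.rpow_natCast, ← Real.rpow_mul (norm_nonneg _),
          ← Real.rpow_mul (norm_nonneg _)]
        norm_num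
    _ ≤ N a * dual N b := lintegral_mul_le_dual h (ne_top_of_le_ne_top hc ha) b
    _ ≤ c ^ 2 := by rw [sq]; exact mul_le_mul' ha hb

theorem ample_dual_dual {N : ExtNorm μ} (h : IsSolid N)
    (hA : Ample μ fun E => MemInd N E ∧ MemInd (dual N) E) :
    Ample μ fun E => MemInd (dual N) E ∧ MemInd (dual (dual N)) E := by
  intro B hB hB0
  obtain ⟨E, hEB, hE0, ⟨hEm, hE⟩, hE'⟩ := hA B hB hB0
  exact ⟨E, hEB, hE0, hE', hEm, (dual_dual_le h _ hE.ne).trans_lt hE⟩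

theorem Ample.mono {P Q : Set α → Prop} (hP : Ample μ P) (h : ∀ E, P E → Q E) : Ample μ Q :=
  fun A hA hA0 => by
    obtain ⟨E, h1, h2, h3⟩ := hP A hA hA0
    exact ⟨E, h1, h2, h _ h3⟩

/-- The interpolation space of a space and its dual at `1/2` embeds into `L₂`, and derivatives of
functions that vanish at `1/2` are in `L₂`. -/
theorem exists_normLp_two_bound [SigmaFinite μ] {N : ExtNorm μ} (h : IsKothe N)
    (hA : Ample μ fun E => MemInd N E ∧ MemInd (dual N) E) :
    ∃ K : ℝ≥0, ∀ F, MemCalderon N (dual N) F → calderonNorm N (dual N) F ≠ ∞ →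
      normLp μ 2 (F (1 / 2 : ℝ)) ≤ K * calderonNorm N (dual N) F ∧
      ∀ D, F (1 / 2 : ℝ) = 0 → HasDerivIn (sumNorm N (dual N)) F (1 / 2 : ℝ) D →
        normLp μ 2 D ≤ K * calderonNorm N (dual N) F := by
  obtain ⟨K, hK⟩ := exists_calderon_bound h (dual_isKothe h.isSolid (hA.mono fun _ hE => hE.1))
    (ample_dual_dual h.isSolid hA) (s := 1 / 2) (by norm_num) (by norm_num)
  refine ⟨K, fun F hF hfin => ?_⟩
  obtain ⟨a, b, ha, hb, hv, hd⟩ := hK F hF hfin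
  have hc := ENNReal.mul_ne_top (a := (K : ℝ≥0∞)) ENNReal.coe_ne_top hfin
  exact ⟨normLp_two_le_of_le_rpow_mul h.isSolid hc hv ha hb, fun D h0 hD =>
    normLp_two_le_of_le_rpow_mul h.isSolid hc (hd D h0 hD) ha hb⟩

/-- The indicator of `A ∩ {|f| ≥ 1/(n+1)}` is dominated by a multiple of `f`, hence has finite norm,
so this set is null for every `n`. -/
theorem ae_eq_zero_of_memInd_null {N : ExtNorm μ} (h : IsSolid N) {A : Set α}
    (hA : MeasurableSet A) (H : ∀ E ⊆ A, MemInd N E → μ E = 0) {f : α →ₘ[μ] ℂ} (hf : N f < ∞) :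
    ∀ᵐ x ∂μ, x ∈ A → f x = 0 := by
  have key : ∀ n : ℕ, μ (A ∩ {x | ((n : ℝ) + 1)⁻¹ ≤ ‖f x‖}) = 0 := by
    intro n
    have hm : MeasurableSet (A ∩ {x | ((n : ℝ) + 1)⁻¹ ≤ ‖f x‖}) :=
      hA.inter (measurableSet_le measurable_const f.measurable.norm)
    refine H _ Set.inter_subset_left ⟨hm, (h.mono_smul (g := f) (n + 1) ?_).trans_lt
      (ENNReal.mul_lt_top ENNReal.coe_lt_top hf)⟩
    filter_upwards [coeFn_chi (μ := μ) hm] with x hx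
    rw [hx]
    by_cases hxE : x ∈ A ∩ {x | ((n : ℝ) + 1)⁻¹ ≤ ‖f x‖}
    · have h1 : ((n : ℝ) + 1)⁻¹ ≤ ‖f x‖ := hxE.2
      rw [inv_le_iff_one_le_mul₀ (by positivity)] at h1
      simp only [hxE, Set.indicator_of_mem, Pi.one_apply, norm_one]
      push_cast
      linarith
    · simp only [hxE, not_false_eq_true, Set.indicator_of_notMem, norm_zero]
      positivity
  have hall : ∀ᵐ x ∂μ, ∀ n : ℕ, x ∉ A ∩ {x | ((n : ℝ) + 1)⁻¹ ≤ ‖f x‖} :=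
    ae_all_iff.2 fun n => measure_eq_zero_iff_ae_notMem.1 (key n)
  filter_upwards [hall] with x hx hxA
  by_contra hne
  obtain ⟨n, hn⟩ := exists_nat_one_div_lt (norm_pos_iff.2 hne)
  exact hx n ⟨hxA, by simpa using hn.le⟩

theorem Ample.of_not_exists [SigmaFinite μ] {P : Set α → Prop}
    (H : ∀ A, MeasurableSet A → μ A ≠ 0 → μ A < ∞ → (∀ E ⊆ A, P E → μ E = 0) → False) :
    Ample μ P := by
  intro A hA hA0
  obtain ⟨A', hA'm, hA'A, hA'0, hA'f⟩ := Measure.exists_subset_measure_lt_top hA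
    (pos_iff_ne_zero.2 hA0)
  by_contra hcon
  push Not at hcon
  exact H A' hA'm hA'0.ne' hA'f fun E hE hPE => by
    by_contra h0
    exact hcon E (hE.trans hA'A) h0 hPE

theorem chi_ne_zero {A : Set α} (hA : MeasurableSet A) (h0 : μ A ≠ 0) : chi μ hA ≠ 0 := by
  intro h
  apply h0
  rw [measure_eq_zero_iff_ae_notMem]
  filter_upwards [eq_zero_iff_ae.1 h, coeFn_chi (μ := μ) hA] with x h1 h2 hx
  rw [h2] at h1
  simp [hx] at h1

/-- If the space lived off a set `A`, the dual norm would vanish on multiples of the indicator of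
`A`, and so would the sum norm. Continuity and analyticity would then say nothing about multiples of
that indicator, and a function supported at the single point `1/2` would give it interpolation norm
zero although its `L₂`-norm is not zero. -/
theorem ample_of_sameSpace [SigmaFinite μ] {N : ExtNorm μ} (h : IsSolid N)
    (hN : SameSpace (interp N (dual N) (1 / 2)) (normLp μ 2)) : Ample μ (MemInd N) := by
  refine Ample.of_not_exists fun A hA hA0 _ H => ?_
  have hdual : ∀ c : ℂ, dual N (c • chi μ hA) = 0 := by
    intro c
    refine le_antisymm (iSup_le fun f => ?_) zero_le
    rw [lintegral_congr_ae (g := 0), ]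
    · simp
    filter_upwards [ae_eq_zero_of_memInd_null h hA H (f.2.trans_lt ENNReal.one_lt_top),
      AEEqFun.coeFn_smul c (chi μ hA), coeFn_chi (μ := μ) hA] with x h1 h2 h3
    rw [h2, Pi.smul_apply, h3]
    by_cases hx : x ∈ A
    · simp [h1 hx]
    · simp [hx]
  have hsum : ∀ c : ℂ, sumNorm N (dual N) (c • chi μ hA) = 0 := fun c =>
    le_antisymm ((sumNorm_le_right h.map_zero _).trans (hdual c).le) zero_le
  have hzero : (0 : ℂ) • chi μ hA = 0 := zero_smul ℂ (chi μ hA)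
  set e : ℂ → ℂ := fun z => if z = (1 / 2 : ℝ) then 1 else 0 with he
  set F : ℂ → α →ₘ[μ] ℂ := fun z => e z • chi μ hA with hF
  have hsub : ∀ z w, F w - F z = (e w - e z) • chi μ hA := fun z w =>
    (sub_smul (e w) (e z) (chi μ hA)).symm
  have hL : ∀ t : ℝ, F (t * Complex.I) = 0 := fun t => by
    have : (t * Complex.I : ℂ) ≠ (1 / 2 : ℝ) := fun h => by
      have := congrArg Complex.re h
      simp at this
    rw [hF, he]
    simp only [this, if_false]
    exact hzero
  have hR : ∀ t : ℝ, F (1 + t * Complex.I) = 0 := fun t => by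
    have : (1 + t * Complex.I : ℂ) ≠ (1 / 2 : ℝ) := fun h => by
      have := congrArg Complex.re h
      simp at this
    rw [hF, he]
    simp only [this, if_false]
    exact hzero
  have hd0 : dual N 0 = 0 := by rw [← hzero]; exact hdual 0
  have hFm : MemCalderon N (dual N) F :=
    { bounded := ⟨0, fun z _ => (hsum _).le⟩
      continuous := fun z _ => by simp only [hsub, hsum]; exact tendsto_const_nhds
      analytic := fun z _ => ⟨0, by rw [← hzero, hsum]; simp, by
        simp only [hsub, smul_smul, sub_zero, hsum]; exact tendsto_const_nhds⟩
      mem_left := fun t => by rw [hL, h.map_zero]; simp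
      continuous_left := fun t => by simp only [hL, sub_self, h.map_zero]; exact tendsto_const_nhds
      decay_left := by simp only [hL, h.map_zero]; exact tendsto_const_nhds
      mem_right := fun t => by rw [hR, hd0]; simp
      continuous_right := fun t => by simp only [hR, sub_self, hd0]; exact tendsto_const_nhds
      decay_right := by simp only [hR, hd0]; exact tendsto_const_nhds }
  have hFhalf : F (1 / 2 : ℝ) = chi μ hA := by
    rw [hF, he]
    simp only [if_true]
    exact one_smul ℂ (chi μ hA)
  have hint := interp_le (s := 1 / 2) hFm
  rw [hFhalf] at hint
  have hc : calderonNorm N (dual N) F ≤ 0 := calderonNorm_le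
    (fun t => by rw [hL, h.map_zero]) (fun t => by rw [hR, hd0])
  obtain ⟨C, -, hC⟩ := hN
  have := (hC (chi μ hA)).2
  rw [nonpos_iff_eq_zero.1 (hint.trans hc), mul_zero, nonpos_iff_eq_zero] at this
  exact chi_ne_zero hA hA0 ((normLp_isSolid 2 (by norm_num)).eq_zero _ this)

theorem chi_mul_chi {A : Set α} (hA : MeasurableSet A) : chi μ hA * chi μ hA = chi μ hA := by
  apply AEEqFun.ext
  filter_upwards [chi_mul_apply hA (chi μ hA), coeFn_chi (μ := μ) hA] with x h1 h2
  rw [h1]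
  by_cases hx : x ∈ A <;> simp [hx, h2]

theorem norm_chi_le_one {A : Set α} (hA : MeasurableSet A) : ∀ᵐ x ∂μ, ‖chi μ hA x‖ ≤ 1 := by
  filter_upwards [coeFn_chi (μ := μ) hA] with x hx
  rw [hx]
  by_cases h : x ∈ A <;> simp [h]

theorem normLp_chi_lt_top {A : Set α} (hA : MeasurableSet A) (hfin : μ A < ∞) :
    normLp μ 2 (chi μ hA) < ∞ := by
  have h : ∫⁻ x, ‖chi μ hA x‖ₑ ^ 2 ∂μ ≤ μ A := by
    rw [← setLIntegral_one, ← lintegral_indicator hA]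
    refine lintegral_mono_ae ?_
    filter_upwards [coeFn_chi (μ := μ) hA] with x hx
    rw [hx]
    by_cases h : x ∈ A <;> simp [h]
  rw [← normLp_two_sq] at h
  by_contra hcon
  rw [not_lt, top_le_iff] at hcon
  rw [hcon] at h
  simp at h
  exact hfin.ne h

/-- If the dual lived off `A`, take `F` with value the indicator of `A` at `1/2` and multiply it by
that indicator. The product vanishes on the right edge, hence by the three lines bound also at
`1/2`. -/
theorem ample_dual_of_sameSpace [SigmaFinite μ] {N : ExtNorm μ} (h : IsKothe N)
    (hN : SameSpace (interp N (dual N) (1 / 2)) (normLp μ 2)) : Ample μ (MemInd (dual N)) := by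
  have hd := dual_isKothe h.isSolid (ample_of_sameSpace h.isSolid hN)
  refine Ample.of_not_exists fun A hA hA0 hAfin H => ?_
  obtain ⟨C, -, hC⟩ := hN
  have hlt : interp N (dual N) (1 / 2) (chi μ hA) < ∞ :=
    (hC _).1.trans_lt (ENNReal.mul_lt_top ENNReal.coe_lt_top (normLp_chi_lt_top hA hAfin))
  obtain ⟨F, hF, hFv, hFfin⟩ := exists_of_interp_lt hlt
  have hG := hF.mul_left h hd (norm_chi_le_one hA)
  have hGR : ∀ t : ℝ, dual N (chi μ hA * F (1 + t * Complex.I)) ≤ (0 : ℝ≥0) := fun t => by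
    have : chi μ hA * F (1 + t * Complex.I) = 0 := by
      refine eq_zero_iff_ae.2 ?_
      filter_upwards [chi_mul_apply hA (F (1 + t * Complex.I)),
        ae_eq_zero_of_memInd_null hd.isSolid hA H (hF.mem_right t)] with x h1 h2
      rw [h1]
      by_cases hx : x ∈ A
      · simp [hx, h2 hx]
      · simp [hx]
    rw [this, hd.map_zero]
    simp
  have hmain := hG.sumNorm_le_rpow h hd
    (a := (calderonNorm N (dual N) fun z => chi μ hA * F z).toNNReal) (b := 0) (fun t => by
    rw [ENNReal.coe_toNNReal
      ((calderonNorm_mul_le h.isSolid hd.isSolid (norm_chi_le_one hA)).trans_lt hFfin).ne]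
    exact le_calderonNorm_left (F := fun z => chi μ hA * F z) t) hGR
    (strip_subset_closedStrip (ofReal_mem_strip (s := 1 / 2) (by norm_num) (by norm_num)))
  rw [Complex.ofReal_re, NNReal.coe_zero, Real.zero_rpow (by norm_num), mul_zero, norm_le_zero_iff,
    hFv, chi_mul_chi] at hmain
  have hfin := hG.lt_top
    (strip_subset_closedStrip (ofReal_mem_strip (s := 1 / 2) (by norm_num) (by norm_num)))
  rw [hFv, chi_mul_chi] at hfin
  have := congrArg Sp.val hmain
  rw [Sp.val_of hfin, Sp.val_zero] at this
  exact chi_ne_zero hA hA0 this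

theorem ample_and_of_sameSpace [SigmaFinite μ] {N : ExtNorm μ} (h : IsKothe N)
    (hN : SameSpace (interp N (dual N) (1 / 2)) (normLp μ 2)) :
    Ample μ fun E => MemInd N E ∧ MemInd (dual N) E := by
  intro A hA hA0
  obtain ⟨E, hEA, hE0, hE⟩ := ample_of_sameSpace h.isSolid hN A hA hA0
  obtain ⟨E', hE'E, hE'0, hE'⟩ := ample_dual_of_sameSpace h hN E hE.1 hE0
  exact ⟨E', hE'E.trans hEA, hE'0, h.isSolid.memInd_mono hE hE'.1 hE'E, hE'⟩

/-! ### Exponential functions in Calderón's space. -/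

section exponential

variable {A : Set α} {ω : α → ℂ} {p q : α → ℝ} {s : ℝ}

/-- The function `1_A ω exp ((1 - z) p + z q + (z - s) ^ 2)`. -/
def expFun (A : Set α) (ω : α → ℂ) (p q : α → ℝ) (s : ℝ) (z : ℂ) : α → ℂ :=
  A.indicator fun x => ω x * Complex.exp ((1 - z) * p x + z * q x + (z - s) ^ 2)

/-- Data for which `expFun` is a bounded function with values supported in `A`. -/
structure ExpData (A : Set α) (ω : α → ℂ) (p q : α → ℝ) (M : ℝ) : Prop where
  meas_set : MeasurableSet A
  meas_phase : Measurable ω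
  meas_left : Measurable p
  meas_right : Measurable q
  phase_le : ∀ x, ‖ω x‖ ≤ 1
  left_le : ∀ x, |p x| ≤ M
  right_le : ∀ x, |q x| ≤ M

theorem ExpData.measurable {M : ℝ} (h : ExpData A ω p q M) (s : ℝ) (z : ℂ) :
    Measurable (expFun A ω p q s z) := by
  have h1 := h.meas_phase
  have h2 := h.meas_left
  have h3 := h.meas_right
  have : Measurable fun x => ω x * Complex.exp ((1 - z) * p x + z * q x + (z - s) ^ 2) := by
    fun_prop
  exact this.indicator h.meas_set

/-- The class of `expFun`. -/
def expL {M : ℝ} (μ : Measure α) (h : ExpData A ω p q M) (s : ℝ) (z : ℂ) : α →ₘ[μ] ℂ :=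
  AEEqFun.mk (expFun A ω p q s z) (h.measurable s z).aestronglyMeasurable

theorem coeFn_expL {M : ℝ} (h : ExpData A ω p q M) (s : ℝ) (z : ℂ) :
    ∀ᵐ x ∂μ, expL μ h s z x = expFun A ω p q s z x := AEEqFun.coeFn_mk _ _

theorem ExpData.measurable_deriv {M : ℝ} (h : ExpData A ω p q M) (s : ℝ) (z : ℂ) :
    Measurable fun x => expFun A ω p q s z x * (q x - p x + 2 * (z - s)) := by
  have h1 := h.measurable s z
  have h2 := h.meas_left
  have h3 := h.meas_right
  fun_prop

/-- The class of the derivative of `expFun`. -/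
def expLDeriv {M : ℝ} (μ : Measure α) (h : ExpData A ω p q M) (s : ℝ) (z : ℂ) : α →ₘ[μ] ℂ :=
  AEEqFun.mk _ (h.measurable_deriv s z).aestronglyMeasurable

theorem coeFn_expLDeriv {M : ℝ} (h : ExpData A ω p q M) (s : ℝ) (z : ℂ) :
    ∀ᵐ x ∂μ, expLDeriv μ h s z x = expFun A ω p q s z x * (q x - p x + 2 * (z - s)) :=
  AEEqFun.coeFn_mk _ _

theorem norm_expFun_le {M : ℝ} (h : ExpData A ω p q M) (s : ℝ) (z : ℂ) (x : α) :
    ‖expFun A ω p q s z x‖ ≤ A.indicator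
      (fun x => Real.exp ((1 - z.re) * p x + z.re * q x + ((z.re - s) ^ 2 - z.im ^ 2))) x := by
  unfold expFun
  by_cases hx : x ∈ A
  · simp only [hx, Set.indicator_of_mem, norm_mul, Complex.norm_exp]
    refine (mul_le_of_le_one_left (Real.exp_nonneg _) (h.phase_le x)).trans_eq ?_
    congr 1
    simp [sq]
  · simp [hx]

theorem norm_expFun_le' {M : ℝ} (h : ExpData A ω p q M) (s : ℝ) (z : ℂ) (x : α) :
    ‖expFun A ω p q s z x‖ ≤
      Real.exp (|1 - z.re| * M + |z.re| * M + ((z.re - s) ^ 2 - z.im ^ 2)) *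
        A.indicator 1 x := by
  refine (norm_expFun_le h s z x).trans ?_
  by_cases hx : x ∈ A
  · simp only [hx, Set.indicator_of_mem, Pi.one_apply, mul_one, Real.exp_le_exp]
    have h1 : (1 - z.re) * p x ≤ |1 - z.re| * M := (le_abs_self _).trans (by
      rw [abs_mul]; exact mul_le_mul_of_nonneg_left (h.left_le x) (abs_nonneg _))
    have h2 : z.re * q x ≤ |z.re| * M := (le_abs_self _).trans (by
      rw [abs_mul]; exact mul_le_mul_of_nonneg_left (h.right_le x) (abs_nonneg _))
    linarith
  · simp [hx]

theorem IsSolid.le_mul_chi {N : ExtNorm μ} (h : IsSolid N) (hA : MeasurableSet A) (C : ℝ≥0)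
    {f : α →ₘ[μ] ℂ} (hf : ∀ᵐ x ∂μ, ‖f x‖ ≤ C * A.indicator (1 : α → ℝ) x) :
    N f ≤ C * N (chi μ hA) := by
  refine h.mono_smul C ?_
  filter_upwards [hf, coeFn_chi (μ := μ) hA] with x h1 h2
  rw [h2]
  by_cases hx : x ∈ A <;> simpa [hx] using h1

theorem expL_lt_top {M : ℝ} (hd : ExpData A ω p q M) {N : ExtNorm μ} (h : IsSolid N)
    (hA : MemInd N A) (s : ℝ) (z : ℂ) : N (expL μ hd s z) < ∞ := by
  obtain ⟨hAm, hA⟩ := hA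
  refine (h.le_mul_chi hAm (Real.exp (|1 - z.re| * M + |z.re| * M +
    ((z.re - s) ^ 2 - z.im ^ 2))).toNNReal ?_).trans_lt (ENNReal.mul_lt_top ENNReal.coe_lt_top hA)
  filter_upwards [coeFn_expL (μ := μ) hd s z] with x hx
  rw [hx, Real.coe_toNNReal _ (Real.exp_nonneg _)]
  exact norm_expFun_le' hd s z x

theorem norm_exp_slope_sub_le {γ w : ℂ} {G : ℝ} (hγ : ‖γ‖ ≤ G) (hw0 : w ≠ 0)
    (hwG : ‖w‖ * (G + 1) ≤ 1) :
    ‖w⁻¹ * (Complex.exp (w * γ + w ^ 2) - 1) - γ‖ ≤ ((G + 1) ^ 2 + 1) * ‖w‖ := by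
  have hG : 0 ≤ G := (norm_nonneg _).trans hγ
  have hw1 : ‖w‖ ≤ 1 := by nlinarith [norm_nonneg w]
  have hpos : 0 < ‖w‖ := norm_pos_iff.2 hw0
  have hy : ‖w * γ + w ^ 2‖ ≤ ‖w‖ * (G + 1) := by
    rw [sq, ← mul_add, norm_mul]
    exact mul_le_mul_of_nonneg_left ((norm_add_le _ _).trans (add_le_add hγ hw1)) hpos.le
  have h1 := Complex.norm_exp_sub_one_sub_id_le (hy.trans hwG)
  have e : w⁻¹ * (Complex.exp (w * γ + w ^ 2) - 1) - γ
      = w⁻¹ * (Complex.exp (w * γ + w ^ 2) - 1 - (w * γ + w ^ 2)) + w := by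
    field_simp
    ring
  rw [e]
  refine (norm_add_le _ _).trans ?_
  rw [norm_mul, norm_inv, add_mul, one_mul]
  refine add_le_add ?_ le_rfl
  calc ‖w‖⁻¹ * ‖Complex.exp (w * γ + w ^ 2) - 1 - (w * γ + w ^ 2)‖
      ≤ ‖w‖⁻¹ * (‖w‖ * (G + 1)) ^ 2 := by
        gcongr
        exact h1.trans (pow_le_pow_left₀ (norm_nonneg _) hy 2)
    _ = (G + 1) ^ 2 * ‖w‖ := by field_simp

theorem expFun_slope_bound {M : ℝ} (h : ExpData A ω p q M) (s : ℝ) (z w : ℂ) (hw : w ≠ z)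
    (hwz : ‖w - z‖ * ((2 * M + 2 * ‖z - s‖) + 1) ≤ 1) (x : α) :
    ‖(w - z)⁻¹ * (expFun A ω p q s w x - expFun A ω p q s z x)
      - expFun A ω p q s z x * (q x - p x + 2 * (z - s))‖ ≤
      ‖w - z‖ * (Real.exp (|1 - z.re| * M + |z.re| * M + ((z.re - s) ^ 2 - z.im ^ 2)) *
        (((2 * M + 2 * ‖z - s‖) + 1) ^ 2 + 1)) * A.indicator 1 x := by
  set γ : ℂ := q x - p x + 2 * (z - s) with hγ
  have hγG : ‖γ‖ ≤ 2 * M + 2 * ‖z - s‖ := by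
    refine (norm_add_le _ _).trans (add_le_add ((norm_sub_le _ _).trans ?_) ?_)
    · rw [Complex.norm_real, Complex.norm_real, Real.norm_eq_abs, Real.norm_eq_abs]
      linarith [h.left_le x, h.right_le x]
    · rw [norm_mul]; simp
  have hexp : expFun A ω p q s w x
      = expFun A ω p q s z x * Complex.exp ((w - z) * γ + (w - z) ^ 2) := by
    unfold expFun
    by_cases hx : x ∈ A
    · simp only [hx, Set.indicator_of_mem]
      rw [mul_assoc, ← Complex.exp_add]
      congr 2
      rw [hγ]
      ring
    · simp [hx]
  have e : (w - z)⁻¹ * (expFun A ω p q s w x - expFun A ω p q s z x)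
      - expFun A ω p q s z x * γ = expFun A ω p q s z x *
        ((w - z)⁻¹ * (Complex.exp ((w - z) * γ + (w - z) ^ 2) - 1) - γ) := by
    rw [hexp]; ring
  rw [e, norm_mul]
  have h1 := norm_exp_slope_sub_le hγG (sub_ne_zero.2 hw) hwz
  have h2 := norm_expFun_le' h s z x
  calc _ ≤ (Real.exp (|1 - z.re| * M + |z.re| * M + ((z.re - s) ^ 2 - z.im ^ 2)) *
        A.indicator 1 x) * (((2 * M + 2 * ‖z - s‖ + 1) ^ 2 + 1) * ‖w - z‖) :=
        mul_le_mul h2 h1 (norm_nonneg _) ((norm_nonneg _).trans h2)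
    _ = _ := by ring

theorem expLDeriv_lt_top {M : ℝ} (hd : ExpData A ω p q M) {N : ExtNorm μ} (h : IsSolid N)
    (hA : MemInd N A) (s : ℝ) (z : ℂ) : N (expLDeriv μ hd s z) < ∞ := by
  refine (h.mono_smul (g := expL μ hd s z) (2 * M + 2 * ‖z - s‖).toNNReal ?_).trans_lt
    (ENNReal.mul_lt_top ENNReal.coe_lt_top (expL_lt_top hd h hA s z))
  filter_upwards [coeFn_expL (μ := μ) hd s z, coeFn_expLDeriv (μ := μ) hd s z] with x h1 h2
  rw [h1, h2, norm_mul, mul_comm]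
  refine mul_le_mul_of_nonneg_right ?_ (norm_nonneg _)
  have hM : 0 ≤ M := (abs_nonneg _).trans (hd.left_le x)
  rw [Real.coe_toNNReal _ (by positivity)]
  refine (norm_add_le _ _).trans (add_le_add ((norm_sub_le _ _).trans ?_) ?_)
  · rw [Complex.norm_real, Complex.norm_real, Real.norm_eq_abs, Real.norm_eq_abs]
    linarith [hd.left_le x, hd.right_le x]
  · rw [norm_mul]; simp

/-- Since `p` and `q` are bounded, the difference quotients converge uniformly on `A`. With the
indicator of `A` of finite norm this is convergence in norm, without any order continuity. -/
theorem hasDerivAt_expL {M : ℝ} (hd : ExpData A ω p q M) {N : ExtNorm μ} (h : IsSolid N)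
    (hA : MemInd N A) (s : ℝ) (z : ℂ) :
    HasDerivAt (fun w => Sp.of h (expL μ hd s w)) (Sp.of h (expLDeriv μ hd s z)) z := by
  have hfin := expL_lt_top hd h hA s
  refine ((Sp.hasDerivIn_iff h (Eventually.of_forall hfin)).1
    ⟨expLDeriv_lt_top hd h hA s z, ?_⟩).2
  obtain ⟨hAm, hA⟩ := hA
  set B : ℝ := Real.exp (|1 - z.re| * M + |z.re| * M + ((z.re - s) ^ 2 - z.im ^ 2)) *
        (((2 * M + 2 * ‖z - s‖) + 1) ^ 2 + 1) with hB
  have hB0 : 0 ≤ B := by positivity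
  have hlim : Tendsto (fun w => ENNReal.ofReal (‖w - z‖ * B) * N (chi μ hAm)) (𝓝[≠] z) (𝓝 0) := by
    have h1 : Tendsto (fun w => ‖w - z‖ * B) (𝓝[≠] z) (𝓝 0) := by
      have : Continuous fun w => ‖w - z‖ * B := by fun_prop
      simpa using (this.tendsto z).mono_left nhdsWithin_le_nhds
    have h2 := ENNReal.Tendsto.mul_const (b := N (chi μ hAm))
      (ENNReal.tendsto_ofReal h1) (Or.inr hA.ne)
    simpa using h2
  refine tendsto_of_tendsto_of_tendsto_of_le_of_le' tendsto_const_nhds hlim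
    (Eventually.of_forall fun _ => zero_le) ?_
  have hnear : ∀ᶠ w in 𝓝[≠] z, ‖w - z‖ * ((2 * M + 2 * ‖z - s‖) + 1) ≤ 1 := by
    have : Continuous fun w => ‖w - z‖ * ((2 * M + 2 * ‖z - s‖) + 1) := by fun_prop
    have h1 := (this.tendsto z).mono_left (nhdsWithin_le_nhds (s := {z}ᶜ))
    simp only [sub_self, norm_zero, zero_mul] at h1
    exact h1.eventually_le_const (by norm_num)
  filter_upwards [hnear, self_mem_nhdsWithin] with w hw hwz
  refine h.le_mul_chi hAm (‖w - z‖ * B).toNNReal ?_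
  filter_upwards [coeFn_expL (μ := μ) hd s z, coeFn_expL (μ := μ) hd s w,
    coeFn_expLDeriv (μ := μ) hd s z,
    AEEqFun.coeFn_sub ((w - z)⁻¹ • (expL μ hd s w - expL μ hd s z)) (expLDeriv μ hd s z),
    AEEqFun.coeFn_smul ((w - z)⁻¹) (expL μ hd s w - expL μ hd s z),
    AEEqFun.coeFn_sub (expL μ hd s w) (expL μ hd s z)] with x h1 h2 h3 h4 h5 h6
  rw [h4, Pi.sub_apply, h5, Pi.smul_apply, h6, Pi.sub_apply, h1, h2, h3, smul_eq_mul,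
    Real.coe_toNNReal _ (by positivity)]
  exact expFun_slope_bound hd s z w hwz hw x

theorem tendsto_exp_neg_sq_cocompact : Tendsto (fun t : ℝ => Real.exp (-t ^ 2)) (cocompact ℝ)
    (𝓝 0) := by
  have h1 : Tendsto (fun t : ℝ => ‖t‖ ^ 2) (cocompact ℝ) atTop :=
    (tendsto_pow_atTop (by norm_num)).comp tendsto_norm_cocompact_atTop
  have := Real.tendsto_exp_neg_atTop_nhds_zero.comp h1
  refine this.congr fun t => ?_
  simp

/-- This decay is the purpose of the term `(z - s) ^ 2` in the exponent. Its double zero at `s`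
leaves the value and the derivative there unchanged. -/
theorem tendsto_expL_edge {M : ℝ} (hd : ExpData A ω p q M) {N : ExtNorm μ} (h : IsSolid N)
    (hA : MemInd N A) {j : ℝ} (s0 : 0 ≤ s) (s1 : s ≤ 1) (j0 : 0 ≤ j) (j1 : j ≤ 1) :
    Tendsto (fun t : ℝ => Sp.of h (expL μ hd s (j + t * Complex.I))) (cocompact ℝ) (𝓝 0) := by
  refine Sp.tendsto_iff.2 ?_
  have hfin := expL_lt_top hd h hA s
  obtain ⟨hAm, hA⟩ := hA
  simp only [Sp.val_of (hfin _), Sp.val_zero, sub_zero]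
  have h1 : Tendsto (fun t : ℝ => Real.exp (M + 1) * Real.exp (-t ^ 2)) (cocompact ℝ) (𝓝 0) := by
    simpa using tendsto_exp_neg_sq_cocompact.const_mul (Real.exp (M + 1))
  have hlim : Tendsto (fun t : ℝ => ENNReal.ofReal (Real.exp (M + 1) * Real.exp (-t ^ 2)) *
      N (chi μ hAm)) (cocompact ℝ) (𝓝 0) := by
    simpa using ENNReal.Tendsto.mul_const (b := N (chi μ hAm))
      (ENNReal.tendsto_ofReal h1) (Or.inr hA.ne)
  refine tendsto_of_tendsto_of_tendsto_of_le_of_le tendsto_const_nhds hlim (fun _ => zero_le) ?_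
  intro t
  refine h.le_mul_chi hAm _ ?_
  filter_upwards [coeFn_expL (μ := μ) hd s (j + t * Complex.I)] with x hx
  rw [hx]
  refine (norm_expFun_le' hd s _ x).trans ?_
  rw [Real.coe_toNNReal _ (by positivity), ← Real.exp_add]
  refine mul_le_mul_of_nonneg_right (Real.exp_le_exp.2 ?_)
    (Set.indicator_nonneg (fun _ _ => zero_le_one) _)
  · simp only [Complex.add_re, Complex.ofReal_re, Complex.mul_re, Complex.I_re, mul_zero,
      Complex.ofReal_im, Complex.I_im, mul_one, sub_self, add_zero, Complex.add_im,
      Complex.mul_im, zero_add]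
    rw [abs_of_nonneg j0, abs_of_nonneg (sub_nonneg.2 j1)]
    nlinarith

theorem MemInd.mono {N N' : ExtNorm μ} (h : MemInd N A) (hle : ∀ f, N' f ≤ N f) : MemInd N' A := by
  obtain ⟨h1, h2⟩ := h
  exact ⟨h1, (hle _).trans_lt h2⟩

theorem memCalderon_expL {M : ℝ} (hd : ExpData A ω p q M) {N₀ N₁ : ExtNorm μ} (h₀ : IsKothe N₀)
    (h₁ : IsKothe N₁) (hA₀ : MemInd N₀ A) (hA₁ : MemInd N₁ A) (s0 : 0 ≤ s) (s1 : s ≤ 1) :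
    MemCalderon N₀ N₁ (expL μ hd s) := by
  have hs := sumNorm_isSolid h₀ h₁
  have hA : MemInd (sumNorm N₀ N₁) A := hA₀.mono (sumNorm_le_left h₁.map_zero)
  have hcont : ∀ {N : ExtNorm μ} (h : IsSolid N), MemInd N A →
      Continuous fun z => Sp.of h (expL μ hd s z) := fun h hA =>
    continuous_iff_continuousAt.2 fun z => (hasDerivAt_expL hd h hA s z).continuousAt
  refine MemCalderon.of_lift (S := fun z => Sp.of hs (expL μ hd s z))
    (L := fun t => Sp.of h₀.isSolid (expL μ hd s (t * Complex.I)))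
    (R := fun t => Sp.of h₁.isSolid (expL μ hd s (1 + t * Complex.I)))
    (fun z _ => Sp.val_of (expL_lt_top hd hs hA s z))
    (fun t => Sp.val_of (expL_lt_top hd h₀.isSolid hA₀ s _))
    (fun t => Sp.val_of (expL_lt_top hd h₁.isSolid hA₁ s _))
    (Differentiable.diffContOnCl fun z => (hasDerivAt_expL hd hs hA s z).differentiableAt)
    ?_ ((hcont h₀.isSolid hA₀).comp (by fun_prop)) ((hcont h₁.isSolid hA₁).comp (by fun_prop)) ?_ ?_
  · obtain ⟨hAm, hAf⟩ := hA
    refine ⟨(Real.exp (M + 1)).toNNReal * (sumNorm N₀ N₁ (chi μ hAm)).toNNReal, fun z hz => ?_⟩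
    rw [← NNReal.coe_mul, Sp.norm_le_iff, Sp.val_of (expL_lt_top hd hs ⟨hAm, hAf⟩ s z),
      ENNReal.coe_mul, ENNReal.coe_toNNReal hAf.ne]
    refine hs.le_mul_chi hAm _ ?_
    filter_upwards [coeFn_expL (μ := μ) hd s z] with x hx
    rw [hx]
    refine (norm_expFun_le' hd s _ x).trans ?_
    rw [Real.coe_toNNReal _ (by positivity)]
    refine mul_le_mul_of_nonneg_right (Real.exp_le_exp.2 ?_)
      (Set.indicator_nonneg (fun _ _ => zero_le_one) _)
    · rw [abs_of_nonneg hz.1, abs_of_nonneg (sub_nonneg.2 hz.2)]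
      have h1 := hz.1
      have h2 := hz.2
      nlinarith [sq_nonneg z.im]
  · simpa using tendsto_expL_edge hd h₀.isSolid hA₀ s0 s1 le_rfl zero_le_one
  · simpa using tendsto_expL_edge hd h₁.isSolid hA₁ s0 s1 zero_le_one le_rfl

/-- On the edges the modulus is at most `e^p` or `e^q` times that of `exp ((z - s)²)`, which is at
most `e < 3`. -/
theorem calderonNorm_expL_le {M : ℝ} (hd : ExpData A ω p q M) {N₀ N₁ : ExtNorm μ}
    (h₀ : IsSolid N₀) (h₁ : IsSolid N₁) (s0 : 0 ≤ s) (s1 : s ≤ 1) {a b : α →ₘ[μ] ℂ}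
    (ha : ∀ᵐ x ∂μ, x ∈ A → Real.exp (p x) ≤ ‖a x‖)
    (hb : ∀ᵐ x ∂μ, x ∈ A → Real.exp (q x) ≤ ‖b x‖) {c : ℝ≥0∞} (hac : N₀ a ≤ c) (hbc : N₁ b ≤ c) :
    calderonNorm N₀ N₁ (expL μ hd s) ≤ 3 * c := by
  have key : ∀ y : ℝ, y ≤ 1 → ∀ u v : ℝ, Real.exp u ≤ v → Real.exp (u + y) ≤ (3 : ℝ≥0) * v := by
    intro y hy u v huv
    rw [Real.exp_add, mul_comm]
    refine mul_le_mul ?_ huv (Real.exp_nonneg _) (by positivity)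
    have := Real.exp_one_lt_d9
    refine (Real.exp_le_exp.2 hy).trans ?_
    norm_num at this ⊢
    linarith
  refine calderonNorm_le (fun t => ?_) (fun t => ?_)
  · refine (h₀.mono_smul (g := a) 3 ?_).trans (by gcongr; simp)
    filter_upwards [coeFn_expL (μ := μ) hd s (t * Complex.I), ha] with x h1 h2
    rw [h1]
    refine (norm_expFun_le hd s _ x).trans ?_
    by_cases hx : x ∈ A
    · simp only [hx, Set.indicator_of_mem, Complex.mul_re, Complex.ofReal_re, Complex.I_re,
        mul_zero, Complex.ofReal_im, Complex.I_im, mul_one, sub_self, sub_zero, one_mul, zero_mul,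
        add_zero, Complex.mul_im, zero_sub]
      exact key _ (by nlinarith) _ _ (h2 hx)
    · simp only [hx, not_false_eq_true, Set.indicator_of_notMem]
      positivity
  · refine (h₁.mono_smul (g := b) 3 ?_).trans (by gcongr; simp)
    filter_upwards [coeFn_expL (μ := μ) hd s (1 + t * Complex.I), hb] with x h1 h2
    rw [h1]
    refine (norm_expFun_le hd s _ x).trans ?_
    by_cases hx : x ∈ A
    · simp only [hx, Set.indicator_of_mem, Complex.add_re, Complex.one_re, Complex.mul_re,
        Complex.ofReal_re, Complex.I_re, mul_zero, Complex.ofReal_im, Complex.I_im, mul_one,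
        sub_self, add_zero, zero_mul, one_mul, zero_add, Complex.add_im, Complex.one_im,
        Complex.mul_im]
      exact key _ (by nlinarith) _ _ (h2 hx)
    · simp only [hx, not_false_eq_true, Set.indicator_of_notMem]
      positivity

theorem coeFn_expL_self {M : ℝ} (h : ExpData A ω p q M) (s : ℝ) :
    ∀ᵐ x ∂μ, expL μ h s s x
      = A.indicator (fun x => ω x * (Real.exp ((1 - s) * p x + s * q x) : ℂ)) x := by
  filter_upwards [coeFn_expL (μ := μ) h s s] with x hx
  rw [hx]
  unfold expFun
  congr 1
  ext1 y
  simp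

theorem hasDerivIn_expL {M : ℝ} (hd : ExpData A ω p q M) {N : ExtNorm μ} (h : IsSolid N)
    (hA : MemInd N A) (s : ℝ) (z : ℂ) :
    HasDerivIn N (expL μ hd s) z (expLDeriv μ hd s z) :=
  (Sp.hasDerivIn_iff h (Eventually.of_forall (expL_lt_top hd h hA s))).2
    ⟨expLDeriv_lt_top hd h hA s z, hasDerivAt_expL hd h hA s z⟩

end exponential

/-! ### Powers of functions and convexification. -/

theorem coeFn_absPow (p : ℝ) (f : α →ₘ[μ] ℂ) :
    ∀ᵐ x ∂μ, absPow p f x = ((‖f x‖ ^ p : ℝ) : ℂ) := AEEqFun.coeFn_compMeasurable _ _ f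

theorem norm_absPow (p : ℝ) (f : α →ₘ[μ] ℂ) : ∀ᵐ x ∂μ, ‖absPow p f x‖ = ‖f x‖ ^ p := by
  filter_upwards [coeFn_absPow p f] with x hx
  rw [hx, Complex.norm_real, Real.norm_of_nonneg (by positivity)]

theorem enorm_absPow {p : ℝ} (hp : 0 ≤ p) (f : α →ₘ[μ] ℂ) :
    ∀ᵐ x ∂μ, ‖absPow p f x‖ₑ = ‖f x‖ₑ ^ p := by
  filter_upwards [norm_absPow p f] with x hx
  rw [← ofReal_norm, hx, ← ENNReal.ofReal_rpow_of_nonneg (norm_nonneg _) hp, ofReal_norm]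

/-- Hölder's inequality for `e_k = (t_k^{1-p} e_k^p)^{1/p} · t_k^{1/q}`. The hypothesis `h0` is
needed because the real power `0 ^ (1 - p)` takes the value `0`. -/
theorem tsum_le_rpow_tsum_mul {p q : ℝ} (hpq : p.HolderConjugate q) {e t : ℕ → ℝ≥0∞}
    (ht : ∀ k, t k ≠ ∞) (h0 : ∀ k, t k = 0 → e k = 0) :
    ∑' k, e k ≤ (∑' k, ENNReal.ofReal ((t k).toReal ^ (1 - p)) * e k ^ p) ^ (1 / p)
      * (∑' k, t k) ^ (1 / q) := by
  have hp := hpq.pos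
  have hq := hpq.symm.pos
  have hone : 1 / p + 1 / q = 1 := by simpa using hpq.inv_add_inv_eq_one
  refine ENNReal.tsum_le_of_sum_range_le fun n => ?_
  have key : ∀ k, e k ≤ (ENNReal.ofReal ((t k).toReal ^ (1 - p)) * e k ^ p) ^ (1 / p)
      * t k ^ (1 / q) := by
    intro k
    by_cases hk : t k = 0
    · rw [h0 k hk]; exact zero_le
    · have hpos : 0 < (t k).toReal := ENNReal.toReal_pos hk (ht k)
      rw [← ENNReal.ofReal_rpow_of_pos hpos, ENNReal.ofReal_toReal (ht k),
        ENNReal.mul_rpow_of_nonneg _ _ (by positivity), ← ENNReal.rpow_mul, ← ENNReal.rpow_mul,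
        mul_one_div_cancel hp.ne', ENNReal.rpow_one, mul_right_comm, ← ENNReal.rpow_add _ _ hk (ht k)]
      have : (1 - p) * (1 / p) + 1 / q = 0 := by
        rw [sub_mul, mul_one_div_cancel hp.ne']; linarith
      rw [this, ENNReal.rpow_zero, one_mul]
  have hH := ENNReal.inner_le_Lp_mul_Lq (Finset.range n)
    (fun k => (ENNReal.ofReal ((t k).toReal ^ (1 - p)) * e k ^ p) ^ (1 / p))
    (fun k => t k ^ (1 / q)) hpq
  simp only [← ENNReal.rpow_mul, one_div_mul_cancel hp.ne', one_div_mul_cancel hq.ne',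
    ENNReal.rpow_one] at hH
  refine (Finset.sum_le_sum fun k _ => key k).trans (hH.trans ?_)
  gcongr
  · exact ENNReal.sum_le_tsum _
  · exact ENNReal.sum_le_tsum _

section convexification

variable {N : ExtNorm μ} {p : ℝ}

theorem convexification_congr (h : IsSolid N) {f g : α →ₘ[μ] ℂ}
    (hfg : ∀ᵐ x ∂μ, ‖f x‖ ^ p = ‖g x‖) : convexification p N f = N g ^ (1 / p) := by
  unfold convexification
  rw [h.congr_norm]
  filter_upwards [hfg, norm_absPow p f] with x h1 h2
  rw [h2, h1]

theorem convexification_eq_zero (h : IsSolid N) (hp : 1 < p) {f : α →ₘ[μ] ℂ}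
    (hf : convexification p N f = 0) : f = 0 := by
  have hp0 : 0 < p := by linarith
  have h1 : N (absPow p f) = 0 := (ENNReal.rpow_eq_zero_iff_of_pos (by positivity)).1 hf
  have h2 := eq_zero_iff_ae.1 (h.eq_zero _ h1)
  refine eq_zero_iff_ae.2 ?_
  filter_upwards [h2, norm_absPow p f] with x h3 h4
  rw [h3, norm_zero] at h4
  exact norm_eq_zero.1 ((Real.rpow_eq_zero (norm_nonneg _) hp0.ne').1 h4.symm)

theorem convexification_mono (h : IsSolid N) (hp : 1 < p) {f g : α →ₘ[μ] ℂ}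
    (hfg : ∀ᵐ x ∂μ, ‖f x‖ ≤ ‖g x‖) : convexification p N f ≤ convexification p N g := by
  have hp0 : 0 < p := by linarith
  refine ENNReal.rpow_le_rpow (h.mono _ _ ?_) (by positivity)
  filter_upwards [hfg, norm_absPow p f, norm_absPow p g] with x h1 h2 h3
  rw [h2, h3]
  exact Real.rpow_le_rpow (norm_nonneg _) h1 hp0.le

/-- Let `t_k` be the norms of the `u_k` and `T` their sum. The functions `t_k^{1-p} |u_k|^p` have
norm at most `t_k` in the original space, so some `W` of norm at most `T` dominates their sum. By
the weighted Hölder inequality `∑ |u_k| ≤ T^{1/q} |W|^{1/p}`, and the right side has convexified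
norm at most `T`. The triangle inequality and completeness both follow. -/
theorem convexification_dominating (h : IsKothe N) (hp : 1 < p) {u : ℕ → α →ₘ[μ] ℂ}
    (hu : ∑' n, convexification p N (u n) ≠ ∞) :
    ∃ s, convexification p N s ≤ ∑' n, convexification p N (u n) ∧
      ∀ᵐ x ∂μ, ∑' n, ‖u n x‖ₑ ≤ ‖s x‖ₑ := by
  have hp0 : 0 < p := by linarith
  have hpq := Real.HolderConjugate.conjExponent hp
  set q := p.conjExponent
  have hone : 1 / p + 1 / q = 1 := by simpa using hpq.inv_add_inv_eq_one
  set t : ℕ → ℝ≥0∞ := fun n => convexification p N (u n) with ht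
  have htop : ∀ k, t k ≠ ∞ := fun k => ENNReal.ne_top_of_tsum_ne_top hu k
  set T := ∑' n, t n
  set v : ℕ → α →ₘ[μ] ℂ := fun k => (((t k).toReal ^ (1 - p) : ℝ) : ℂ) • absPow p (u k) with hv
  have hNv : ∀ k, N (v k) ≤ t k := by
    intro k
    rw [hv]
    have e : N (absPow p (u k)) = t k ^ p := by
      simp only [ht, convexification]
      rw [← ENNReal.rpow_mul, one_div_mul_cancel hp0.ne', ENNReal.rpow_one]
    rw [h.smul, e, ← ofReal_norm, Complex.norm_real, Real.norm_of_nonneg (by positivity)]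
    by_cases hk : t k = 0
    · simp [hk, ENNReal.zero_rpow_of_pos hp0]
    · have hpos : 0 < (t k).toReal := ENNReal.toReal_pos hk (htop k)
      rw [← ENNReal.ofReal_rpow_of_pos hpos, ENNReal.ofReal_toReal (htop k),
        ← ENNReal.rpow_add _ _ hk (htop k), sub_add_cancel, ENNReal.rpow_one]
  have hsum : ∑' k, N (v k) ≤ T := ENNReal.tsum_le_tsum hNv
  obtain ⟨W, hW1, hW2⟩ := h.exists_dominating (ne_top_of_le_ne_top hu hsum)
  refine ⟨(((T ^ (1 / q)).toReal : ℝ) : ℂ) • absPow (1 / p) W, ?_, ?_⟩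
  · have hT : T ^ (1 / q) ≠ ∞ := ENNReal.rpow_ne_top_of_nonneg
      (by have := hpq.symm.pos; positivity) hu
    have e : convexification p N ((((T ^ (1 / q)).toReal : ℝ) : ℂ) • absPow (1 / p) W)
        = N ((((T ^ (1 / q)).toReal ^ p : ℝ) : ℂ) • W) ^ (1 / p) := by
      refine convexification_congr h.isSolid ?_
      filter_upwards [norm_absPow (1 / p) W,
        AEEqFun.coeFn_smul (((T ^ (1 / q)).toReal : ℝ) : ℂ) (absPow (1 / p) W),
        AEEqFun.coeFn_smul (((T ^ (1 / q)).toReal ^ p : ℝ) : ℂ) W] with x h1 h2 h3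
      rw [h2, h3, Pi.smul_apply, Pi.smul_apply, norm_smul, norm_smul, h1,
        Complex.norm_real, Complex.norm_real, Real.norm_of_nonneg (by positivity),
        Real.norm_of_nonneg (by positivity),
        Real.mul_rpow (by positivity) (by positivity), ← Real.rpow_mul (norm_nonneg _),
        one_div_mul_cancel hp0.ne', Real.rpow_one]
    rw [e, h.smul, ← ofReal_norm, Complex.norm_real, Real.norm_of_nonneg (by positivity),
      ← ENNReal.ofReal_rpow_of_nonneg ENNReal.toReal_nonneg hp0.le, ENNReal.ofReal_toReal hT,
      ENNReal.mul_rpow_of_nonneg _ _ (by positivity), ← ENNReal.rpow_mul,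
      mul_one_div_cancel hp0.ne', ENNReal.rpow_one]
    have hle : N W ^ (1 / p) ≤ T ^ (1 / p) :=
      ENNReal.rpow_le_rpow (hW1.trans hsum) (by positivity)
    refine (mul_le_mul_right hle _).trans ?_
    rw [← ENNReal.rpow_add_of_nonneg _ _ (by have := hpq.symm.pos; positivity) (by positivity),
      add_comm, hone, ENNReal.rpow_one]
  · have hT : T ^ (1 / q) ≠ ∞ := ENNReal.rpow_ne_top_of_nonneg
      (by have := hpq.symm.pos; positivity) hu
    have hz : ∀ᵐ x ∂μ, ∀ k, t k = 0 → ‖u k x‖ₑ = 0 := by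
      rw [ae_all_iff]
      intro k
      by_cases hk : t k = 0
      · filter_upwards [eq_zero_iff_ae.1 (convexification_eq_zero h.isSolid hp hk)] with x hx _
        simp [hx]
      · exact Eventually.of_forall fun x hx => absurd hx hk
    filter_upwards [hz, hW2, ae_all_iff.2 fun k => enorm_absPow hp0.le (u k),
      ae_all_iff.2 fun k => AEEqFun.coeFn_smul (((t k).toReal ^ (1 - p) : ℝ) : ℂ)
        (absPow p (u k)), enorm_absPow (p := 1 / p) (by positivity) W,
      AEEqFun.coeFn_smul (((T ^ (1 / q)).toReal : ℝ) : ℂ) (absPow (1 / p) W)]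
      with x h1 h2 h3 h4 h5 h6
    refine (tsum_le_rpow_tsum_mul hpq htop h1).trans ?_
    rw [h6, Pi.smul_apply, enorm_smul, h5, mul_comm]
    refine mul_le_mul' ?_ (ENNReal.rpow_le_rpow (le_trans (le_of_eq ?_) h2) (by positivity))
    · rw [← ofReal_norm, Complex.norm_real, Real.norm_of_nonneg ENNReal.toReal_nonneg,
        ENNReal.ofReal_toReal hT]
    · refine tsum_congr fun k => ?_
      rw [hv]
      rw [h4 k, Pi.smul_apply, enorm_smul, h3 k,
        ← ofReal_norm (((t k).toReal ^ (1 - p) : ℝ) : ℂ), Complex.norm_real, Real.norm_of_nonneg (by positivity)]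

theorem convexification_isSolid (h : IsKothe N) (hp : 1 < p) : IsSolid (convexification p N) := by
  have hp0 : 0 < p := by linarith
  have hzero : convexification p N 0 = 0 := by
    rw [convexification_congr h.isSolid (g := 0), h.map_zero,
      ENNReal.zero_rpow_of_pos (by positivity)]
    filter_upwards [AEEqFun.coeFn_zero (μ := μ) (β := ℂ)] with x hx
    rw [hx]
    simp [Real.zero_rpow hp0.ne']
  refine ⟨hzero, fun f => convexification_eq_zero h.isSolid hp, fun f g => ?_, fun c f => ?_,
    fun f g => convexification_mono h.isSolid hp⟩
  · by_cases hfin : convexification p N f + convexification p N g = ∞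
    · rw [hfin]; exact le_top
    -- The triangle inequality is the Riesz–Fischer bound, with constant `1`, for the series `f, g,
    -- 0, 0, …`.
    set u : ℕ → α →ₘ[μ] ℂ := fun n => if n = 0 then f else if n = 1 then g else 0 with hu
    have hsum : ∑' n, convexification p N (u n) = convexification p N f + convexification p N g := by
      rw [tsum_eq_sum (s := Finset.range 2), Finset.sum_range_succ, Finset.sum_range_one]
      · simp [hu]
      · intro n hn
        have : ¬ n = 0 ∧ ¬ n = 1 := by simp at hn; omega
        simp [hu, this.1, this.2, hzero]
    obtain ⟨s, hs1, hs2⟩ := convexification_dominating h hp (u := u) (by rwa [hsum])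
    rw [← hsum]
    refine (convexification_mono h.isSolid hp ?_).trans hs1
    filter_upwards [hs2, AEEqFun.coeFn_add f g] with x h1 h2
    have h3 := (ENNReal.sum_le_tsum (Finset.range 2)).trans h1
    rw [Finset.sum_range_succ, Finset.sum_range_one] at h3
    simp only [hu, if_true, one_ne_zero, if_false] at h3
    rw [← enorm_le_iff_norm_le, h2]
    exact (enorm_add_le _ _).trans h3
  · have e : convexification p N (c • f) = N (((‖c‖ ^ p : ℝ) : ℂ) • absPow p f) ^ (1 / p) := by
      refine convexification_congr h.isSolid ?_
      filter_upwards [norm_absPow p f, AEEqFun.coeFn_smul c f,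
        AEEqFun.coeFn_smul ((‖c‖ ^ p : ℝ) : ℂ) (absPow p f)] with x h1 h2 h3
      rw [h2, h3, Pi.smul_apply, Pi.smul_apply, norm_smul, norm_smul, h1, Complex.norm_real,
        Real.norm_of_nonneg (by positivity), Real.mul_rpow (norm_nonneg _) (norm_nonneg _)]
    rw [e, h.smul, ← ofReal_norm, Complex.norm_real, Real.norm_of_nonneg (by positivity),
      ← ENNReal.ofReal_rpow_of_nonneg (norm_nonneg _) hp0.le,
      ENNReal.mul_rpow_of_nonneg _ _ (by positivity), ← ENNReal.rpow_mul,
      mul_one_div_cancel hp0.ne', ENNReal.rpow_one, ofReal_norm, convexification]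

theorem convexification_isKothe (h : IsKothe N) (hp : 1 < p) : IsKothe (convexification p N) := by
  refine (convexification_isSolid h hp).isKothe_of_dominating fun u hu => ?_
  obtain ⟨s, hs1, hs2⟩ := convexification_dominating h hp hu
  exact ⟨s, hs1.trans (le_mul_of_one_le_left' one_le_two), hs2⟩

end convexification

/-! ### Interpolation spaces are Köthe spaces. -/

section interp

variable {N₀ N₁ : ExtNorm μ} {θ : ℝ}

theorem interp_isSolid (h₀ : IsKothe N₀) (h₁ : IsKothe N₁) (t0 : 0 < θ) (t1 : θ < 1) :
    IsSolid (interp N₀ N₁ θ) where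
  map_zero := by
    refine le_antisymm ((interp_le (s := θ) (MemCalderon.zero h₀ h₁)).trans ?_) zero_le
    exact calderonNorm_le (fun _ => h₀.map_zero.le) (fun _ => h₁.map_zero.le)
  eq_zero f hf := by
    refine (sumNorm_isSolid h₀ h₁).eq_zero f (le_antisymm ?_ zero_le)
    rw [← hf]
    refine le_interp fun F hF hFf => ?_
    rw [← hFf]
    exact hF.sumNorm_le h₀ h₁ (strip_subset_closedStrip (ofReal_mem_strip t0 t1))
  add_le f g := by
    refine ENNReal.le_of_forall_pos_le_add fun ε hε hfin => ?_
    have hε2 : (0 : ℝ≥0∞) < (ε / 2 : ℝ≥0) := by exact_mod_cast half_pos hε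
    obtain ⟨F, hF, hFf, hFc⟩ := exists_of_interp_lt (ENNReal.lt_add_right
      (ne_top_of_le_ne_top hfin.ne le_self_add) hε2.ne')
    obtain ⟨G, hG, hGf, hGc⟩ := exists_of_interp_lt (ENNReal.lt_add_right
      (ne_top_of_le_ne_top hfin.ne le_add_self) hε2.ne')
    have h1 := interp_le (s := θ) (hF.add h₀ h₁ hG)
    simp only [hFf, hGf] at h1
    refine h1.trans ((calderonNorm_add_le h₀.isSolid h₁.isSolid).trans
      ((add_le_add hFc.le hGc.le).trans (le_of_eq ?_)))
    rw [add_add_add_comm, ← ENNReal.coe_add, add_halves]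
  smul := by
    refine enorm_smul_eq_of_le fun c f => ?_
    by_cases hc : c = 0
    · subst hc
      rw [show (0 : ℂ) • f = 0 from zero_smul ℂ f]
      refine le_of_eq_of_le ?_ zero_le
      refine le_antisymm ((interp_le (s := θ) (MemCalderon.zero h₀ h₁)).trans ?_) zero_le
      exact calderonNorm_le (fun _ => h₀.map_zero.le) (fun _ => h₁.map_zero.le)
    have hc0 : ‖c‖ₑ ≠ 0 := by simpa using hc
    rw [mul_comm, ← ENNReal.div_le_iff hc0 enorm_ne_top]
    refine le_interp fun F hF hFf => ?_
    rw [ENNReal.div_le_iff hc0 enorm_ne_top, mul_comm]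
    have h1 := interp_le (s := θ) (hF.const_smul h₀ h₁ c)
    rw [Pi.smul_apply, hFf] at h1
    exact h1.trans (calderonNorm_smul_le h₀.isSolid h₁.isSolid (ψ := fun _ => c)
      fun _ _ => le_rfl)
  mono f g hfg := by
    obtain ⟨m, hm, hmf⟩ := exists_mul_of_norm_le hfg
    refine le_interp fun F hF hFg => ?_
    have h1 := interp_le (s := θ) (hF.mul_left h₀ h₁ hm)
    simp only [hFg, hmf] at h1
    exact h1.trans (calderonNorm_mul_le h₀.isSolid h₁.isSolid hm)

/-- Almost optimal functions for the absolute values `|u n|` are summed in Calderón's space; the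
value of the sum at `θ` is the majorant. -/
theorem interp_isKothe (h₀ : IsKothe N₀) (h₁ : IsKothe N₁) (t0 : 0 < θ) (t1 : θ < 1) :
    IsKothe (interp N₀ N₁ θ) := by
  have hI := interp_isSolid h₀ h₁ t0 t1
  have hS := sumNorm_isSolid h₀ h₁
  refine hI.isKothe_of_dominating fun u hu => ?_
  have hsel : ∀ n, ∃ F, MemCalderon N₀ N₁ F ∧ F θ = absL (u n) ∧
      calderonNorm N₀ N₁ F ≤ 2 * interp N₀ N₁ θ (u n) := by
    intro n
    by_cases h0 : interp N₀ N₁ θ (u n) = 0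
    · refine ⟨fun _ => 0, MemCalderon.zero h₀ h₁, ?_, ?_⟩
      · symm
        rw [eq_zero_iff_ae]
        filter_upwards [coeFn_absL (u n), eq_zero_iff_ae.1 (hI.eq_zero _ h0)] with x h1 h2
        rw [h1, h2]; simp
      · exact (calderonNorm_le (fun _ => h₀.map_zero.le) (fun _ => h₁.map_zero.le)).trans zero_le
    · have hlt : interp N₀ N₁ θ (absL (u n)) < 2 * interp N₀ N₁ θ (u n) := by
        rw [hI.abs_eq, two_mul]
        exact ENNReal.lt_add_right (ENNReal.ne_top_of_tsum_ne_top hu n) h0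
      obtain ⟨F, hF, hFf, hFc⟩ := exists_of_interp_lt hlt
      exact ⟨F, hF, hFf, hFc.le⟩
  choose F hF hFf hFc using hsel
  have hsum : ∑' n, calderonNorm N₀ N₁ (F n) ≤ 2 * ∑' n, interp N₀ N₁ θ (u n) := by
    rw [← ENNReal.tsum_mul_left]
    exact ENNReal.tsum_le_tsum hFc
  obtain ⟨G, hG, hGc, hGt⟩ := MemCalderon.exists_tsum h₀ h₁ hF
    (ne_top_of_le_ne_top (ENNReal.mul_ne_top (by norm_num) hu) hsum)
  refine ⟨G θ, (interp_le hG).trans (hGc.trans hsum), hS.ae_tsum_le_of_tendsto ?_⟩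
  simpa only [hFf] using hGt θ (strip_subset_closedStrip (ofReal_mem_strip t0 t1))

end interp

/-! ### The common properties of the two choices of the space `Y`. -/

/-- `Y` is trapped between the `(1 - θ)⁻¹`-convexification of `N` and the functions
`exp ((1 - θ) p + θ log r)` with `exp p` in the ball of radius `r` of `N`. -/
structure IsScaling (N Y : ExtNorm μ) (θ : ℝ) (C : ℝ≥0) : Prop where
  isKothe : IsKothe Y
  convexification_le : ∀ f, convexification (1 / (1 - θ)) N f ≤ C * Y f
  le_of_exp : ∀ {A : Set α} {p : α → ℝ} {M r : ℝ} {a g : α →ₘ[μ] ℂ}, MemInd N A → Measurable p →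
    (∀ x, |p x| ≤ M) → 0 < r → N a ≤ ENNReal.ofReal r →
    (∀ᵐ x ∂μ, x ∈ A → Real.exp (p x) ≤ ‖a x‖) →
    (∀ᵐ x ∂μ, ‖g x‖ ≤ A.indicator (fun x => Real.exp ((1 - θ) * p x + θ * Real.log r)) x) →
    Y g ≤ C * ENNReal.ofReal r

theorem convexification_le_of_le_rpow_mul {N : ExtNorm μ} (h : IsSolid N) {θ : ℝ} (t0 : 0 < θ)
    (t1 : θ < 1) {f a : α →ₘ[μ] ℂ} {r : ℝ} (hr : 0 ≤ r)
    (hf : ∀ᵐ x ∂μ, ‖f x‖ ≤ ‖a x‖ ^ (1 - θ) * r ^ θ) (ha : N a ≤ ENNReal.ofReal r) :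
    convexification (1 / (1 - θ)) N f ≤ ENNReal.ofReal r := by
  have h1 : 0 < 1 - θ := by linarith
  set p := 1 / (1 - θ) with hp
  have hp0 : 0 < p := by positivity
  have hp1 : (1 - θ) * p = 1 := mul_one_div_cancel h1.ne'
  have hb : N (absPow p f) ≤ ENNReal.ofReal (r ^ p) := by
    have hle : N (absPow p f) ≤ (r ^ (θ * p)).toNNReal * N a := by
      refine h.mono_smul _ ?_
      filter_upwards [hf, norm_absPow p f] with x h2 h3
      rw [h3, Real.coe_toNNReal _ (by positivity)]
      refine (Real.rpow_le_rpow (norm_nonneg _) h2 hp0.le).trans_eq ?_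
      rw [Real.mul_rpow (by positivity) (by positivity), ← Real.rpow_mul (norm_nonneg _),
        ← Real.rpow_mul hr, hp1, Real.rpow_one, mul_comm]
    refine hle.trans ((mul_le_mul_right ha _).trans_eq ?_)
    rw [← ENNReal.ofReal, ← ENNReal.ofReal_mul (by positivity),
      ← Real.rpow_add_one' hr (by positivity)]
    congr 2
    linarith
  unfold convexification
  refine (ENNReal.rpow_le_rpow hb (by positivity)).trans_eq ?_
  rw [← ENNReal.ofReal_rpow_of_nonneg hr hp0.le, ← ENNReal.rpow_mul, mul_one_div_cancel hp0.ne',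
    ENNReal.rpow_one]

theorem isScaling_convexification {N : ExtNorm μ} (h : IsKothe N) {θ : ℝ} (t0 : 0 < θ)
    (t1 : θ < 1) : IsScaling N (convexification (1 / (1 - θ)) N) θ 1 where
  isKothe := convexification_isKothe h (by rw [lt_one_div one_pos (by linarith)]; linarith)
  convexification_le f := by simp
  le_of_exp {A p M r a g} _ _ _ hr ha hexp hg := by
    rw [ENNReal.coe_one, one_mul]
    refine convexification_le_of_le_rpow_mul h.isSolid t0 t1 hr.le ?_ ha
    filter_upwards [hexp, hg] with x h1 h2
    refine h2.trans ?_
    by_cases hx : x ∈ A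
    · rw [Set.indicator_of_mem hx, Real.exp_add, mul_comm (1 - θ), Real.exp_mul,
        mul_comm θ, Real.exp_mul, Real.exp_log hr]
      have : 0 ≤ 1 - θ := by linarith
      gcongr
      exact h1 hx
    · rw [Set.indicator_of_notMem hx]
      positivity

theorem measure_lt_top_of_memInd {N : ExtNorm μ} (h : IsSolid N) {E : Set α} (hE : MemInd N E)
    (hE' : MemInd (dual N) E) : μ E < ∞ := by
  obtain ⟨hm, hE⟩ := hE
  obtain ⟨_, hE'⟩ := hE'
  have h1 := lintegral_mul_le_dual h hE.ne (chi μ hm)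
  rw [lintegral_chi_mul] at h1
  refine lt_of_eq_of_lt ?_ (h1.trans_lt (ENNReal.mul_lt_top hE hE'))
  rw [← setLIntegral_one]
  refine lintegral_congr_ae ?_
  filter_upwards [ae_restrict_mem hm, ae_restrict_of_ae (coeFn_chi (μ := μ) hm)] with x h2 h3
  rw [h3, Set.indicator_of_mem h2]
  simp

theorem ae_enorm_le_normLp_top (f : α →ₘ[μ] ℂ) : ∀ᵐ x ∂μ, ‖f x‖ₑ ≤ normLp μ ∞ f := by
  rw [normLp, eLpNorm_exponent_top]
  exact ae_le_eLpNormEssSup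

theorem memInd_dual_top {E : Set α} (hE : MeasurableSet E) (hfin : μ E < ∞) :
    MemInd (dual (normLp μ ∞)) E := by
  refine ⟨hE, lt_of_le_of_lt (iSup_le fun f => ?_) hfin⟩
  rw [lintegral_congr fun x => mul_comm ‖f.1 x‖ₑ _, lintegral_chi_mul, ← setLIntegral_one]
  refine lintegral_mono_ae (ae_restrict_of_ae ?_)
  filter_upwards [ae_enorm_le_normLp_top f.1] with x hx
  exact hx.trans f.2

/-- The pointwise bound with `|b|` at most a constant places the interpolation space inside the
convexification. In the other direction, `exp ((1 - z) p + z log r)` is an explicit function for the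
pair with `L_∞`; bounded exponents on one set suffice for what follows. -/
theorem exists_isScaling_interp [SigmaFinite μ] {N : ExtNorm μ} (h : IsKothe N)
    (hA : Ample μ fun E => MemInd N E ∧ MemInd (dual N) E) {θ : ℝ} (t0 : 0 < θ)
    (t1 : θ < 1) : ∃ C, IsScaling N (interp N (normLp μ ∞) θ) θ C := by
  have hL := normLp_top_isKothe (μ := μ)
  obtain ⟨K, hK⟩ := exists_calderon_bound h hL (hA.mono fun E hE =>
    ⟨hE.2, memInd_dual_top hE.1.1 (measure_lt_top_of_memInd h.isSolid hE.1 hE.2)⟩) t0 t1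
  refine ⟨K + 3, interp_isKothe h hL t0 t1, fun f => ?_, ?_⟩
  · have hK0 : ((K + 3 : ℝ≥0) : ℝ≥0∞) ≠ 0 := by
      rw [Ne, ENNReal.coe_eq_zero]; positivity
    rw [mul_comm, ← ENNReal.div_le_iff hK0 ENNReal.coe_ne_top]
    refine le_interp fun F hF hFf => ?_
    rw [ENNReal.div_le_iff hK0 ENNReal.coe_ne_top, mul_comm]
    by_cases hfin : calderonNorm N (normLp μ ∞) F = ∞
    · rw [hfin, ENNReal.mul_top hK0]; exact le_top
    obtain ⟨a, b, ha, hb, hab, -⟩ := hK F hF hfin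
    rw [hFf] at hab
    set c := K * calderonNorm N (normLp μ ∞) F with hc
    have hctop : c ≠ ∞ := ENNReal.mul_ne_top ENNReal.coe_ne_top hfin
    have hmain := convexification_le_of_le_rpow_mul h.isSolid t0 t1 (f := f) (a := a)
      (r := c.toReal) ENNReal.toReal_nonneg ?_ (by rwa [ENNReal.ofReal_toReal hctop])
    · rw [ENNReal.ofReal_toReal hctop] at hmain
      refine hmain.trans ?_
      rw [hc]
      gcongr
      simp
    · filter_upwards [hab, ae_enorm_le_normLp_top b] with x h1 h2
      refine h1.trans (mul_le_mul_of_nonneg_left ?_ (by positivity))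
      refine Real.rpow_le_rpow (norm_nonneg _) ?_ t0.le
      rw [← toReal_enorm]
      exact ENNReal.toReal_mono hctop (h2.trans hb)
  · intro A p M r a g hAN hp hM hr ha hexp hg
    have hAL : MemInd (normLp μ ∞) A := by
      obtain ⟨hm, -⟩ := hAN
      refine ⟨hm, lt_of_le_of_lt ?_ ENNReal.one_lt_top⟩
      rw [normLp, eLpNorm_exponent_top]
      refine essSup_le_of_ae_le _ ?_
      filter_upwards [norm_chi_le_one (μ := μ) hm] with x hx
      rw [← ofReal_norm]
      exact ENNReal.ofReal_le_one.2 hx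
    have hd : ExpData A (fun _ => 1) p (fun _ => Real.log r) (max M |Real.log r|) :=
      ⟨hAN.1, measurable_const, hp, measurable_const, by simp,
        fun x => (hM x).trans (le_max_left _ _), fun _ => le_max_right _ _⟩
    have hF := memCalderon_expL hd h hL hAN hAL t0.le t1.le
    have hrC : ‖(r : ℂ)‖ₑ = ENNReal.ofReal r := by
      rw [← ofReal_norm, Complex.norm_real, Real.norm_of_nonneg hr.le]
    have hn := calderonNorm_expL_le hd h.isSolid hL.isSolid t0.le t1.le (μ := μ) (a := a)
      (b := AEEqFun.const α (r : ℂ)) hexp ?_ ha ?_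
    · refine ((interp_isKothe h hL t0 t1).mono _ (expL μ hd θ θ) ?_).trans
        ((interp_le hF).trans (hn.trans ?_))
      · filter_upwards [hg, coeFn_expL_self (μ := μ) hd θ] with x h1 h2
        refine h1.trans_eq ?_
        rw [h2]
        by_cases hx : x ∈ A
        · simp only [hx, Set.indicator_of_mem, one_mul, Complex.norm_real,
            Real.norm_of_nonneg (Real.exp_nonneg _)]
        · simp [hx]
      · gcongr
        simp
    · filter_upwards [AEEqFun.coeFn_const (μ := μ) α (r : ℂ)] with x hx _
      rw [hx, Real.exp_log hr, Function.const_apply, Complex.norm_real,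
        Real.norm_of_nonneg hr.le]
    · rw [normLp, eLpNorm_congr_ae (AEEqFun.coeFn_const α _), eLpNorm_exponent_top]
      exact essSup_le_of_ae_le _ (Eventually.of_forall fun x => hrC.le)

namespace IsScaling

variable {N Y : ExtNorm μ} {θ : ℝ} {C : ℝ≥0}

/-- For `u` in the unit ball of `Y`, `|u|^{1/(1-θ)}` lies in `N`. Hölder's inequality with exponents
`1/(1-θ)` and `1/θ` splits the integral of `|u| |b|^{1-θ} |f|^{2θ}` into the pairing of
`|u|^{1/(1-θ)}` with `b` and the integral of `|f|²`. -/
theorem dual_le (hY : IsScaling N Y θ C) (h : IsSolid N) (t0 : 0 < θ) (t1 : θ < 1)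
    {b f g : α →ₘ[μ] ℂ} (c : ℝ≥0)
    (hg : ∀ᵐ x ∂μ, ‖g x‖ ≤ c * (‖b x‖ ^ (1 - θ) * ‖f x‖ ^ (2 * θ))) :
    dual Y g ≤ C * c * (dual N b ^ (1 - θ) * normLp μ 2 f ^ (2 * θ)) := by
  have h1 : 0 < 1 - θ := by linarith
  refine iSup_le fun u => ?_
  set p := 1 / (1 - θ) with hp
  have hp0 : 0 < p := by positivity
  have hp1 : p * (1 - θ) = 1 := one_div_mul_cancel h1.ne'
  have hu : N (absPow p u.1) ≤ (C : ℝ≥0∞) ^ p := by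
    have h2 := (hY.convexification_le u.1).trans (mul_le_of_le_one_right' u.2)
    have h3 := ENNReal.rpow_le_rpow h2 hp0.le
    rwa [convexification, ← ENNReal.rpow_mul, one_div_mul_cancel hp0.ne', ENNReal.rpow_one] at h3
  have hufin : N (absPow p u.1) ≠ ∞ :=
    ne_top_of_le_ne_top (ENNReal.rpow_ne_top_of_nonneg hp0.le ENNReal.coe_ne_top) hu
  calc ∫⁻ x, ‖u.1 x‖ₑ * ‖g x‖ₑ ∂μ
      ≤ ∫⁻ x, c * ((‖absPow p u.1 x‖ₑ * ‖b x‖ₑ) ^ (1 - θ) * (‖f x‖ₑ ^ 2) ^ θ) ∂μ := by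
        refine lintegral_mono_ae ?_
        filter_upwards [hg, enorm_absPow hp0.le u.1] with x h2 h3
        have h4 : ‖g x‖ₑ ≤ c * (‖b x‖ₑ ^ (1 - θ) * ‖f x‖ₑ ^ (2 * θ)) := by
          have := ENNReal.ofReal_le_ofReal h2
          rwa [ENNReal.ofReal_mul c.coe_nonneg, ENNReal.ofReal_mul (by positivity),
            ← ENNReal.ofReal_rpow_of_nonneg (norm_nonneg _) h1.le,
            ← ENNReal.ofReal_rpow_of_nonneg (norm_nonneg _) (by positivity), ofReal_norm,
            ofReal_norm, ofReal_norm, ENNReal.ofReal_coe_nnreal] at this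
        refine (mul_le_mul_right h4 _).trans_eq ?_
        rw [h3, ENNReal.mul_rpow_of_nonneg _ _ h1.le, ← ENNReal.rpow_mul, hp1, ENNReal.rpow_one,
          ← ENNReal.rpow_natCast, ← ENNReal.rpow_mul, Nat.cast_ofNat]
        ring
    _ = c * ∫⁻ x, (‖absPow p u.1 x‖ₑ * ‖b x‖ₑ) ^ (1 - θ) * (‖f x‖ₑ ^ 2) ^ θ ∂μ :=
        lintegral_const_mul' _ _ ENNReal.coe_ne_top
    _ ≤ c * ((∫⁻ x, ‖absPow p u.1 x‖ₑ * ‖b x‖ₑ ∂μ) ^ (1 - θ) * (∫⁻ x, ‖f x‖ₑ ^ 2 ∂μ) ^ θ) := by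
        gcongr
        exact ENNReal.lintegral_mul_norm_pow_le
          ((aemeasurable_enorm_L0 _).mul (aemeasurable_enorm_L0 _))
          ((aemeasurable_enorm_L0 f).pow_const 2) h1.le t0.le (by ring)
    _ ≤ c * (((C : ℝ≥0∞) ^ p * dual N b) ^ (1 - θ) * (normLp μ 2 f ^ 2) ^ θ) := by
        rw [normLp_two_sq]
        gcongr
        exact (lintegral_mul_le_dual h hufin b).trans (mul_le_mul_left hu _)
    _ = C * c * (dual N b ^ (1 - θ) * normLp μ 2 f ^ (2 * θ)) := by
        rw [ENNReal.mul_rpow_of_nonneg _ _ h1.le, ← ENNReal.rpow_mul, hp1, ENNReal.rpow_one,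
          ← ENNReal.rpow_natCast, ← ENNReal.rpow_mul, Nat.cast_ofNat]
        ring

theorem memInd (hY : IsScaling N Y θ C) (t0 : 0 < θ) {E : Set α} (hE : MemInd N E) :
    MemInd Y E := by
  obtain ⟨hm, hfin⟩ := hE
  refine ⟨hm, ?_⟩
  -- The lower bound `r ≥ 1` makes `θ log r` nonnegative, so the indicator is dominated by the
  -- admissible function with `p = 0`.
  set r : ℝ := max 1 (N (chi μ hm)).toReal with hr
  have hr1 : 1 ≤ r := le_max_left _ _
  refine (hY.le_of_exp (A := E) (p := fun _ => 0) (M := 0) (r := r) (a := chi μ hm) ⟨hm, hfin⟩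
    measurable_const (by simp) (by linarith) ?_ ?_ ?_).trans_lt
    (ENNReal.mul_lt_top ENNReal.coe_lt_top ENNReal.ofReal_lt_top)
  · rw [← ENNReal.ofReal_toReal hfin.ne]
    exact ENNReal.ofReal_le_ofReal (le_max_right _ _)
  · filter_upwards [coeFn_chi (μ := μ) hm] with x hx hxE
    simp [hx, hxE]
  · filter_upwards [coeFn_chi (μ := μ) hm] with x hx
    rw [hx]
    by_cases hxE : x ∈ E
    · have : 0 ≤ θ * Real.log r := mul_nonneg t0.le (Real.log_nonneg hr1)
      simpa [hxE] using this
    · simp [hxE]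

theorem memInd_dual (hY : IsScaling N Y θ C) (h : IsSolid N) (t0 : 0 < θ) (t1 : θ < 1)
    {E : Set α} (hE : MemInd N E) (hE' : MemInd (dual N) E) : MemInd (dual Y) E := by
  have hfin := measure_lt_top_of_memInd h hE hE'
  obtain ⟨hm, hE'⟩ := hE'
  refine ⟨hm, (hY.dual_le h t0 t1 (b := chi μ hm) (f := chi μ hm) 1 ?_).trans_lt ?_⟩
  · filter_upwards [coeFn_chi (μ := μ) hm] with x hx
    rw [hx]
    by_cases hxE : x ∈ E
    · simp [hxE]
    · simp only [hxE, not_false_eq_true, Set.indicator_of_notMem, norm_zero]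
      positivity
  · refine ENNReal.mul_lt_top (ENNReal.mul_lt_top ENNReal.coe_lt_top ENNReal.coe_lt_top)
      (ENNReal.mul_lt_top (ENNReal.rpow_lt_top_of_nonneg (by linarith) hE'.ne)
        (ENNReal.rpow_lt_top_of_nonneg (by positivity) (normLp_chi_lt_top hm hfin).ne))

theorem ample (hY : IsScaling N Y θ C) (h : IsSolid N) (t0 : 0 < θ) (t1 : θ < 1)
    (hA : Ample μ fun E => MemInd N E ∧ MemInd (dual N) E) :
    Ample μ fun E => MemInd Y E ∧ MemInd (dual Y) E :=
  hA.mono fun _ hE => ⟨hY.memInd t0 hE.1, hY.memInd_dual h t0 t1 hE.1 hE.2⟩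

end IsScaling

/-! ### Derivatives, and gluing of functions with disjoint supports. -/

namespace HasDerivIn

variable {N : ExtNorm μ} {F G : ℂ → α →ₘ[μ] ℂ} {z : ℂ} {D E : α →ₘ[μ] ℂ}

theorem unique (h : IsSolid N) (hD : HasDerivIn N F z D) (hE : HasDerivIn N F z E) : D = E := by
  rw [← sub_eq_zero]
  refine h.eq_zero _ (le_antisymm ?_ zero_le)
  have h1 := hE.2.add hD.2
  rw [add_zero] at h1
  refine ge_of_tendsto h1 (Eventually.of_forall fun w => ?_)
  refine (le_of_eq ?_).trans (h.sub_le _ _)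
  congr 1
  abel

theorem congr (hF : HasDerivIn N F z D) (hFG : ∀ᶠ w in 𝓝 z, F w = G w) : HasDerivIn N G z D := by
  refine ⟨hF.1, hF.2.congr' ?_⟩
  filter_upwards [hFG.filter_mono nhdsWithin_le_nhds] with w hw
  rw [hw, hFG.self_of_nhds]

theorem mul_left (h : IsSolid N) (hF : HasDerivIn N F z D) {m : α →ₘ[μ] ℂ}
    (hm : ∀ᵐ x ∂μ, ‖m x‖ ≤ 1) : HasDerivIn N (fun w => m * F w) z (m * D) := by
  refine ⟨(h.mul_le hm D).trans_lt hF.1, tendsto_of_tendsto_of_tendsto_of_le_of_le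
    tendsto_const_nhds hF.2 (fun _ => zero_le) fun w => ?_⟩
  simp only
  rw [← mul_sub_L0, ← mul_smul_L0, ← mul_sub_L0]
  exact h.mul_le hm _

theorem add (h : IsSolid N) (hF : HasDerivIn N F z D) (hG : HasDerivIn N G z E) :
    HasDerivIn N (fun w => F w + G w) z (D + E) := by
  refine ⟨(h.add_le _ _).trans_lt (ENNReal.add_lt_top.2 ⟨hF.1, hG.1⟩), ?_⟩
  have h1 := hF.2.add hG.2
  rw [add_zero] at h1
  refine tendsto_of_tendsto_of_tendsto_of_le_of_le
    tendsto_const_nhds h1 (fun _ => zero_le) fun w => ?_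
  refine (le_of_eq ?_).trans (h.add_le _ _)
  congr 1
  rw [add_sub_add_comm, show (w - z)⁻¹ • (F w - F z + (G w - G z))
    = (w - z)⁻¹ • (F w - F z) + (w - z)⁻¹ • (G w - G z) from smul_add _ _ _, add_sub_add_comm]

theorem const_smul (h : IsSolid N) (hF : HasDerivIn N F z D) (c : ℂ) :
    HasDerivIn N (c • F) z (c • D) := by
  refine ⟨by rw [h.smul]; exact ENNReal.mul_lt_top enorm_lt_top hF.1, ?_⟩
  have h1 := ENNReal.Tendsto.const_mul (a := ‖c‖ₑ) hF.2 (Or.inr enorm_ne_top)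
  rw [mul_zero] at h1
  refine h1.congr fun w => ?_
  rw [← h.smul]
  congr 1
  rw [show c • ((w - z)⁻¹ • (F w - F z) - D) = c • ((w - z)⁻¹ • (F w - F z)) - c • D from
    smul_sub _ _ _, show c • ((w - z)⁻¹ • (F w - F z)) = (w - z)⁻¹ • (c • (F w - F z)) from
    smul_comm _ _ _, show c • (F w - F z) = c • F w - c • F z from smul_sub _ _ _]
  rfl

theorem sub (h : IsSolid N) (hF : HasDerivIn N F z D) (hG : HasDerivIn N G z E) :
    HasDerivIn N (fun w => F w - G w) z (D - E) := by
  have h1 := hF.add h (hG.const_smul h (-1))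
  rw [show (-1 : ℂ) • E = -E from neg_one_smul ℂ E, ← sub_eq_add_neg] at h1
  refine h1.congr (Eventually.of_forall fun w => ?_)
  rw [Pi.smul_apply, show (-1 : ℂ) • G w = -G w from neg_one_smul ℂ (G w), ← sub_eq_add_neg]

end HasDerivIn

/-- A zero of `ψ` removes the term with the derivative of `F`. Adding such a product changes a
derivative by a prescribed amount while keeping the value. -/
theorem MemCalderon.hasDerivIn_smul {N₀ N₁ : ExtNorm μ} {F : ℂ → α →ₘ[μ] ℂ}
    (hF : MemCalderon N₀ N₁ F) (hs : IsSolid (sumNorm N₀ N₁)) {z : ℂ} (hz : z ∈ strip)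
    {ψ : ℂ → ℂ} {ψ' : ℂ} (hψ : HasDerivAt ψ ψ' z) (h0 : ψ z = 0) :
    HasDerivIn (sumNorm N₀ N₁) (fun w => ψ w • F w) z (ψ' • F z) := by
  obtain ⟨D, hD⟩ := hF.analytic z hz
  have h1 := ((hF.hasDerivIn_iff hs hz).1 hD).2
  have hfin := hF.eventually_lt_top hz
  have hfin' : ∀ᶠ w in 𝓝 z, sumNorm N₀ N₁ (ψ w • F w) < ∞ := by
    filter_upwards [hfin] with w hw
    rw [hs.smul]
    exact ENNReal.mul_lt_top enorm_lt_top hw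
  have hz' : sumNorm N₀ N₁ (ψ' • F z) < ∞ := by
    rw [hs.smul]
    exact ENNReal.mul_lt_top enorm_lt_top hfin.self_of_nhds
  have hof : ∀ (c : ℂ) (f : α →ₘ[μ] ℂ), sumNorm N₀ N₁ f < ∞ →
      c • Sp.of hs f = Sp.of hs (c • f) := by
    intro c f hf
    rw [← Sp.of_val (c • Sp.of hs f), Sp.val_smul, Sp.val_of hf]
  refine (Sp.hasDerivIn_iff hs hfin').2 ⟨hz', ?_⟩
  have h2 := hψ.smul h1
  rw [h0, zero_smul, zero_add, hof _ _ hfin.self_of_nhds] at h2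
  refine h2.congr_of_eventuallyEq ?_
  filter_upwards [hfin] with w hw
  exact (hof _ _ hw).symm

/-- `F` is a function in Calderón's space of norm at most `c` whose values vanish off `A`, with
value `1_A f` and derivative `D` at `1 / 2`. -/
structure Piece (N₀ N₁ : ExtNorm μ) (f : α →ₘ[μ] ℂ) (c : ℝ≥0∞) (A : Set α)
    (F : ℂ → α →ₘ[μ] ℂ) (D : α →ₘ[μ] ℂ) : Prop where
  mem : MemCalderon N₀ N₁ F
  norm_le : calderonNorm N₀ N₁ F ≤ c
  support : ∀ z, ∀ᵐ x ∂μ, x ∉ A → F z x = 0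
  value : ∀ᵐ x ∂μ, x ∈ A → F (1 / 2 : ℝ) x = f x
  deriv : HasDerivIn (sumNorm N₀ N₁) F (1 / 2 : ℝ) D

theorem half_mem_strip : ((1 / 2 : ℝ) : ℂ) ∈ strip :=
  ofReal_mem_strip (by norm_num) (by norm_num)

theorem MemCalderon.deriv_eq_of_mul_eq {N₀ N₁ : ExtNorm μ} {F G : ℂ → α →ₘ[μ] ℂ}
    {D E m : α →ₘ[μ] ℂ} (hs : IsSolid (sumNorm N₀ N₁)) {z : ℂ} (hz : z ∈ strip)
    (hG : HasDerivIn (sumNorm N₀ N₁) G z E) (hF : HasDerivIn (sumNorm N₀ N₁) F z D)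
    (hm : ∀ᵐ x ∂μ, ‖m x‖ ≤ 1) (hGF : ∀ w ∈ strip, m * G w = F w) : m * E = D :=
  ((hG.mul_left hs hm).congr
    (eventually_of_mem (isOpen_strip.mem_nhds hz) hGF)).unique hs hF

theorem coeFn_sum_L0 {ι : Type*} (s : Finset ι) (u : ι → α →ₘ[μ] ℂ) :
    ∀ᵐ x ∂μ, (∑ i ∈ s, u i : α →ₘ[μ] ℂ) x = ∑ i ∈ s, u i x := by
  classical
  induction s using Finset.induction_on with
  | empty => exact AEEqFun.coeFn_zero
  | insert i s hi ih =>
    rw [Finset.sum_insert hi]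
    filter_upwards [ih, AEEqFun.coeFn_add (u i) (∑ i ∈ s, u i)] with x h1 h2
    rw [h2, Pi.add_apply, h1, Finset.sum_insert hi]

/-- The pieces are summed in Calderón's space. By disjointness, multiplication by the indicator of
`A n` recovers the `n`-th piece; it also commutes with differentiation, so the derivative of the sum
is found on each set without differentiating the series. -/
theorem exists_piece_union {N₀ N₁ : ExtNorm μ} (h₀ : IsKothe N₀) (h₁ : IsKothe N₁)
    {f : α →ₘ[μ] ℂ} {c : ℕ → ℝ≥0∞} {A : ℕ → Set α} {F : ℕ → ℂ → α →ₘ[μ] ℂ}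
    {D : ℕ → α →ₘ[μ] ℂ} (hA : ∀ n, MeasurableSet (A n)) (hdisj : Pairwise (Function.onFun Disjoint A))
    (hF : ∀ n, Piece N₀ N₁ f (c n) (A n) (F n) (D n)) (hc : ∑' n, c n ≠ ∞)
    (hf : ∀ᵐ x ∂μ, x ∉ ⋃ n, A n → f x = 0) :
    ∃ G E, Piece N₀ N₁ f (∑' n, c n) Set.univ G E ∧
      (∀ᵐ x ∂μ, ∀ n, x ∈ A n → E x = D n x) ∧ ∀ᵐ x ∂μ, x ∉ ⋃ n, A n → E x = 0 := by
  have hs := sumNorm_isSolid h₀ h₁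
  have hle : ∑' n, calderonNorm N₀ N₁ (F n) ≤ ∑' n, c n :=
    ENNReal.tsum_le_tsum fun n => (hF n).norm_le
  obtain ⟨G, hG, hGc, hGt⟩ := MemCalderon.exists_tsum h₀ h₁ (fun n => (hF n).mem)
    (ne_top_of_le_ne_top hc hle)
  obtain ⟨E, hE⟩ := hG.analytic _ half_mem_strip
  -- Multiplication by `m` is continuous, and the products with the partial sums are eventually
  -- constant.
  have hmul : ∀ (m g : α →ₘ[μ] ℂ) (k₀ : ℕ) (z : ℂ), (∀ᵐ x ∂μ, ‖m x‖ ≤ 1) → z ∈ closedStrip →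
      (∀ k, k₀ ≤ k → m * ∑ n ∈ Finset.range k, F n z = g) → m * G z = g := by
    intro m g k₀ z hm hz hk
    symm
    rw [← sub_eq_zero]
    refine hs.eq_zero _ (le_antisymm (ge_of_tendsto (hGt z hz) ?_) zero_le)
    filter_upwards [eventually_ge_atTop k₀] with k hk'
    rw [← hk k hk', ← mul_sub_L0]
    exact hs.mul_le hm _
  have hsupp : ∀ z, ∀ᵐ x ∂μ, ∀ n, x ∉ A n → F n z x = 0 := fun z =>
    ae_all_iff.2 fun n => (hF n).support z
  have hpiece : ∀ n z, z ∈ closedStrip → chi μ (hA n) * G z = F n z := by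
    intro n z hz
    refine hmul _ _ (n + 1) z (norm_chi_le_one _) hz fun k hk => ?_
    apply AEEqFun.ext
    filter_upwards [chi_mul_apply (hA n) (∑ n ∈ Finset.range k, F n z),
      coeFn_sum_L0 (Finset.range k) (fun n => F n z), hsupp z] with x h1 h2 h3
    rw [h1]
    by_cases hx : x ∈ A n
    · rw [Set.indicator_of_mem hx, h2]
      refine Finset.sum_eq_single n (fun j _ hj => h3 j fun hxj => ?_) fun hn => ?_
      · exact Set.disjoint_left.1 (hdisj hj) hxj hx
      · exact absurd (Finset.mem_range.2 hk) hn
    · rw [Set.indicator_of_notMem hx, h3 n hx]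
  set U : Set α := (⋃ n, A n)ᶜ with hU
  have hUm : MeasurableSet U := (MeasurableSet.iUnion hA).compl
  have hrest : ∀ z, z ∈ closedStrip → chi μ hUm * G z = 0 := by
    intro z hz
    refine hmul _ _ 0 z (norm_chi_le_one _) hz fun k _ => eq_zero_iff_ae.2 ?_
    filter_upwards [chi_mul_apply hUm (∑ n ∈ Finset.range k, F n z),
      coeFn_sum_L0 (Finset.range k) (fun n => F n z), hsupp z] with x h1 h2 h3
    rw [h1]
    by_cases hx : x ∈ U
    · rw [Set.indicator_of_mem hx, h2]
      exact Finset.sum_eq_zero fun n _ => h3 n fun hxn => hx (Set.mem_iUnion.2 ⟨n, hxn⟩)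
    · rw [Set.indicator_of_notMem hx]
  have hEn : ∀ n, chi μ (hA n) * E = D n := fun n =>
    MemCalderon.deriv_eq_of_mul_eq hs half_mem_strip hE (hF n).deriv (norm_chi_le_one _)
      fun w hw => hpiece n w (strip_subset_closedStrip hw)
  have hE0 : chi μ hUm * E = 0 := by
    refine MemCalderon.deriv_eq_of_mul_eq hs half_mem_strip (F := fun _ => 0) hE ?_
      (norm_chi_le_one _) fun w hw => hrest w (strip_subset_closedStrip hw)
    refine ⟨by rw [hs.map_zero]; exact ENNReal.zero_lt_top, ?_⟩
    simp only [sub_self]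
    refine tendsto_const_nhds.congr fun w => ?_
    rw [show (w - ((1 / 2 : ℝ) : ℂ))⁻¹ • (0 : α →ₘ[μ] ℂ) = 0 from
      smul_zero (M := ℂ) (A := α →ₘ[μ] ℂ) _, sub_zero, hs.map_zero]
  have hhalf := strip_subset_closedStrip half_mem_strip
  refine ⟨G, E, ⟨hG, hGc.trans hle, fun z => Eventually.of_forall fun x hx => absurd trivial hx,
    ?_, hE⟩, ?_, ?_⟩
  · filter_upwards [ae_all_iff.2 fun n => chi_mul_apply (hA n) (G (1 / 2 : ℝ)),
      chi_mul_apply hUm (G (1 / 2 : ℝ)), hf, ae_all_iff.2 fun n => (hF n).value,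
      eq_zero_iff_ae.1 (hrest _ hhalf)] with x h1 h2 h3 h4 h5 _
    by_cases hx : x ∈ ⋃ n, A n
    · obtain ⟨n, hn⟩ := Set.mem_iUnion.1 hx
      have := h1 n
      rw [hpiece n _ hhalf, Set.indicator_of_mem hn, h4 n hn] at this
      exact this.symm
    · rw [h5, Set.indicator_of_mem hx] at h2
      rw [h3 hx, h2]
  · filter_upwards [ae_all_iff.2 fun n => chi_mul_apply (hA n) E] with x h1 n hn
    have := h1 n
    rw [hEn n, Set.indicator_of_mem hn] at this
    exact this.symm
  · filter_upwards [chi_mul_apply hUm E, eq_zero_iff_ae.1 hE0] with x h1 h2 hx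
    rw [h2, Set.indicator_of_mem hx] at h1
    exact h1.symm

/-! ### The explicit functions for the two pairs on a set where the data are bounded. -/

theorem piece_expL {A : Set α} {ω : α → ℂ} {p q : α → ℝ} {M : ℝ} (hd : ExpData A ω p q M)
    {N₀ N₁ : ExtNorm μ} (h₀ : IsKothe N₀) (h₁ : IsKothe N₁) (hA₀ : MemInd N₀ A)
    (hA₁ : MemInd N₁ A) {a b f : α →ₘ[μ] ℂ} (ha : ∀ᵐ x ∂μ, x ∈ A → Real.exp (p x) ≤ ‖a x‖)
    (hb : ∀ᵐ x ∂μ, x ∈ A → Real.exp (q x) ≤ ‖b x‖) {c : ℝ≥0∞} (hac : N₀ a ≤ c) (hbc : N₁ b ≤ c)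
    (hf : ∀ x ∈ A, ω x * (Real.exp ((p x + q x) / 2) : ℂ) = f x) :
    Piece N₀ N₁ f (3 * c) A (expL μ hd (1 / 2)) (expLDeriv μ hd (1 / 2) (1 / 2 : ℝ)) ∧
      ∀ᵐ x ∂μ, x ∈ A → expLDeriv μ hd (1 / 2) (1 / 2 : ℝ) x = f x * (q x - p x) := by
  have hval : ∀ᵐ x ∂μ, x ∈ A → expL μ hd (1 / 2) (1 / 2 : ℝ) x = f x := by
    filter_upwards [coeFn_expL_self (μ := μ) hd (1 / 2)] with x hx hxA
    rw [hx, Set.indicator_of_mem hxA, ← hf x hxA]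
    congr 4
    ring
  refine ⟨⟨memCalderon_expL hd h₀ h₁ hA₀ hA₁ (by norm_num) (by norm_num),
    calderonNorm_expL_le hd h₀.isSolid h₁.isSolid (by norm_num) (by norm_num) ha hb hac hbc,
    fun z => ?_, hval, ?_⟩, ?_⟩
  · filter_upwards [coeFn_expL (μ := μ) hd (1 / 2) z] with x hx hxA
    rw [hx, expFun, Set.indicator_of_notMem hxA]
  · exact hasDerivIn_expL hd (sumNorm_isSolid h₀ h₁)
      (hA₀.mono (sumNorm_le_left h₁.map_zero)) _ _
  · filter_upwards [hval, coeFn_expL (μ := μ) hd (1 / 2) (1 / 2 : ℝ),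
      coeFn_expLDeriv (μ := μ) hd (1 / 2) (1 / 2 : ℝ)] with x h1 h2 h3 hxA
    rw [h3, ← h2, h1 hxA, sub_self, mul_zero, add_zero]

theorem IsSolid.memInd_of_le {N : ExtNorm μ} (h : IsSolid N) {A : Set α} (hA : MeasurableSet A)
    {a : α →ₘ[μ] ℂ} (ha : N a < ∞) {c : ℝ} (hc : 0 < c) (H : ∀ x ∈ A, c ≤ ‖a x‖) :
    MemInd N A := by
  refine ⟨hA, (h.mono_smul (g := a) c⁻¹.toNNReal ?_).trans_lt
    (ENNReal.mul_lt_top ENNReal.coe_lt_top ha)⟩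
  filter_upwards [coeFn_chi (μ := μ) hA] with x hx
  rw [hx, Real.coe_toNNReal _ (by positivity)]
  by_cases hxA : x ∈ A
  · rw [Set.indicator_of_mem hxA, Pi.one_apply, norm_one, ← mul_inv_cancel₀ hc.ne', mul_comm]
    exact mul_le_mul_of_nonneg_left (H x hxA) (by positivity)
  · rw [Set.indicator_of_notMem hxA, norm_zero]
    positivity

theorem exists_L0_norm_eq {w : α → ℝ} (hw : Measurable w) (h0 : ∀ x, 0 ≤ w x) :
    ∃ g : α →ₘ[μ] ℂ, ∀ᵐ x ∂μ, ‖g x‖ = w x := by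
  have hm : Measurable fun x => (w x : ℂ) := by fun_prop
  refine ⟨AEEqFun.mk _ hm.aestronglyMeasurable, ?_⟩
  filter_upwards [AEEqFun.coeFn_mk (μ := μ) _ hm.aestronglyMeasurable] with x hx
  rw [hx, Complex.norm_real, Real.norm_of_nonneg (h0 x)]

theorem normLp_two_chi_mul_le {B : Set α} (hB : MeasurableSet B) {f : α →ₘ[μ] ℂ} {c : ℝ≥0∞}
    (h : ∫⁻ x in B, ‖f x‖ₑ ^ 2 ∂μ ≤ c ^ 2) : normLp μ 2 (chi μ hB * f) ≤ c := by
  rw [normLp_two_le_iff]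
  refine le_trans (le_of_eq ?_) h
  rw [← lintegral_indicator hB]
  refine lintegral_congr_ae ?_
  filter_upwards [chi_mul_apply hB f] with x hx
  rw [hx]
  by_cases hxB : x ∈ B <;> simp [hxB]

/-- The central computation. With exponents `p, q` for the first pair and `p', q'` for the second,
the derivatives at `1/2` are `f (q - p)` and `f (q' - p')`, and `q' - p' = (1 - θ) (q - p) + 2θ log
(|f| / r)`. -/
theorem IsScaling.exists_pieces {N Y : ExtNorm μ} {θ : ℝ} {C : ℝ≥0} (hY : IsScaling N Y θ C)
    (h : IsKothe N) (hdN : IsKothe (dual N)) (hdY : IsKothe (dual Y)) (t0 : 0 < θ) (t1 : θ < 1)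
    {f a b : α →ₘ[μ] ℂ} {A B : Set α} (hA : MeasurableSet A) (hB : MeasurableSet B) (hAB : A ⊆ B)
    {r L : ℝ} (hr : 0 < r) (hL : 0 < L) (ha : N a ≤ ENNReal.ofReal r)
    (hb : dual N b ≤ ENNReal.ofReal r) (hf : ∫⁻ x in B, ‖f x‖ₑ ^ 2 ∂μ ≤ ENNReal.ofReal r ^ 2)
    (hab : ∀ᵐ x ∂μ, x ∈ B → ‖f x‖ ≤ ‖a x‖ ^ (1 - (1 / 2 : ℝ)) * ‖b x‖ ^ (1 / 2 : ℝ))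
    (haL : ∀ x ∈ A, L⁻¹ ≤ ‖a x‖) (hbL : ∀ x ∈ A, L⁻¹ ≤ ‖b x‖ ∧ ‖b x‖ ≤ L)
    (hfL : ∀ x ∈ A, L⁻¹ ≤ ‖f x‖ ∧ ‖f x‖ ≤ L) :
    ∃ F D G E, Piece N (dual N) f (3 * ENNReal.ofReal r) A F D ∧
      Piece Y (dual Y) f (3 * (C * ENNReal.ofReal r)) A G E ∧
      ∀ᵐ x ∂μ, x ∈ A → E x = ((1 - θ : ℝ) : ℂ) * D x
        + ((2 * θ : ℝ) : ℂ) * (f x * (Real.log (‖f x‖ / r) : ℂ)) := by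
  have hAN : MemInd N A := h.isSolid.memInd_of_le hA (ha.trans_lt ENNReal.ofReal_lt_top)
    (inv_pos.2 hL) haL
  have hAN' : MemInd (dual N) A := hdN.isSolid.memInd_of_le hA
    (hb.trans_lt ENNReal.ofReal_lt_top) (inv_pos.2 hL) fun x hx => (hbL x hx).1
  have hb0 : ∀ x ∈ A, 0 < ‖b x‖ := fun x hx => (inv_pos.2 hL).trans_le (hbL x hx).1
  have hf0 : ∀ x ∈ A, 0 < ‖f x‖ := fun x hx => (inv_pos.2 hL).trans_le (hfL x hx).1
  set m : ℝ := |Real.log L| with hm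
  have hm0 : 0 ≤ m := abs_nonneg _
  have hlog : ∀ y : ℝ, L⁻¹ ≤ y → y ≤ L → |Real.log y| ≤ m := by
    intro y h1 h2
    have hy : 0 < y := (inv_pos.2 hL).trans_le h1
    have h3 := Real.log_le_log (inv_pos.2 hL) h1
    rw [Real.log_inv] at h3
    exact abs_le.2 ⟨by linarith [le_abs_self (Real.log L)],
      (Real.log_le_log hy h2).trans (le_abs_self _)⟩
  set ω : α → ℂ := fun x => f x / (‖f x‖ : ℂ) with hω
  set l : α → ℝ := A.indicator fun x => Real.log ‖f x‖ with hl
  set q : α → ℝ := A.indicator fun x => Real.log ‖b x‖ with hq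
  -- The factor `a` is replaced on `A` by `|f|² / |b|`, which is at most `|a|`. The value at `1/2`
  -- is then exactly `f`, and no upper bound for `a` is needed.
  set p : α → ℝ := fun x => 2 * l x - q x with hp
  have hfm := f.measurable
  have hbm := b.measurable
  have hωm : Measurable ω := by fun_prop
  have hω1 : ∀ x, ‖ω x‖ ≤ 1 := fun x => by
    rw [hω, norm_div, Complex.norm_real, norm_norm]
    exact div_self_le_one _
  have hlm : Measurable l := Measurable.indicator (by fun_prop) hA
  have hqm : Measurable q := Measurable.indicator (by fun_prop) hA
  have hpm : Measurable p := by fun_prop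
  have hlM : ∀ x, |l x| ≤ m := by
    intro x
    by_cases hx : x ∈ A
    · rw [hl, Set.indicator_of_mem hx]
      exact hlog _ (hfL x hx).1 (hfL x hx).2
    · rw [hl, Set.indicator_of_notMem hx, abs_zero]; exact hm0
  have hqM : ∀ x, |q x| ≤ m := by
    intro x
    by_cases hx : x ∈ A
    · rw [hq, Set.indicator_of_mem hx]
      exact hlog _ (hbL x hx).1 (hbL x hx).2
    · rw [hq, Set.indicator_of_notMem hx, abs_zero]; exact hm0
  have hpM : ∀ x, |p x| ≤ 3 * m := by
    intro x
    have h1 := abs_le.1 (hlM x)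
    have h2 := abs_le.1 (hqM x)
    exact abs_le.2 ⟨by simp only [hp]; linarith, by simp only [hp]; linarith⟩
  have hωf : ∀ x ∈ A, ω x * (Real.exp (l x) : ℂ) = f x := by
    intro x hx
    have := hf0 x hx
    rw [hl, Set.indicator_of_mem hx, Real.exp_log this, hω]
    exact div_mul_cancel₀ _ (by exact_mod_cast this.ne')
  have hpa : ∀ᵐ x ∂μ, x ∈ A → Real.exp (p x) ≤ ‖a x‖ := by
    filter_upwards [hab] with x hx hxA
    have h1 := hb0 x hxA
    have h2 := hx (hAB hxA)
    simp only [hp, hl, hq, Set.indicator_of_mem hxA]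
    rw [Real.exp_sub, Real.exp_log h1, two_mul, Real.exp_add, Real.exp_log (hf0 x hxA),
      div_le_iff₀ h1]
    refine (mul_le_mul h2 h2 (norm_nonneg _) ((norm_nonneg _).trans h2)).trans_eq ?_
    rw [mul_mul_mul_comm, ← Real.rpow_add' (norm_nonneg _) (by norm_num),
      ← Real.rpow_add' (norm_nonneg _) (by norm_num)]
    norm_num
  have hqb : ∀ x ∈ A, Real.exp (q x) = ‖b x‖ := by
    intro x hx
    rw [hq, Set.indicator_of_mem hx, Real.exp_log (hb0 x hx)]
  have hdX : ExpData A ω p q (3 * m) := ⟨hA, hωm, hpm, hqm, hω1, hpM,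
    fun x => (hqM x).trans (by linarith)⟩
  obtain ⟨hF, hD⟩ := piece_expL (μ := μ) hdX h hdN hAN hAN' hpa
    (Eventually.of_forall fun x hx => (hqb x hx).le) ha hb (f := f) (by
      intro x hx
      rw [← hωf x hx]
      congr 4
      simp only [hp]
      ring)
  -- The `θ`-parts `log r` and `2 log |f| - log r` add up to `2 log |f|`, so `p' + q' = p + q` and
  -- the value at `1/2` is unchanged.
  set p' : α → ℝ := fun x => (1 - θ) * p x + θ * Real.log r with hp'
  set q' : α → ℝ := fun x => (1 - θ) * q x + θ * (2 * l x - Real.log r) with hq'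
  have hp'm : Measurable p' := by fun_prop
  have hq'm : Measurable q' := by fun_prop
  have hdY' : ExpData A ω p' q' (5 * m + |Real.log r|) := by
    have s1 : 0 ≤ 1 - θ := by linarith
    have e1 : |Real.log r| * θ ≤ |Real.log r| := mul_le_of_le_one_right (abs_nonneg _) t1.le
    have e2 : (1 - θ) * m ≤ m := mul_le_of_le_one_left hm0 (by linarith)
    have e3 : θ * m ≤ m := mul_le_of_le_one_left hm0 t1.le
    refine ⟨hA, hωm, hp'm, hq'm, hω1, fun x => ?_, fun x => ?_⟩
    · refine (abs_add_le _ _).trans ?_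
      rw [abs_mul, abs_mul, abs_of_nonneg s1, abs_of_nonneg t0.le]
      have := mul_le_mul_of_nonneg_left (hpM x) s1
      linarith
    · refine (abs_add_le _ _).trans ?_
      rw [abs_mul, abs_mul, abs_of_nonneg s1, abs_of_nonneg t0.le]
      have h1 := mul_le_mul_of_nonneg_left (hqM x) s1
      have h2 : |2 * l x - Real.log r| ≤ 2 * m + |Real.log r| := by
        refine (abs_sub _ _).trans ?_
        rw [abs_mul, abs_two]
        linarith [hlM x]
      have h3 := mul_le_mul_of_nonneg_left h2 t0.le
      linarith
  obtain ⟨a', ha'⟩ := exists_L0_norm_eq (μ := μ) (w := A.indicator fun x => Real.exp (p' x))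
    ((by fun_prop : Measurable fun x => Real.exp (p' x)).indicator hA)
    (Set.indicator_nonneg fun _ _ => Real.exp_nonneg _)
  obtain ⟨b', hb'⟩ := exists_L0_norm_eq (μ := μ) (w := A.indicator fun x => Real.exp (q' x))
    ((by fun_prop : Measurable fun x => Real.exp (q' x)).indicator hA)
    (Set.indicator_nonneg fun _ _ => Real.exp_nonneg _)
  have ha'N : Y a' ≤ C * ENNReal.ofReal r :=
    hY.le_of_exp hAN hpm hpM hr ha hpa (ha'.mono fun x hx => hx.le)
  have hb'N : dual Y b' ≤ C * ENNReal.ofReal r := by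
    -- On `A`, `exp q' = r^{-θ} |b|^{1-θ} |f|^{2θ}`; the powers of `r` add up to `-θ + (1 - θ) + 2θ
    -- = 1`.
    refine (hY.dual_le h.isSolid t0 t1 (b := b) (f := chi μ hB * f) (r ^ (-θ)).toNNReal ?_).trans ?_
    · filter_upwards [hb', chi_mul_apply hB f] with x h1 h2
      rw [h1, h2, Real.coe_toNNReal _ (by positivity)]
      by_cases hx : x ∈ A
      · rw [Set.indicator_of_mem hx, Set.indicator_of_mem (hAB hx)]
        refine le_of_eq ?_
        simp only [hq', hq, hl, Set.indicator_of_mem hx]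
        rw [Real.rpow_def_of_pos hr, Real.rpow_def_of_pos (hb0 x hx),
          Real.rpow_def_of_pos (hf0 x hx), ← Real.exp_add, ← Real.exp_add]
        congr 1
        ring
      · rw [Set.indicator_of_notMem hx]
        positivity
    · have hr0 : ENNReal.ofReal r ≠ 0 := (ENNReal.ofReal_pos.2 hr).ne'
      calc C * (r ^ (-θ)).toNNReal * (dual N b ^ (1 - θ) * normLp μ 2 (chi μ hB * f) ^ (2 * θ))
          ≤ C * (r ^ (-θ)).toNNReal *
            (ENNReal.ofReal r ^ (1 - θ) * ENNReal.ofReal r ^ (2 * θ)) := by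
            have := normLp_two_chi_mul_le hB hf
            have : 0 ≤ 1 - θ := by linarith
            gcongr
        _ = C * ENNReal.ofReal r := by
            rw [← ENNReal.ofReal, ← ENNReal.ofReal_rpow_of_pos hr,
              ← ENNReal.rpow_add _ _ hr0 ENNReal.ofReal_ne_top, mul_assoc,
              ← ENNReal.rpow_add _ _ hr0 ENNReal.ofReal_ne_top,
              show -θ + (1 - θ + 2 * θ) = 1 by ring, ENNReal.rpow_one]
  obtain ⟨hG, hE⟩ := piece_expL (μ := μ) hdY' hY.isKothe hdY (hY.memInd t0 hAN)
    (hY.memInd_dual h.isSolid t0 t1 hAN hAN') (a := a') (b := b')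
    (ha'.mono fun x hx hxA => by rw [hx, Set.indicator_of_mem hxA])
    (hb'.mono fun x hx hxA => by rw [hx, Set.indicator_of_mem hxA]) ha'N hb'N (f := f) (by
      intro x hx
      rw [← hωf x hx]
      congr 4
      simp only [hp', hq', hp]
      ring)
  refine ⟨_, _, _, _, hF, hG, ?_⟩
  filter_upwards [hD, hE] with x h1 h2 hx
  rw [h1 hx, h2 hx, Real.log_div (hf0 x hx).ne' hr.ne']
  have hlx : l x = Real.log ‖f x‖ := by rw [hl, Set.indicator_of_mem hx]
  rw [← hlx]
  simp only [hp', hq', hp]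
  push_cast
  ring

/-- Where `f ≠ 0` the factorization forces `a` and `b` to be nonzero, so almost every such point of
`B` lies in the bounded sets for all large `n`. Dominated convergence makes the remaining mass
small. -/
theorem exists_subset_bounded {f a b : α →ₘ[μ] ℂ} {B : Set α} (hB : MeasurableSet B)
    (hf : ∫⁻ x in B, ‖f x‖ₑ ^ 2 ∂μ ≠ ∞)
    (hab : ∀ᵐ x ∂μ, x ∈ B → ‖f x‖ ≤ ‖a x‖ ^ (1 - (1 / 2 : ℝ)) * ‖b x‖ ^ (1 / 2 : ℝ))
    {ε : ℝ≥0∞} (hε : 0 < ε) :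
    ∃ A ⊆ B, MeasurableSet A ∧ ∃ L : ℝ, 0 < L ∧ (∀ x ∈ A, L⁻¹ ≤ ‖a x‖) ∧
      (∀ x ∈ A, L⁻¹ ≤ ‖b x‖ ∧ ‖b x‖ ≤ L) ∧ (∀ x ∈ A, L⁻¹ ≤ ‖f x‖ ∧ ‖f x‖ ≤ L) ∧
      ∫⁻ x in B \ A, ‖f x‖ₑ ^ 2 ∂μ ≤ ε := by
  have hfm := f.measurable.norm
  have ham := a.measurable.norm
  have hbm := b.measurable.norm
  set S : ℕ → Set α := fun n => {x | ((n : ℝ) + 1)⁻¹ ≤ ‖a x‖} ∩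
    ({x | ((n : ℝ) + 1)⁻¹ ≤ ‖b x‖} ∩ {x | ‖b x‖ ≤ (n : ℝ) + 1}) ∩
    ({x | ((n : ℝ) + 1)⁻¹ ≤ ‖f x‖} ∩ {x | ‖f x‖ ≤ (n : ℝ) + 1}) with hS
  have hSm : ∀ n, MeasurableSet (S n) := fun n =>
    ((measurableSet_le measurable_const ham).inter
      ((measurableSet_le measurable_const hbm).inter (measurableSet_le hbm measurable_const))).inter
      ((measurableSet_le measurable_const hfm).inter (measurableSet_le hfm measurable_const))
  have hSev : ∀ x, 0 < ‖a x‖ → 0 < ‖b x‖ → 0 < ‖f x‖ → ∀ᶠ n in atTop, x ∈ S n := by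
    intro x h1 h2 h3
    have lim0 : Tendsto (fun n : ℕ => ((n : ℝ) + 1)⁻¹) atTop (𝓝 0) := by
      simpa [one_div] using tendsto_one_div_add_atTop_nhds_zero_nat (𝕜 := ℝ)
    have limT : Tendsto (fun n : ℕ => (n : ℝ) + 1) atTop atTop :=
      tendsto_atTop_add_const_right _ _ tendsto_natCast_atTop_atTop
    filter_upwards [lim0.eventually_le_const h1, lim0.eventually_le_const h2,
      lim0.eventually_le_const h3, limT.eventually_ge_atTop ‖b x‖,
      limT.eventually_ge_atTop ‖f x‖] with n e1 e2 e3 e4 e5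
    exact ⟨⟨e1, e2, e4⟩, e3, e5⟩
  have hlim : Tendsto (fun n => ∫⁻ x in B, (S n)ᶜ.indicator (fun x => ‖f x‖ₑ ^ 2) x ∂μ) atTop
      (𝓝 (∫⁻ _ in B, 0 ∂μ)) := by
    refine tendsto_lintegral_of_dominated_convergence' (fun x => ‖f x‖ₑ ^ 2) (fun n =>
      (((aemeasurable_enorm_L0 f).pow_const 2).indicator (hSm n).compl).restrict)
      (fun n => Eventually.of_forall fun x => Set.indicator_le_self _ _ _) hf ?_
    filter_upwards [ae_restrict_mem hB, ae_restrict_of_ae hab] with x hx h1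
    refine tendsto_const_nhds.congr' ?_
    by_cases hfx : f x = 0
    · refine Eventually.of_forall fun n => ?_
      by_cases hxS : x ∈ (S n)ᶜ <;> simp [hxS, hfx]
    · have hf0 := norm_pos_iff.2 hfx
      have h2 := hf0.trans_le (h1 hx)
      have ha0 : 0 < ‖a x‖ := by
        refine lt_of_le_of_ne (norm_nonneg _) fun h => ?_
        rw [← h, Real.zero_rpow (by norm_num), zero_mul] at h2
        exact lt_irrefl _ h2
      have hb0 : 0 < ‖b x‖ := by
        refine lt_of_le_of_ne (norm_nonneg _) fun h => ?_
        rw [← h, Real.zero_rpow (by norm_num : (1 / 2 : ℝ) ≠ 0), mul_zero] at h2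
        exact lt_irrefl _ h2
      filter_upwards [hSev x ha0 hb0 hf0] with n hn
      simp [hn]
  rw [lintegral_zero] at hlim
  obtain ⟨n, hn⟩ := (hlim.eventually_le_const hε).exists
  refine ⟨B ∩ S n, Set.inter_subset_left, hB.inter (hSm n), n + 1, by positivity,
    fun x hx => hx.2.1.1, fun x hx => hx.2.1.2, fun x hx => hx.2.2, ?_⟩
  rwa [Set.sdiff_self_inter, Set.sdiff_eq, Set.inter_comm, ← setLIntegral_indicator (hSm n).compl]

theorem exists_seq_of_forall {β : Type*} {Q : ℕ → β → Prop} {R : ℕ → β → β → Prop} {b : β}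
    (h0 : Q 0 b) (H : ∀ n x, Q n x → ∃ y, Q (n + 1) y ∧ R n x y) :
    ∃ u : ℕ → β, u 0 = b ∧ ∀ n, Q n (u n) ∧ R n (u n) (u (n + 1)) := by
  choose! g hg1 hg2 using H
  let u : ℕ → β := fun n => Nat.rec b (fun n x => g n x) n
  have hu : ∀ n, Q n (u n) := fun n => by
    induction n with
    | zero => exact h0
    | succ n ih => exact hg1 n _ ih
  exact ⟨u, rfl, fun n => ⟨hu n, hg2 n _ (hu n)⟩⟩

/-- Every function in `L₂` is the geometric mean of functions in `N` and in its dual. -/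
theorem exists_factorization [SigmaFinite μ] {N : ExtNorm μ} (h : IsKothe N)
    (hN : SameSpace (interp N (dual N) (1 / 2)) (normLp μ 2)) :
    ∃ K : ℝ, 1 ≤ K ∧ ∀ (f : α →ₘ[μ] ℂ) (t : ℝ), 0 < t → normLp μ 2 f ≤ ENNReal.ofReal t →
      ∃ a b, N a ≤ ENNReal.ofReal (K * t) ∧ dual N b ≤ ENNReal.ofReal (K * t) ∧
        ∀ᵐ x ∂μ, ‖f x‖ ≤ ‖a x‖ ^ (1 - (1 / 2 : ℝ)) * ‖b x‖ ^ (1 / 2 : ℝ) := by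
  have hA := ample_and_of_sameSpace h hN
  obtain ⟨K, hK⟩ := exists_calderon_bound h (dual_isKothe h.isSolid (hA.mono fun _ hE => hE.1))
    (ample_dual_dual h.isSolid hA) (s := 1 / 2) (by norm_num) (by norm_num)
  obtain ⟨C, -, hC⟩ := hN
  refine ⟨max 1 (K * (C + 1)), le_max_left _ _, fun f t ht hf => ?_⟩
  -- The constant `C + 1` makes the inequality strict, so that some function of Calderón's space
  -- realises it.
  have hlt : interp N (dual N) (1 / 2) f < ((C + 1 : ℝ≥0) : ℝ≥0∞) * ENNReal.ofReal t := by
    refine ((hC f).1.trans (mul_le_mul_right hf _)).trans_lt ?_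
    rw [ENNReal.mul_lt_mul_iff_left (ENNReal.ofReal_pos.2 ht).ne' ENNReal.ofReal_ne_top]
    exact_mod_cast lt_add_one C
  obtain ⟨F, hF, hFf, hFc⟩ := exists_of_interp_lt hlt
  obtain ⟨a, b, ha, hb, hv, -⟩ := hK F hF hFc.ne_top
  have hle : K * calderonNorm N (dual N) F ≤ ENNReal.ofReal (max 1 (K * (C + 1)) * t) := by
    refine (mul_le_mul_right hFc.le _).trans ?_
    rw [ENNReal.ofReal_mul (by positivity), ← mul_assoc]
    gcongr
    rw [← ENNReal.coe_mul, ← ENNReal.ofReal_coe_nnreal]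
    refine ENNReal.ofReal_le_ofReal ?_
    push_cast
    exact le_max_right _ _
  refine ⟨a, b, ha.trans hle, hb.trans hle, ?_⟩
  rwa [hFf] at hv

/-- Data for the pairs `(N, N^*)` and `(Y, Y^*)` at a function `f` of `L₂`-norm `t`. -/
theorem IsScaling.exists_pieces_seq [SigmaFinite μ] {N Y : ExtNorm μ} {θ : ℝ} {C : ℝ≥0}
    (hY : IsScaling N Y θ C) (h : IsKothe N) (hdN : IsKothe (dual N)) (hdY : IsKothe (dual Y))
    (t0 : 0 < θ) (t1 : θ < 1) {K : ℝ} (hK1 : 1 ≤ K)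
    (hK : ∀ (f : α →ₘ[μ] ℂ) (t : ℝ), 0 < t → normLp μ 2 f ≤ ENNReal.ofReal t →
      ∃ a b, N a ≤ ENNReal.ofReal (K * t) ∧ dual N b ≤ ENNReal.ofReal (K * t) ∧
        ∀ᵐ x ∂μ, ‖f x‖ ≤ ‖a x‖ ^ (1 - (1 / 2 : ℝ)) * ‖b x‖ ^ (1 / 2 : ℝ))
    {f : α →ₘ[μ] ℂ} {t : ℝ} (ht : 0 < t) (hf : normLp μ 2 f ≤ ENNReal.ofReal t) :
    ∃ B : ℕ → Set α, B 0 = Set.univ ∧ ∀ n, (MeasurableSet (B n) ∧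
      ∫⁻ x in B n, ‖f x‖ₑ ^ 2 ∂μ ≤ ENNReal.ofReal (t / 2 ^ n) ^ 2) ∧ B (n + 1) ⊆ B n ∧
      ∃ F D G E, Piece N (dual N) f (3 * ENNReal.ofReal (K * (t / 2 ^ n))) (B n \ B (n + 1)) F D ∧
        Piece Y (dual Y) f (3 * (C * ENNReal.ofReal (K * (t / 2 ^ n)))) (B n \ B (n + 1)) G E ∧
        ∀ᵐ x ∂μ, x ∈ B n \ B (n + 1) → E x = ((1 - θ : ℝ) : ℂ) * D x
          + ((2 * θ : ℝ) : ℂ) * (f x * (Real.log (‖f x‖ / (K * (t / 2 ^ n))) : ℂ)) := by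
  refine exists_seq_of_forall (Q := fun n B => MeasurableSet B ∧
    ∫⁻ x in B, ‖f x‖ₑ ^ 2 ∂μ ≤ ENNReal.ofReal (t / 2 ^ n) ^ 2) (R := fun n B B' => B' ⊆ B ∧
      ∃ F D G E, Piece N (dual N) f (3 * ENNReal.ofReal (K * (t / 2 ^ n))) (B \ B') F D ∧
        Piece Y (dual Y) f (3 * (C * ENNReal.ofReal (K * (t / 2 ^ n)))) (B \ B') G E ∧
        ∀ᵐ x ∂μ, x ∈ B \ B' → E x = ((1 - θ : ℝ) : ℂ) * D x
          + ((2 * θ : ℝ) : ℂ) * (f x * (Real.log (‖f x‖ / (K * (t / 2 ^ n))) : ℂ)))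
    ⟨MeasurableSet.univ, ?_⟩ ?_
  · rw [setLIntegral_univ, ← normLp_two_le_iff]
    simpa using hf
  · rintro n B ⟨hB, hfB⟩
    have htn : 0 < t / 2 ^ n := by positivity
    -- The remainder is factored afresh at each stage, so the norms of its factors decrease with its
    -- `L₂`-norm.
    obtain ⟨a, b, ha, hb, hab⟩ := hK (chi μ hB * f) _ htn (normLp_two_chi_mul_le hB hfB)
    have hab' : ∀ᵐ x ∂μ, x ∈ B → ‖f x‖ ≤ ‖a x‖ ^ (1 - (1 / 2 : ℝ)) * ‖b x‖ ^ (1 / 2 : ℝ) := by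
      filter_upwards [hab, chi_mul_apply hB f] with x h1 h2 hx
      rwa [h2, Set.indicator_of_mem hx] at h1
    obtain ⟨A, hAB, hA, L, hL, haL, hbL, hfL, hrest⟩ := exists_subset_bounded hB
      (ne_top_of_le_ne_top (ENNReal.pow_ne_top ENNReal.ofReal_ne_top) hfB) hab'
      (ε := ENNReal.ofReal (t / 2 ^ (n + 1)) ^ 2)
      (ENNReal.pow_pos (ENNReal.ofReal_pos.2 (by positivity)) 2)
    refine ⟨B \ A, ⟨hB.diff hA, hrest⟩, Set.sdiff_subset, ?_⟩
    rw [Set.sdiff_sdiff_cancel_left hAB]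
    refine hY.exists_pieces h hdN hdY t0 t1 hA hB hAB (by positivity) hL ha hb
      (hfB.trans ?_) hab' haL hbL hfL
    gcongr
    exact le_mul_of_one_le_left htn.le hK1

/-! ### The Kalton–Peck term, and the comparison of derivatives for the two pairs. -/

theorem coeFn_kaltonPeck (p : ℝ) (f : α →ₘ[μ] ℂ) : ∀ᵐ x ∂μ, kaltonPeck p f x
    = (p : ℂ) * f x * (Real.log (‖f x‖ / (normLp μ (ENNReal.ofReal p) f).toReal) : ℂ) :=
  AEEqFun.coeFn_compMeasurable _ _ f

theorem tsum_ofReal_div_two_pow {x : ℝ} (hx : 0 ≤ x) :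
    ∑' n : ℕ, ENNReal.ofReal (x / 2 ^ n) = 2 * ENNReal.ofReal x := by
  have h1 := summable_geometric_two' (2 * x)
  have h2 := tsum_geometric_two' (2 * x)
  simp only [mul_div_cancel_left₀ x (two_ne_zero : (2 : ℝ) ≠ 0)] at h1 h2
  rw [← ENNReal.ofReal_tsum_of_nonneg (fun n => by positivity) h1, h2,
    ENNReal.ofReal_mul zero_le_two, ENNReal.ofReal_ofNat]

theorem tsum_ofReal_sq_ne_top (K : ℝ) :
    ∑' n : ℕ, ENNReal.ofReal ((2 * (n + K) / 2 ^ n) ^ 2) ≠ ∞ := by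
  have e : ∀ n : ℕ, (2 * (n + K) / 2 ^ n) ^ 2 = 4 * ((n : ℝ) ^ 2 * (1 / 4) ^ n)
      + (8 * K) * ((n : ℝ) ^ 1 * (1 / 4) ^ n) + (4 * K ^ 2) * (1 / 4) ^ n := by
    intro n
    rw [div_pow, ← pow_mul, mul_comm n 2, pow_mul, one_div, inv_pow]
    norm_num
    field_simp
    ring
  have hs : Summable fun n : ℕ => (2 * (n + K) / 2 ^ n) ^ 2 := by
    simp only [e]
    have hr : ‖(1 / 4 : ℝ)‖ < 1 := by norm_num
    exact (((summable_pow_mul_geometric_of_norm_lt_one 2 hr).mul_left 4).add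
      ((summable_pow_mul_geometric_of_norm_lt_one 1 hr).mul_left _)).add
      ((summable_geometric_of_norm_lt_one hr).mul_left _)
  exact hs.tsum_ofReal_ne_top

theorem abs_log_ratio_le {K t y : ℝ} (hK : 1 ≤ K) (ht : 0 < t) (hy : 0 < y) (n : ℕ) :
    |Real.log (y / (K * (t / 2 ^ n))) - Real.log (y / t)| ≤ n + K := by
  have hK0 : 0 < K := by linarith
  have e : Real.log (y / (K * (t / 2 ^ n))) - Real.log (y / t)
      = n * Real.log 2 - Real.log K := by
    rw [Real.log_div hy.ne' (by positivity), Real.log_div hy.ne' ht.ne',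
      Real.log_mul hK0.ne' (by positivity), Real.log_div ht.ne' (by positivity), Real.log_pow]
    ring
  rw [e]
  have h1 : Real.log 2 ≤ 1 := by linarith [Real.log_two_lt_d9]
  have h2 : 0 ≤ Real.log 2 := Real.log_nonneg (by norm_num)
  have h3 : 0 ≤ Real.log K := Real.log_nonneg hK
  have h4 : Real.log K ≤ K := Real.log_le_self hK0.le
  have h5 : (n : ℝ) * Real.log 2 ≤ n := mul_le_of_le_one_right (Nat.cast_nonneg n) h1
  have h6 : 0 ≤ (n : ℝ) * Real.log 2 := by positivity
  have h7 : (0 : ℝ) ≤ n := Nat.cast_nonneg n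
  exact abs_le.2 ⟨by linarith, by linarith⟩

/-- On the `n`-th set the logarithm is relative to `K t / 2^n` instead of `t = ‖f‖₂`, which changes
it by at most `n + K`. The mass of `|f|²` there is at most `(t / 2^n)²`, and `∑ (n + K)² / 4^n`
converges. -/
theorem IsScaling.exists_link [SigmaFinite μ] {N Y : ExtNorm μ} {θ : ℝ} {C : ℝ≥0}
    (hY : IsScaling N Y θ C) (h : IsKothe N) (hdN : IsKothe (dual N)) (hdY : IsKothe (dual Y))
    (t0 : 0 < θ) (t1 : θ < 1) (hN : SameSpace (interp N (dual N) (1 / 2)) (normLp μ 2)) :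
    ∃ K : ℝ≥0, ∀ f, f ≠ 0 → normLp μ 2 f ≠ ∞ → ∃ F D G E,
      Piece N (dual N) f (K * normLp μ 2 f) Set.univ F D ∧
      Piece Y (dual Y) f (K * normLp μ 2 f) Set.univ G E ∧
      normLp μ 2 (E - (((1 - θ : ℝ) : ℂ) • D + (θ : ℂ) • kaltonPeck 2 f)) ≤ K * normLp μ 2 f := by
  obtain ⟨K, hK1, hK⟩ := exists_factorization h hN
  have hK0 : 0 ≤ K := zero_le_one.trans hK1
  set S := ∑' n : ℕ, ENNReal.ofReal ((2 * (n + K) / 2 ^ n) ^ 2) with hS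
  have hStop : S ≠ ∞ := tsum_ofReal_sq_ne_top K
  -- Each `6` is `3` from the exponential functions times `2` from the geometric series. The maximum
  -- with `1` turns `S ≤ K'` into `S ≤ K'²`, as needed for a norm bound.
  set K' : ℝ≥0 := 6 * K.toNNReal + 6 * (C * K.toNNReal) + max 1 S.toNNReal with hK'
  refine ⟨K', fun f hf0 hf => ?_⟩
  set t := (normLp μ 2 f).toReal with ht
  have hft : normLp μ 2 f = ENNReal.ofReal t := (ENNReal.ofReal_toReal hf).symm
  have htpos : 0 < t := ENNReal.toReal_pos
    (fun h0 => hf0 ((normLp_isSolid 2 one_le_two).eq_zero f h0)) hf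
  obtain ⟨B, hB0, hB⟩ := hY.exists_pieces_seq h hdN hdY t0 t1 hK1 hK htpos hft.le
  set A : ℕ → Set α := fun n => B n \ B (n + 1) with hA
  have hBm : ∀ n, MeasurableSet (B n) := fun n => (hB n).1.1
  have hBf : ∀ n, ∫⁻ x in B n, ‖f x‖ₑ ^ 2 ∂μ ≤ ENNReal.ofReal (t / 2 ^ n) ^ 2 :=
    fun n => (hB n).1.2
  have hBanti : Antitone B := antitone_nat_of_succ_le fun n => (hB n).2.1
  have hAm : ∀ n, MeasurableSet (A n) := fun n => (hBm n).diff (hBm (n + 1))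
  have hdisj : Pairwise (Function.onFun Disjoint A) := by
    refine (pairwise_disjoint_on A).2 fun m n hmn => Set.disjoint_left.2 fun x hx hx' => ?_
    exact hx.2 (hBanti (Nat.succ_le_of_lt hmn) hx'.1)
  have hnot : ∀ x, x ∉ ⋃ n, A n → ∀ n, x ∈ B n := by
    intro x hx n
    induction n with
    | zero => rw [hB0]; trivial
    | succ n ih =>
      by_contra hxn
      exact hx (Set.mem_iUnion.2 ⟨n, ih, hxn⟩)
  have hfzero : ∀ᵐ x ∂μ, x ∉ ⋃ n, A n → f x = 0 := by
    set I : Set α := (⋃ n, A n)ᶜ with hI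
    have hIm : MeasurableSet I := (MeasurableSet.iUnion hAm).compl
    have h1 : ∫⁻ x in I, ‖f x‖ₑ ^ 2 ∂μ ≤ 0 := by
      have hlim : Tendsto (fun n : ℕ => ENNReal.ofReal (t / 2 ^ n) ^ 2) atTop (𝓝 0) := by
        have h2 : Tendsto (fun n : ℕ => t / 2 ^ n) atTop (𝓝 0) :=
          (summable_geometric_two' (2 * t)).tendsto_atTop_zero.congr fun n => by ring
        simpa using ENNReal.Tendsto.pow (n := 2) (ENNReal.tendsto_ofReal h2)
      refine ge_of_tendsto' hlim fun n => (lintegral_mono_set fun x hx => ?_).trans (hBf n)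
      exact hnot x hx n
    rw [nonpos_iff_eq_zero, lintegral_eq_zero_iff'
      ((aemeasurable_enorm_L0 f).pow_const 2).restrict] at h1
    filter_upwards [(ae_restrict_iff' hIm).1 h1] with x hx hxI
    simpa using hx hxI
  choose F D G E hF hG hE using fun n => (hB n).2.2
  have hsum : ∑' n : ℕ, ENNReal.ofReal (K * (t / 2 ^ n)) = 2 * (ENNReal.ofReal K * normLp μ 2 f) := by
    rw [hft, ← ENNReal.ofReal_mul hK0, ← tsum_ofReal_div_two_pow (by positivity)]
    simp only [mul_div_assoc]
  have hsum0 : ∑' n : ℕ, 3 * ENNReal.ofReal (K * (t / 2 ^ n)) ≤ K' * normLp μ 2 f := by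
    rw [ENNReal.tsum_mul_left, hsum]
    calc 3 * (2 * (ENNReal.ofReal K * normLp μ 2 f))
        = ((6 * K.toNNReal : ℝ≥0) : ℝ≥0∞) * normLp μ 2 f := by
          rw [ENNReal.ofReal]
          push_cast
          ring
      _ ≤ K' * normLp μ 2 f := by
          gcongr
          rw [hK', add_assoc]
          exact le_self_add
  have hsum1 : ∑' n : ℕ, 3 * (C * ENNReal.ofReal (K * (t / 2 ^ n))) ≤ K' * normLp μ 2 f := by
    rw [ENNReal.tsum_mul_left, ENNReal.tsum_mul_left, hsum]
    calc 3 * (C * (2 * (ENNReal.ofReal K * normLp μ 2 f)))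
        = ((6 * (C * K.toNNReal) : ℝ≥0) : ℝ≥0∞) * normLp μ 2 f := by
          rw [ENNReal.ofReal]
          push_cast
          ring
      _ ≤ K' * normLp μ 2 f := by
          gcongr
          rw [hK', add_assoc, add_left_comm]
          exact le_self_add
  have hfin : (K' : ℝ≥0∞) * normLp μ 2 f ≠ ∞ := ENNReal.mul_ne_top ENNReal.coe_ne_top hf
  obtain ⟨F', D', hF', hD', hD0⟩ := exists_piece_union h hdN hAm hdisj hF
    (ne_top_of_le_ne_top hfin hsum0) hfzero
  obtain ⟨G', E', hG', hE', hE0⟩ := exists_piece_union hY.isKothe hdY hAm hdisj hG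
    (ne_top_of_le_ne_top hfin hsum1) hfzero
  refine ⟨F', D', G', E', { hF' with norm_le := hF'.norm_le.trans hsum0 },
    { hG' with norm_le := hG'.norm_le.trans hsum1 }, ?_⟩
  set e := E' - (((1 - θ : ℝ) : ℂ) • D' + (θ : ℂ) • kaltonPeck 2 f) with he
  have hpt : ∀ᵐ x ∂μ, ‖e x‖ₑ ^ 2 ≤ ∑' n, (A n).indicator
      (fun x => ENNReal.ofReal (2 * (n + K)) ^ 2 * ‖f x‖ₑ ^ 2) x := by
    filter_upwards [AEEqFun.coeFn_sub E' (((1 - θ : ℝ) : ℂ) • D' + (θ : ℂ) • kaltonPeck 2 f),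
      AEEqFun.coeFn_add (((1 - θ : ℝ) : ℂ) • D') ((θ : ℂ) • kaltonPeck 2 f),
      AEEqFun.coeFn_smul ((1 - θ : ℝ) : ℂ) D', AEEqFun.coeFn_smul (θ : ℂ) (kaltonPeck 2 f),
      coeFn_kaltonPeck 2 f, ae_all_iff.2 hE, hD', hE', hD0, hE0, hfzero]
      with x h1 h2 h3 h4 h5 hE hD' hE' hD0 hE0 hf0
    rw [ENNReal.ofReal_ofNat, ← ht] at h5
    have hex : e x = E' x - (((1 - θ : ℝ) : ℂ) * D' x
        + (θ : ℂ) * ((2 : ℝ) * f x * (Real.log (‖f x‖ / t) : ℂ))) := by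
      rw [h1, Pi.sub_apply, h2, Pi.add_apply, h3, h4, Pi.smul_apply, Pi.smul_apply, h5,
        smul_eq_mul, smul_eq_mul]
    by_cases hx : x ∈ ⋃ n, A n
    · obtain ⟨n, hn⟩ := Set.mem_iUnion.1 hx
      refine le_trans ?_ (ENNReal.le_tsum n)
      rw [Set.indicator_of_mem hn, ← mul_pow]
      refine pow_le_pow_left' ?_ 2
      rw [← ofReal_norm, ← ofReal_norm, ← ENNReal.ofReal_mul (by positivity)]
      refine ENNReal.ofReal_le_ofReal ?_
      have hval : e x = ((2 * θ : ℝ) : ℂ) * f x *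
          ((Real.log (‖f x‖ / (K * (t / 2 ^ n))) - Real.log (‖f x‖ / t) : ℝ) : ℂ) := by
        rw [hex, hE' n hn, hD' n hn, hE n hn]
        push_cast
        ring
      by_cases hfx : f x = 0
      · rw [hval, hfx]; simp
      · rw [hval, norm_mul, norm_mul, Complex.norm_real, Complex.norm_real, Real.norm_eq_abs,
          Real.norm_eq_abs, abs_of_nonneg (by positivity)]
        have h6 := abs_log_ratio_le hK1 htpos (norm_pos_iff.2 hfx) n
        calc 2 * θ * ‖f x‖ * |Real.log (‖f x‖ / (K * (t / 2 ^ n))) - Real.log (‖f x‖ / t)|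
            ≤ 2 * 1 * ‖f x‖ * (n + K) := by gcongr
          _ = 2 * (n + K) * ‖f x‖ := by ring
    · rw [hex, hE0 hx, hD0 hx, hf0 hx]
      simp
  rw [normLp_two_le_iff]
  calc ∫⁻ x, ‖e x‖ₑ ^ 2 ∂μ
      ≤ ∫⁻ x, ∑' n, (A n).indicator
        (fun x => ENNReal.ofReal (2 * (n + K)) ^ 2 * ‖f x‖ₑ ^ 2) x ∂μ := lintegral_mono_ae hpt
    _ = ∑' n : ℕ, ENNReal.ofReal (2 * (n + K)) ^ 2 * ∫⁻ x in A n, ‖f x‖ₑ ^ 2 ∂μ := by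
        rw [lintegral_tsum fun n =>
          (((aemeasurable_enorm_L0 f).pow_const 2).const_mul _).indicator (hAm n)]
        refine tsum_congr fun n => ?_
        rw [lintegral_indicator (hAm n), lintegral_const_mul' _ _
          (ENNReal.pow_ne_top ENNReal.ofReal_ne_top)]
    _ ≤ ∑' n : ℕ, ENNReal.ofReal ((2 * (n + K) / 2 ^ n) ^ 2) * normLp μ 2 f ^ 2 := by
        refine ENNReal.tsum_le_tsum fun n => ?_
        refine (mul_le_mul_right ((lintegral_mono_set Set.sdiff_subset).trans (hBf n)) _).trans_eq ?_
        rw [hft, ← mul_pow, ← ENNReal.ofReal_mul (by positivity), ENNReal.ofReal_pow (by positivity),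
          ← mul_pow, ← ENNReal.ofReal_mul (by positivity)]
        congr 2
        ring
    _ = S * normLp μ 2 f ^ 2 := ENNReal.tsum_mul_right
    _ ≤ (K' * normLp μ 2 f) ^ 2 := by
        rw [mul_pow]
        gcongr
        rw [← ENNReal.coe_toNNReal hStop, ← ENNReal.coe_pow, ENNReal.coe_le_coe]
        have h1 : max 1 S.toNNReal ≤ K' := by rw [hK']; exact le_add_self
        have h2 : 1 ≤ K' := (le_max_left _ _).trans h1
        rw [sq]
        exact ((le_max_right _ _).trans h1).trans (le_mul_of_one_le_left' h2)

/-! ### Differentials: homogeneity, uniqueness up to bounded maps, and existence. -/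

section differential

variable {N₀ N₁ : ExtNorm μ} {Ω : (α →ₘ[μ] ℂ) → (α →ₘ[μ] ℂ)}

theorem IsDifferential.smul_eq (h₀ : IsKothe N₀) (h₁ : IsKothe N₁) {s : ℝ} (s0 : 0 < s)
    (s1 : s < 1) (hΩ : IsDifferential N₀ N₁ s Ω) (c : ℂ) {f : α →ₘ[μ] ℂ}
    (hf : interp N₀ N₁ s f < ∞) : Ω (c • f) = c • Ω f := by
  obtain ⟨B, K, hB1, hB2⟩ := hΩ
  have hs := sumNorm_isSolid h₀ h₁
  have hcf : interp N₀ N₁ s (c • f) < ∞ := by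
    rw [(interp_isSolid h₀ h₁ s0 s1).smul]
    exact ENNReal.mul_lt_top enorm_lt_top hf
  have h1 := (hB2 _ hcf).2.2.2
  rw [hB1 c f hf] at h1
  exact h1.unique hs ((hB2 f hf).2.2.2.const_smul hs c)

/-- For homogeneous `Ω` a bounded choice without any homogeneity suffices: choose on one
representative of each complex line and extend by scalars. -/
theorem isDifferential_of_smul_eq (h₀ : IsKothe N₀) (h₁ : IsKothe N₁) {s : ℝ} (s0 : 0 < s)
    (s1 : s < 1) (hΩ : ∀ (c : ℂ) f, interp N₀ N₁ s f < ∞ → Ω (c • f) = c • Ω f) {K : ℝ≥0}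
    (H : ∀ f, interp N₀ N₁ s f < ∞ → ∃ G, MemCalderon N₀ N₁ G ∧ G s = f ∧
      calderonNorm N₀ N₁ G ≤ K * interp N₀ N₁ s f ∧ HasDerivIn (sumNorm N₀ N₁) G s (Ω f)) :
    IsDifferential N₀ N₁ s Ω := by
  classical
  have hI := interp_isSolid h₀ h₁ s0 s1
  have hs := sumNorm_isSolid h₀ h₁
  let S : Setoid (α →ₘ[μ] ℂ) :=
    { r := fun f g => ∃ c : ℂ, c ≠ 0 ∧ g = c • f
      iseqv := ⟨fun f => ⟨1, one_ne_zero, (one_smul ℂ f).symm⟩,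
        fun {f g} ⟨c, hc, hg⟩ => ⟨c⁻¹, inv_ne_zero hc, by
          rw [hg]; exact (inv_smul_smul₀ hc f).symm⟩,
        fun {f g k} ⟨c, hc, hg⟩ ⟨d, hd, hk⟩ => ⟨d * c, mul_ne_zero hd hc, by
          rw [hk, hg]; exact smul_smul d c f⟩⟩ }
  let r : (α →ₘ[μ] ℂ) → (α →ₘ[μ] ℂ) := fun f => (Quotient.mk S f).out
  have hr : ∀ f, ∃ c : ℂ, c ≠ 0 ∧ f = c • r f := fun f =>
    Quotient.exact (Quotient.out_eq (Quotient.mk S f))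
  choose c hc0 hc using hr
  have hrfin : ∀ f, interp N₀ N₁ s f < ∞ → interp N₀ N₁ s (r f) < ∞ := by
    intro f hf
    rw [hc f, hI.smul] at hf
    exact ENNReal.lt_top_of_mul_ne_top_right hf.ne (by simpa using hc0 f)
  choose! G hG1 hG2 hG3 hG4 using H
  -- The zero function is set apart, since its scalar `c` is not determined.
  obtain ⟨B, hB0, hBne⟩ : ∃ B : (α →ₘ[μ] ℂ) → ℂ → (α →ₘ[μ] ℂ), B 0 = 0 ∧
      ∀ f, f ≠ 0 → B f = c f • G (r f) :=
    ⟨fun f => if f = 0 then 0 else c f • G (r f), if_pos rfl, fun f hf => if_neg hf⟩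
  refine ⟨B, K, fun a f hf => ?_, fun f hf => ?_⟩
  · by_cases ha : a = 0
    · subst ha
      rw [show (0 : ℂ) • f = 0 from zero_smul ℂ f, hB0]
      exact (zero_smul ℂ (B f)).symm
    by_cases hf0 : f = 0
    · subst hf0
      rw [show a • (0 : α →ₘ[μ] ℂ) = 0 from smul_zero (M := ℂ) (A := α →ₘ[μ] ℂ) a, hB0]
      exact (smul_zero (M := ℂ) (A := ℂ → α →ₘ[μ] ℂ) a).symm
    · have haf : a • f ≠ 0 := fun h => (smul_eq_zero.1 h).elim ha hf0
      have hrr : r (a • f) = r f := by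
        have : Quotient.mk S (a • f) = Quotient.mk S f :=
          (Quotient.sound (⟨a, ha, rfl⟩ : S.r f (a • f))).symm
        simp only [r, this]
      have hr0 : r f ≠ 0 := fun h => hf0 (by
        rw [hc f, h]; exact smul_zero (M := ℂ) (A := α →ₘ[μ] ℂ) _)
      have hcc : c (a • f) = a * c f := by
        have h1 := hc (a • f)
        rw [hrr] at h1
        have h2 : (a * c f) • r f = c (a • f) • r f := by
          rw [← h1, show (a * c f) • r f = a • (c f • r f) from mul_smul a (c f) (r f), ← hc f]
        exact (smul_left_injective ℂ hr0 h2).symm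
      rw [hBne _ haf, hBne _ hf0, hrr, hcc]
      exact mul_smul a (c f) (G (r f))
  · by_cases hf0 : f = 0
    · subst hf0
      rw [hB0]
      have hΩ0 : Ω 0 = 0 := by
        have := hΩ 0 0 hf
        rw [show (0 : ℂ) • (0 : α →ₘ[μ] ℂ) = 0 from zero_smul ℂ (0 : α →ₘ[μ] ℂ)] at this
        rw [this]
        exact zero_smul ℂ (Ω 0)
      refine ⟨MemCalderon.zero h₀ h₁, rfl, (calderonNorm_le (fun _ => h₀.map_zero.le)
        fun _ => h₁.map_zero.le).trans zero_le, ?_⟩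
      rw [hΩ0]
      have := (hG4 0 hf).const_smul hs 0
      rw [hΩ0, show (0 : ℂ) • (0 : α →ₘ[μ] ℂ) = 0 from zero_smul ℂ (0 : α →ₘ[μ] ℂ)] at this
      exact this.congr (Eventually.of_forall fun w => zero_smul ℂ (G 0 w))
    · have hrf := hrfin f hf
      rw [hBne f hf0]
      refine ⟨(hG1 _ hrf).const_smul h₀ h₁ _, ?_, ?_, ?_⟩
      · rw [Pi.smul_apply, hG2 _ hrf, ← hc f]
      · refine (calderonNorm_smul_le h₀.isSolid h₁.isSolid (ψ := fun _ => c f)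
          fun _ _ => le_rfl).trans ((mul_le_mul_right (hG3 _ hrf) _).trans_eq ?_)
        conv_rhs => rw [hc f, hI.smul]
        ring
      · have := (hG4 _ hrf).const_smul hs (c f)
        rwa [← hΩ _ _ hrf, ← hc f] at this

end differential

theorem kaltonPeck_smul (p : ℝ) (c : ℂ) (f : α →ₘ[μ] ℂ) (hp : 1 ≤ p) :
    kaltonPeck p (c • f) = c • kaltonPeck p f := by
  have hN := normLp_isSolid (μ := μ) (ENNReal.ofReal p) (ENNReal.one_le_ofReal.2 hp)
  apply AEEqFun.ext
  filter_upwards [coeFn_kaltonPeck p f, coeFn_kaltonPeck p (c • f), AEEqFun.coeFn_smul c f,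
    AEEqFun.coeFn_smul c (kaltonPeck p f)] with x h1 h2 h3 h4
  rw [h2, h4, Pi.smul_apply, h1, h3, Pi.smul_apply, hN.smul, norm_smul, smul_eq_mul, smul_eq_mul,
    ENNReal.toReal_mul, toReal_enorm]
  by_cases hc : c = 0
  · simp [hc]
  · rw [mul_div_mul_left _ _ (norm_ne_zero_iff.2 hc)]
    ring

/-- The difference of the two functions vanishes at `1/2`, so the derivative bound in
`exists_normLp_two_bound` applies to it. -/
theorem exists_normLp_two_sub_le [SigmaFinite μ] {N : ExtNorm μ} (h : IsKothe N)
    (hA : Ample μ fun E => MemInd N E ∧ MemInd (dual N) E) :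
    ∃ K : ℝ≥0, ∀ F G D E, MemCalderon N (dual N) F → MemCalderon N (dual N) G →
      calderonNorm N (dual N) F ≠ ∞ → calderonNorm N (dual N) G ≠ ∞ →
      F (1 / 2 : ℝ) = G (1 / 2 : ℝ) → HasDerivIn (sumNorm N (dual N)) F (1 / 2 : ℝ) D →
      HasDerivIn (sumNorm N (dual N)) G (1 / 2 : ℝ) E →
      normLp μ 2 (D - E) ≤ K * (calderonNorm N (dual N) F + calderonNorm N (dual N) G) := by
  have hd := dual_isKothe h.isSolid (hA.mono fun _ hE => hE.1)
  obtain ⟨K, hK⟩ := exists_normLp_two_bound h hA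
  refine ⟨K, fun F G D E hF hG hFt hGt hFG hD hE => ?_⟩
  have hle : calderonNorm N (dual N) (fun z => F z - G z)
      ≤ calderonNorm N (dual N) F + calderonNorm N (dual N) G :=
    calderonNorm_le
      (fun t => (h.isSolid.sub_le _ _).trans
        (add_le_add (le_calderonNorm_left t) (le_calderonNorm_left t)))
      (fun t => (hd.isSolid.sub_le _ _).trans
        (add_le_add (le_calderonNorm_right t) (le_calderonNorm_right t)))
  refine ((hK _ (hF.sub h hd hG) (ne_top_of_le_ne_top (ENNReal.add_ne_top.2 ⟨hFt, hGt⟩) hle)).2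
    _ (sub_eq_zero.2 hFG) (hD.sub (sumNorm_isSolid h hd) hE)).trans ?_
  gcongr

theorem Piece.eq {N₀ N₁ : ExtNorm μ} {f D : α →ₘ[μ] ℂ} {c : ℝ≥0∞} {F : ℂ → α →ₘ[μ] ℂ}
    (hF : Piece N₀ N₁ f c Set.univ F D) : F (1 / 2 : ℝ) = f := by
  apply AEEqFun.ext
  filter_upwards [hF.value] with x hx
  exact hx trivial

/-- Only the inclusion of `L₂` depends on `H`; the other one holds for every space with enough test
sets, by `exists_normLp_two_bound`. -/
theorem sameSpace_of_pieces [SigmaFinite μ] {N : ExtNorm μ} (h : IsKothe N)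
    (hA : Ample μ fun E => MemInd N E ∧ MemInd (dual N) E) {K : ℝ≥0}
    (H : ∀ f, f ≠ 0 → normLp μ 2 f ≠ ∞ → ∃ F D,
      Piece N (dual N) f (K * normLp μ 2 f) Set.univ F D) :
    SameSpace (interp N (dual N) (1 / 2)) (normLp μ 2) := by
  have hd := dual_isKothe h.isSolid (hA.mono fun _ hE => hE.1)
  have hI := interp_isSolid h hd (θ := 1 / 2) (by norm_num) (by norm_num)
  obtain ⟨K₂, hK₂⟩ := exists_normLp_two_bound h hA
  have hC : ((K + K₂ + 1 : ℝ≥0) : ℝ≥0∞) ≠ 0 := by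
    rw [Ne, ENNReal.coe_eq_zero]; positivity
  refine ⟨K + K₂ + 1, by positivity, fun f => ⟨?_, ?_⟩⟩
  · by_cases hf0 : f = 0
    · rw [hf0, hI.map_zero]; exact zero_le
    by_cases hf : normLp μ 2 f = ∞
    · rw [hf, ENNReal.mul_top hC]; exact le_top
    obtain ⟨F, D, hF⟩ := H f hf0 hf
    have h1 := interp_le (s := 1 / 2) hF.mem
    rw [hF.eq] at h1
    refine (h1.trans hF.norm_le).trans ?_
    gcongr
    rw [add_assoc]
    exact le_self_add
  · rw [mul_comm, ← ENNReal.div_le_iff hC ENNReal.coe_ne_top]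
    refine le_interp fun F hF hFf => ?_
    rw [ENNReal.div_le_iff hC ENNReal.coe_ne_top, mul_comm]
    by_cases hfin : calderonNorm N (dual N) F = ∞
    · rw [hfin, ENNReal.mul_top hC]; exact le_top
    have h1 := (hK₂ F hF hfin).1
    rw [hFf] at h1
    refine h1.trans ?_
    gcongr
    rw [add_right_comm]
    exact le_add_self

/-- Two differentials of a pair `(N, N^*)` with `[N, N^*]_{1/2} = L₂` are boundedly equivalent. -/
theorem IsDifferential.boundedlyEquivalent [SigmaFinite μ] {N : ExtNorm μ} (h : IsKothe N)
    (hN : SameSpace (interp N (dual N) (1 / 2)) (normLp μ 2))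
    {Ω Ψ : (α →ₘ[μ] ℂ) → (α →ₘ[μ] ℂ)} (hΩ : IsDifferential N (dual N) (1 / 2) Ω)
    (hΨ : IsDifferential N (dual N) (1 / 2) Ψ) : BoundedlyEquivalent (normLp μ 2) Ω Ψ := by
  obtain ⟨K, hK⟩ := exists_normLp_two_sub_le h (ample_and_of_sameSpace h hN)
  obtain ⟨C, -, hC⟩ := hN
  obtain ⟨B, K₁, -, hB⟩ := hΩ
  obtain ⟨B', K₂, -, hB'⟩ := hΨ
  refine ⟨K * ((K₁ + K₂) * C), fun f hf => ?_⟩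
  have hfin : interp N (dual N) (1 / 2) f < ∞ :=
    (hC f).1.trans_lt (ENNReal.mul_lt_top ENNReal.coe_lt_top hf)
  obtain ⟨h1, h2, h3, h4⟩ := hB f hfin
  obtain ⟨h1', h2', h3', h4'⟩ := hB' f hfin
  refine (hK _ _ _ _ h1 h1' (ne_top_of_le_ne_top (ENNReal.mul_ne_top ENNReal.coe_ne_top hfin.ne) h3)
    (ne_top_of_le_ne_top (ENNReal.mul_ne_top ENNReal.coe_ne_top hfin.ne) h3')
    (h2.trans h2'.symm) h4 h4').trans ?_
  push_cast
  rw [mul_assoc, mul_assoc]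
  gcongr
  refine (add_le_add h3 h3').trans ?_
  rw [← add_mul]
  gcongr
  exact (hC f).1

/-- A bounded function on the strip with a simple zero of derivative `1` at `1 / 2`. -/
theorem exists_bounded_simple_zero : ∃ ψ : ℂ → ℂ, DiffContOnCl ℂ ψ strip ∧
    (∀ z ∈ closedStrip, ‖ψ z‖ ≤ 3) ∧ ψ (1 / 2 : ℝ) = 0 ∧ HasDerivAt ψ 1 (1 / 2 : ℝ) := by
  have hne : ∀ z : ℂ, 0 ≤ z.re → z + 1 ≠ 0 := by
    intro z hz h
    have := congrArg Complex.re h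
    simp at this
    linarith
  have hder : ∀ z : ℂ, 0 ≤ z.re → HasDerivAt (fun z : ℂ => 3 / 2 * ((z - 1 / 2) / (z + 1)))
      (3 / 2 * ((1 * (z + 1) - (z - 1 / 2) * 1) / (z + 1) ^ 2)) z := fun z hz =>
    ((((hasDerivAt_id z).sub_const _).div ((hasDerivAt_id z).add_const 1) (hne z hz)).const_mul _)
  -- The pole `-1` is off the strip, and the factor `3 / 2 = 1 / 2 + 1` normalises the derivative.
  refine ⟨fun z => 3 / 2 * ((z - 1 / 2) / (z + 1)), ?_, ?_, ?_, ?_⟩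
  · refine ⟨fun z hz => (hder z hz.1.le).differentiableAt.differentiableWithinAt, ?_⟩
    rw [closure_strip]
    exact fun z hz => (hder z hz.1).continuousAt.continuousWithinAt
  · intro z hz
    have h1 : 1 ≤ ‖z + 1‖ := by
      refine le_trans ?_ (Complex.re_le_norm _)
      simp [hz.1]
    have h2 : ‖z - 1 / 2‖ ≤ 2 * ‖z + 1‖ := by
      rw [show z - 1 / 2 = (z + 1) - 3 / 2 by ring]
      refine le_trans ?_ (le_mul_of_one_le_left (norm_nonneg _) one_le_two)
      rw [Complex.norm_def, Complex.norm_def]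
      refine Real.sqrt_le_sqrt ?_
      have e1 : ((3 : ℂ) / 2).re = 3 / 2 := by norm_num
      have e2 : ((3 : ℂ) / 2).im = 0 := by norm_num
      simp only [Complex.normSq_apply, Complex.sub_re, Complex.sub_im, Complex.add_re,
        Complex.one_re, Complex.add_im, Complex.one_im, e1, e2]
      nlinarith [hz.1]
    rw [norm_mul, norm_div (z - 1 / 2)]
    have : ‖(3 / 2 : ℂ)‖ = 3 / 2 := by norm_num
    rw [this]
    have := (div_le_iff₀ (by linarith : 0 < ‖z + 1‖)).2 h2
    linarith
  · norm_num
  · convert hder (1 / 2 : ℝ) (by norm_num) using 1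
    push_cast
    norm_num

/-- The pair `(Y, Y^*)` has `L₂` as its midpoint, and functions in its Calderón space with
derivative `(1 - θ) Ω f + θ KP₂ f` at `1 / 2` exist with control of norms. -/
theorem IsScaling.sameSpace_and_isDifferential [SigmaFinite μ] {N Y : ExtNorm μ} {θ : ℝ}
    {C : ℝ≥0} (hY : IsScaling N Y θ C) (h : IsKothe N)
    (hN : SameSpace (interp N (dual N) (1 / 2)) (normLp μ 2)) (t0 : 0 < θ) (t1 : θ < 1)
    {Ω : (α →ₘ[μ] ℂ) → (α →ₘ[μ] ℂ)} (hΩ : IsDifferential N (dual N) (1 / 2) Ω) :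
    SameSpace (interp Y (dual Y) (1 / 2)) (normLp μ 2) ∧
      IsDifferential Y (dual Y) (1 / 2)
        (fun f => ((1 - θ : ℝ) : ℂ) • Ω f + (θ : ℂ) • kaltonPeck 2 f) := by
  have hA := ample_and_of_sameSpace h hN
  have hAY := hY.ample h.isSolid t0 t1 hA
  have hdN := dual_isKothe h.isSolid (hA.mono fun _ hE => hE.1)
  have hdY := dual_isKothe hY.isKothe.isSolid (hAY.mono fun _ hE => hE.1)
  have h2 := normLp_isSolid (μ := μ) 2 one_le_two
  have hsY := sumNorm_isSolid hY.isKothe hdY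
  obtain ⟨K, hK⟩ := hY.exists_link h hdN hdY t0 t1 hN
  have hYN : SameSpace (interp Y (dual Y) (1 / 2)) (normLp μ 2) :=
    sameSpace_of_pieces hY.isKothe hAY (K := K) fun f hf0 hf => by
      obtain ⟨_, _, G, E, -, hG, -⟩ := hK f hf0 hf
      exact ⟨G, E, hG⟩
  refine ⟨hYN, ?_⟩
  obtain ⟨K₁, hK₁⟩ := exists_normLp_two_sub_le h hA
  obtain ⟨CN, -, hCN⟩ := hN
  obtain ⟨CY, -, hCY⟩ := hYN
  have hfinN : ∀ f, normLp μ 2 f < ∞ → interp N (dual N) (1 / 2) f < ∞ := fun f hf =>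
    (hCN f).1.trans_lt (ENNReal.mul_lt_top ENNReal.coe_lt_top hf)
  have hfin2 : ∀ f, interp Y (dual Y) (1 / 2) f < ∞ → normLp μ 2 f < ∞ := fun f hf =>
    (hCY f).2.trans_lt (ENNReal.mul_lt_top ENNReal.coe_lt_top hf)
  have hIY := interp_isSolid hY.isKothe hdY (θ := 1 / 2) (by norm_num) (by norm_num)
  set Ψ : (α →ₘ[μ] ℂ) → (α →ₘ[μ] ℂ) :=
    fun f => ((1 - θ : ℝ) : ℂ) • Ω f + (θ : ℂ) • kaltonPeck 2 f with hΨdef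
  have hΨ : ∀ (c : ℂ) f, interp Y (dual Y) (1 / 2) f < ∞ → Ψ (c • f) = c • Ψ f := by
    intro c f hf
    simp only [hΨdef]
    rw [hΩ.smul_eq h hdN (by norm_num) (by norm_num) c (hfinN f (hfin2 f hf)),
      kaltonPeck_smul 2 c f one_le_two,
      show ((1 - θ : ℝ) : ℂ) • c • Ω f = c • ((1 - θ : ℝ) : ℂ) • Ω f from smul_comm _ _ _,
      show (θ : ℂ) • c • kaltonPeck 2 f = c • (θ : ℂ) • kaltonPeck 2 f from smul_comm _ _ _]
    exact (smul_add c _ _).symm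
  have hΨ0 : Ψ 0 = 0 := by
    have h0 : interp Y (dual Y) (1 / 2) 0 < ∞ := by rw [hIY.map_zero]; exact ENNReal.zero_lt_top
    have := hΨ 0 0 h0
    rw [show (0 : ℂ) • (0 : α →ₘ[μ] ℂ) = 0 from
      zero_smul ℂ (0 : α →ₘ[μ] ℂ)] at this
    rw [this]
    exact zero_smul ℂ (Ψ 0)
  obtain ⟨ψ, hψd, hψb, hψ0, hψ1⟩ := exists_bounded_simple_zero
  have hψb' : ∀ z ∈ closedStrip, ‖ψ z‖ₑ ≤ 3 := fun z hz => by
    rw [← ofReal_norm]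
    exact (ENNReal.ofReal_le_ofReal (hψb z hz)).trans_eq (ENNReal.ofReal_ofNat 3)
  obtain ⟨B, KΩ, -, hB⟩ := hΩ
  -- The first summand compares `Ω f` with the derivative of the explicit function having the same
  -- value `f`; the second is the error in `IsScaling.exists_link`.
  set e₀ : ℝ≥0 := K₁ * (KΩ * CN + K) + K with he₀
  have herr : ∀ f D E F, normLp μ 2 f ≠ ∞ → Piece N (dual N) f (K * normLp μ 2 f) Set.univ F D →
      normLp μ 2 (E - (((1 - θ : ℝ) : ℂ) • D + (θ : ℂ) • kaltonPeck 2 f)) ≤ K * normLp μ 2 f →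
      normLp μ 2 (Ψ f - E) ≤ e₀ * normLp μ 2 f := by
    intro f D E F hf hF hE
    have hfi := hfinN f hf.lt_top
    obtain ⟨b1, b2, b3, b4⟩ := hB f hfi
    have hd := hK₁ _ _ _ _ b1 hF.mem
      (ne_top_of_le_ne_top (ENNReal.mul_ne_top ENNReal.coe_ne_top hfi.ne) b3)
      (ne_top_of_le_ne_top (ENNReal.mul_ne_top ENNReal.coe_ne_top hf) hF.norm_le)
      (b2.trans hF.eq.symm) b4 hF.deriv
    have hd' : normLp μ 2 (Ω f - D) ≤ (K₁ * (KΩ * CN + K) : ℝ≥0) * normLp μ 2 f := by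
      refine hd.trans ?_
      push_cast
      rw [mul_assoc]
      gcongr
      rw [add_mul, mul_assoc]
      exact add_le_add (b3.trans (mul_le_mul_right (hCN f).1 _)) hF.norm_le
    have e : Ψ f - E = ((1 - θ : ℝ) : ℂ) • (Ω f - D)
        - (E - (((1 - θ : ℝ) : ℂ) • D + (θ : ℂ) • kaltonPeck 2 f)) := by
      simp only [hΨdef]
      rw [show ((1 - θ : ℝ) : ℂ) • (Ω f - D) = ((1 - θ : ℝ) : ℂ) • Ω f - ((1 - θ : ℝ) : ℂ) • D from
        smul_sub _ _ _]
      abel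
    have hθ : ‖((1 - θ : ℝ) : ℂ)‖ₑ ≤ 1 := by
      rw [← ofReal_norm, Complex.norm_real, Real.norm_of_nonneg (by linarith)]
      exact ENNReal.ofReal_le_one.2 (by linarith)
    rw [e]
    refine (h2.sub_le _ _).trans ?_
    rw [h2.smul, he₀, ENNReal.coe_add, add_mul]
    exact add_le_add ((mul_le_of_le_one_left' hθ).trans hd') hE
  refine isDifferential_of_smul_eq hY.isKothe hdY (by norm_num) (by norm_num) hΨ
    (K := (K + 3 * (K * e₀)) * CY) fun f hf => ?_
  have hf2 := hfin2 f hf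
  by_cases hf0 : f = 0
  · subst hf0
    refine ⟨fun _ => 0, MemCalderon.zero hY.isKothe hdY, rfl,
      (calderonNorm_le (fun _ => hY.isKothe.map_zero.le) fun _ => hdY.map_zero.le).trans zero_le, ?_⟩
    rw [hΨ0]
    obtain ⟨D, hD⟩ := (MemCalderon.zero hY.isKothe hdY).analytic _ half_mem_strip
    have := hD.const_smul hsY 0
    rw [show (0 : ℂ) • D = 0 from zero_smul ℂ D] at this
    exact this.congr (Eventually.of_forall fun w => zero_smul ℂ (0 : α →ₘ[μ] ℂ))
  obtain ⟨F, D, G, E, hF, hG, hE⟩ := hK f hf0 hf2.ne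
  have hdiff := herr f D E F hf2.ne hF hE
  -- The error in the derivative lies in `L₂`, hence is itself the value at `1/2` of a function of
  -- Calderón's space.
  have hH : ∃ H, MemCalderon Y (dual Y) H ∧ H (1 / 2 : ℝ) = Ψ f - E ∧
      calderonNorm Y (dual Y) H ≤ K * normLp μ 2 (Ψ f - E) := by
    by_cases h0 : Ψ f - E = 0
    · exact ⟨fun _ => 0, MemCalderon.zero hY.isKothe hdY, h0.symm,
        (calderonNorm_le (fun _ => hY.isKothe.map_zero.le) fun _ => hdY.map_zero.le).trans zero_le⟩
    · obtain ⟨_, _, H, E', -, hH, -⟩ := hK _ h0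
        (ne_top_of_le_ne_top (ENNReal.mul_ne_top ENNReal.coe_ne_top hf2.ne) hdiff)
      exact ⟨H, hH.mem, hH.eq, hH.norm_le⟩
  obtain ⟨H, hHm, hHv, hHn⟩ := hH
  have hψH : MemCalderon Y (dual Y) (fun z => ψ z • H z) := hHm.smul_fun hY.isKothe hdY hψd hψb
  -- The added term is `0` at `1/2` and has derivative `Ψ f - E` there, so the sum has value `f` and
  -- derivative exactly `Ψ f`.
  refine ⟨fun z => G z + ψ z • H z, hG.mem.add hY.isKothe hdY hψH, ?_, ?_, ?_⟩
  · simp only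
    rw [hψ0, hG.eq, show (0 : ℂ) • H (1 / 2 : ℝ) = 0 from zero_smul ℂ (H _), add_zero]
  · calc calderonNorm Y (dual Y) (fun z => G z + ψ z • H z)
        ≤ calderonNorm Y (dual Y) G + calderonNorm Y (dual Y) (fun z => ψ z • H z) :=
          calderonNorm_add_le hY.isKothe.isSolid hdY.isSolid
      _ ≤ K * normLp μ 2 f + 3 * (K * (e₀ * normLp μ 2 f)) := by
          refine add_le_add hG.norm_le ((calderonNorm_smul_le hY.isKothe.isSolid hdY.isSolid
            hψb').trans ?_)
          gcongr
          exact hHn.trans (by gcongr)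
      _ = (K + 3 * (K * e₀)) * normLp μ 2 f := by ring
      _ ≤ ((K + 3 * (K * e₀)) * CY : ℝ≥0) * interp Y (dual Y) (1 / 2) f := by
          push_cast
          rw [mul_assoc _ (CY : ℝ≥0∞)]
          gcongr
          exact (hCY f).2
  · have h3 := hG.deriv.add hsY (hHm.hasDerivIn_smul hsY half_mem_strip hψ1 hψ0)
    rwa [hHv, show (1 : ℂ) • (Ψ f - E) = Ψ f - E from one_smul ℂ _, add_sub_cancel] at h3

end Kothe

end

theorem mainTheorem4 {α : Type*} [MeasurableSpace α] (μ : MeasureTheory.Measure α)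
    [MeasureTheory.SigmaFinite μ] (X : Kothe.ExtNorm μ) (hX : Kothe.IsKothe X)
    (hX2 : Kothe.SameSpace (Kothe.interp X (Kothe.dual X) (1 / 2)) (Kothe.normLp μ 2))
    (Ω : (α →ₘ[μ] ℂ) → (α →ₘ[μ] ℂ))
    (hΩ : Kothe.IsDifferential X (Kothe.dual X) (1 / 2) Ω)
    (θ : ℝ) (hθ0 : 0 < θ) (hθ1 : θ < 1)
    (Y : Kothe.ExtNorm μ)
    (hY : Y = Kothe.interp X (Kothe.normLp μ ∞) θ ∨ Y = Kothe.convexification (1 / (1 - θ)) X) :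
    Kothe.SameSpace (Kothe.interp Y (Kothe.dual Y) (1 / 2)) (Kothe.normLp μ 2) ∧
    Kothe.IsDifferential Y (Kothe.dual Y) (1 / 2)
      (fun f => ((1 - θ : ℝ) : ℂ) • Ω f + (θ : ℂ) • Kothe.kaltonPeck 2 f) ∧
    ∀ Ψ : (α →ₘ[μ] ℂ) → (α →ₘ[μ] ℂ),
      Kothe.IsDifferential Y (Kothe.dual Y) (1 / 2) Ψ →
      Kothe.BoundedlyEquivalent (Kothe.normLp μ 2) Ψ
        (fun f => ((1 - θ : ℝ) : ℂ) • Ω f + (θ : ℂ) • Kothe.kaltonPeck 2 f) := by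
  -- The two choices of `Y` are distinguished only here.
  obtain ⟨C, hC⟩ : ∃ C, Kothe.IsScaling X Y θ C := by
    rcases hY with rfl | rfl
    · exact Kothe.exists_isScaling_interp hX (Kothe.ample_and_of_sameSpace hX hX2) hθ0 hθ1
    · exact ⟨1, Kothe.isScaling_convexification hX hθ0 hθ1⟩
  obtain ⟨h1, h2⟩ := hC.sameSpace_and_isDifferential hX hX2 hθ0 hθ1 hΩ
  exact ⟨h1, h2, fun Ψ hΨ => hΨ.boundedlyEquivalent hC.isKothe h1 h2⟩
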